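/- Let $n\ge 1$ and let $D=\{z\in\mathbb C:|z|\le 2\}$. Let $E$ be a compact $(2n+2)$-dimensional manifold with corners and $X$ a compact connected $2n$-dimensional manifold with boundary. An exact symplectic manifold is a compact manifold with a $1$-form $\alpha$ such that $d\alpha$ is symplectic and such that the Liouville vector field $\chi$, $\iota_\chi d\alpha=\alpha$, is transverse to (every face of) the boundary and points outward there. Let $(\pi,E,\omega_0=d\alpha_0,\alpha_0)$ be an exact Lefschetz fibration over $D$ with regular fibre $X$. That is, $\pi:E\to D$ is smooth with finite critical set $C$, which lies in the interior of $E$; $\pi$ is injective on $C$; near $C$ and $\pi(C)$ there are integrable complex structures $J_0$ on $E$ and $j_0$ (positively oriented) on $D$ for which $\omega_0$ is Kähler, $\pi$ is holomorphic and has nondegenerate complex Hessian at each point of $C$; over $D\setminus\pi(C)$ the map $\pi$ is a smooth fibre bundle with fibre $X$, whose fibres $E_z=\pi^{-1}(z)$ with $\alpha_0|_{E_z}$ are exact symplectic manifolds; and near the horizontal boundary $\partial_hE=\bigcup_z\partial E_z$ over $D\setminus\pi(C)$ the triple $(\pi,\omega_0,\alpha_0)$ is isomorphic, by a fibre-preserving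 diffeomorphism that is the identity on one fibre $E_{z_0}$, to the product fibration with fibre $E_{z_0}$ and the forms pulled back from $E_{z_0}$. Let $(E,\omega=d\alpha,\alpha,\chi)$ be an exact symplectic manifold that is compatible with the fibration: $\omega=\omega_0+\pi^*\omega_D$ for a positive area form $\omega_D$ on $D$, and $\omega$ tames an almost complex structure $J$ on $E$ that extends $J_0$ near $C$, such that $\pi$ is $(J,j)$-holomorphic for a positively oriented complex structure $j$ on $D$ extending $j_0$ near $\pi(C)$, and such that $\omega_0(\cdot,J\cdot)$ is symmetric and positive definite on $\ker d\pi$. Assume that $0$ is a regular value of $\pi$. The open book on $\partial E$ induced by $\pi$ has binding $B=\partial E_0=\partial E\cap\pi^{-1}(0)$ and fibration $f=\pi/|\pi|:\partial E\setminus B\to S^1$. Its pages $f^{-1}(t)$ consist of the fibre $E_{2t}$ in the vertical boundary $\pi^{-1}(\partial D)$ and the part of $f^{-1}(t)$ in the rest of $\partial E$ (the horizontal boundary), and are smooth on each face of $\partial E$. Then this open book carries the contact structure $\ker(\alpha|_{\partial E})$ in Giroux's sense. Precisely: 1. $\alpha$ restricts to a contact form on every face of $\partial E$. 2. $d\alpha$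 is symplectic on every regular fibre of $\pi$, in particular on the part $E_{2t}$ of each page. Moreover $\alpha|_{TB}$ is a contact form, and the orientation of $B$ given by $\alpha\wedge(d\alpha)^{n-1}$ is its orientation as the boundary of $(E_0,d\alpha)$. 3. There is a smooth function $g:E\to(0,\infty)$, equal to $1$ on $\pi^{-1}(\partial D)$, such that the contact form $\beta=g\alpha$ of the same contact structure satisfies: (i) $\beta|_{TB}$ is a contact form; (ii) $d\beta$ is symplectic on every page $f^{-1}(t)$, $t\in S^1$ (on each of its smooth pieces up to the corners, with orientations that agree along the corners); (iii) the orientation of $B$ given by $\beta\wedge(d\beta)^{n-1}$ is its orientation as the boundary of the closure of each page oriented by $(d\beta)^n$. -/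

import Mathlib

open Set Filter Topology Manifold
open scoped ContDiff ComplexConjugate Bundle

namespace ExactLefschetz

/-! ### Differential forms on manifolds with corners -/

section Forms

variable {V H M : Type*} [NormedAddCommGroup V] [NormedSpace ℝ V] [TopologicalSpace H]
  (I : ModelWithCorners ℝ V H) [TopologicalSpace M] [ChartedSpace H M]

/-- A (not necessarily smooth) `1`-form on `M`. -/
noncomputable abbrev OneForm (M : Type*) [TopologicalSpace M] [ChartedSpace H M] : Type _ :=
  ∀ p : M, TangentSpace I p →L[ℝ] ℝ

variable {I}

/-- The `1`-form `a` is smooth, as a section of the cotangent bundle. -/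
def OneForm.IsSmooth [IsManifold I ∞ M] (a : OneForm I M) : Prop :=
  ContMDiff I (I.prod 𝓘(ℝ, V →L[ℝ] ℝ)) ∞
    (fun p ↦ Bundle.TotalSpace.mk' (V →L[ℝ] ℝ)
      (E := fun p : M ↦ TangentSpace I p →L[ℝ] ℝ) p (a p))

/-- The `1`-form `a` read in the preferred chart at `p`: the pull-back of `a` by the inverse of
this chart, a `1`-form on a part of the model space. -/
noncomputable def OneForm.inChart (a : OneForm I M) (p : M) (x : V) : V →L[ℝ] ℝ :=
  (a ((extChartAt I p).symm x)).comp
    (mfderivWithin 𝓘(ℝ, V) I (extChartAt I p).symm (range I) x)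

/-- The exterior derivative of a `1`-form at `p`, computed in the preferred chart at `p`
(in Mathlib the tangent space at `p` is the model space, read in that chart):
`(da)_p (u, v) = D_u a (v) - D_v a (u)`. -/
noncomputable def OneForm.d (a : OneForm I M) (p : M) (u v : TangentSpace I p) : ℝ :=
  let D : V →L[ℝ] V →L[ℝ] ℝ := fderivWithin ℝ (a.inChart p) (range I) (extChartAt I p p)
  D u v - D v u

/-- The product of a function and a `1`-form. -/
noncomputable def OneForm.mulFun (g : M → ℝ) (a : OneForm I M) : OneForm I M := fun p ↦ g p • a p

/-- The pull-back of a `1`-form by a map `f`. -/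
noncomputable def OneForm.pullback {V' H' M' : Type*} [NormedAddCommGroup V'] [NormedSpace ℝ V']
    [TopologicalSpace H'] {I' : ModelWithCorners ℝ V' H'} [TopologicalSpace M']
    [ChartedSpace H' M'] (f : M' → M) (a : OneForm I M) : OneForm I' M' :=
  fun x ↦ (a (f x)).comp (mfderiv I' I f x)

/-- The tangent vector `v` at `p` is transverse to every boundary face through `p` and points out
of the manifold: in the chart, moving from `p` in the direction `-v` leads into the interior. -/
def PointsOutward (p : M) (v : TangentSpace I p) : Prop :=
  ∀ᶠ t : ℝ in 𝓝[>] 0, extChartAt I p p - t • (show V from v) ∈ interior (range I)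

/-- `(M, da, a, χ)` is an exact symplectic manifold: `da` is symplectic and `χ`, the
vector field with `ι_χ da = a` (hence a Liouville vector field), is transverse to the boundary and
points outward there, so that the boundary is convex and `a` restricts to a contact form on it. -/
structure IsExactSymplectic [IsManifold I ∞ M] (a : OneForm I M)
    (χ : ∀ p : M, TangentSpace I p) : Prop where
  smooth : a.IsSmooth
  nondegenerate : ∀ (p : M) (u : TangentSpace I p), (∀ v, a.d p u v = 0) → u = 0
  liouville : ∀ (p : M) (v : TangentSpace I p), a.d p (χ p) v = a p v
  outward : ∀ p ∈ I.boundary M, PointsOutward p (χ p)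

end Forms

/-! ### Linear algebra -/

section LinearAlgebra

variable {V : Type*} [AddCommGroup V] [Module ℝ V]

/-- The restriction of `w` to the `2k`-dimensional subspace `T` is a symplectic form. -/
def IsSymplecticOn (k : ℕ) (T : Submodule ℝ V) (w : V → V → ℝ) : Prop :=
  Module.finrank ℝ T = 2 * k ∧ ∀ x ∈ T, (∀ y ∈ T, w x y = 0) → x = 0

/-- On the `(2k+1)`-dimensional subspace `T` the pair `(a, w)`, `w = da`, satisfies the contact
condition `a ∧ w^k ≠ 0`: `a` is not zero on `T`, and `w` is nondegenerate on `T ∩ ker a`. -/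
def IsContactOn (k : ℕ) (T : Submodule ℝ V) (a : V → ℝ) (w : V → V → ℝ) : Prop :=
  Module.finrank ℝ T = 2 * k + 1 ∧ (∃ x ∈ T, a x ≠ 0) ∧
    ∀ x ∈ T, a x = 0 → (∀ y ∈ T, a y = 0 → w x y = 0) → x = 0

/-- The value of the exterior power `w^k` of a `2`-form on `2k` vectors, up to the positive
factor `2^k` (only its sign is used). -/
def wedgePow (k : ℕ) (w : V → V → ℝ) (e : Fin (2 * k) → V) : ℝ :=
  ∑ s : Equiv.Perm (Fin (2 * k)), ((Equiv.Perm.sign s : ℤ) : ℝ) *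
    ∏ i : Fin k, w (e (s ⟨2 * i, by omega⟩)) (e (s ⟨2 * i + 1, by omega⟩))

/-- The value of `a ∧ w^k` on `2k+1` vectors, for a `1`-form `a` and a `2`-form `w`, up to the
positive factor `2^k` (only its sign is used). -/
def contactVol (k : ℕ) (a : V → ℝ) (w : V → V → ℝ) (e : Fin (2 * k + 1) → V) : ℝ :=
  ∑ s : Equiv.Perm (Fin (2 * k + 1)), ((Equiv.Perm.sign s : ℤ) : ℝ) *
    (a (e (s 0)) * ∏ i : Fin k, w (e (s ⟨2 * i + 1, by omega⟩)) (e (s ⟨2 * i + 2, by omega⟩)))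

end LinearAlgebra

/-! ### Manifolds with corners and maps to the disk -/

/-- The model `[0,∞)^d` of a `d`-dimensional manifold with corners. -/
abbrev Cor (d : ℕ) := modelWithCornersEuclideanQuadrant d

/-- The base: the closed disk of radius `2` in `ℂ`. -/
abbrev disk : Set ℂ := Metric.closedBall 0 2

section Corners

variable {d : ℕ} {E : Type*} [TopologicalSpace E] [ChartedSpace (EuclideanQuadrant d) E]

/-- The `i`-th coordinate of the preferred chart at `p` vanishes at `p`: near `p` its zero set is a
face of the boundary through `p`. All faces through `p` arise in this way, once each. -/
def IsFace (p : E) (i : Fin d) : Prop := (extChartAt (Cor d) p p) i = 0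

/-- The differential at `p` of the `i`-th coordinate of the preferred chart at `p`. -/
noncomputable def dcoord (p : E) (i : Fin d) : TangentSpace (Cor d) p →L[ℝ] ℝ :=
  (EuclideanSpace.proj i : EuclideanSpace ℝ (Fin d) →L[ℝ] ℝ)

/-- The tangent space at `p` of the face `i` of the boundary. -/
noncomputable def faceTangent (p : E) (i : Fin d) : Submodule ℝ (TangentSpace (Cor d) p) :=
  LinearMap.ker (dcoord p i).toLinearMap

/-- The differential of a map to `ℂ`. -/
noncomputable def dmap (pr : E → ℂ) (p : E) : TangentSpace (Cor d) p →L[ℝ] ℂ :=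
  mfderiv (Cor d) 𝓘(ℝ, ℂ) pr p

/-- The set of critical points. -/
def critSet (d : ℕ) {E : Type*} [TopologicalSpace E]
    [ChartedSpace (EuclideanQuadrant d) E] (pr : E → ℂ) : Set E := {p | ¬ Function.Surjective (dmap (d := d) pr p)}

/-- The regular part of the disk. -/
def regularBase (d : ℕ) {E : Type*} [TopologicalSpace E]
    [ChartedSpace (EuclideanQuadrant d) E] (pr : E → ℂ) : Set ℂ := disk \ (pr '' critSet d pr)

/-- The vertical tangent space; at points of a regular fibre it is the tangent space of
the fibre. -/
noncomputable def vert (pr : E → ℂ) (p : E) : Submodule ℝ (TangentSpace (Cor d) p) :=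
  LinearMap.ker (dmap pr p).toLinearMap

end Corners

/-! ### Exact Lefschetz fibrations -/

section Fibrations

variable {m : ℕ} {E X : Type*}
  [TopologicalSpace E] [ChartedSpace (EuclideanQuadrant (2 * m + 4)) E]
  [TopologicalSpace X] [ChartedSpace (EuclideanHalfSpace (2 * m + 2)) X]

/-- `Φ` and `Ψ` are a smooth trivialization of `pr` over the part of the disk in `U`, with
fibre `X`: `p ↦ (pr p, Ψ p)` is a diffeomorphism of the preimage onto `(U ∩ disk) × X`, with
inverse `Φ`. -/
structure IsTrivialization (m : ℕ) {E X : Type*}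
    [TopologicalSpace E] [ChartedSpace (EuclideanQuadrant (2 * m + 4)) E]
    [TopologicalSpace X] [ChartedSpace (EuclideanHalfSpace (2 * m + 2)) X] (pr : E → ℂ) (U : Set ℂ) (Φ : ℂ × X → E) (Ψ : E → X) : Prop where
  isOpen : IsOpen U
  smooth_toFun : ContMDiffOn (Cor (2 * m + 4)) (𝓡∂ (2 * m + 2)) ∞ Ψ (pr ⁻¹' U)
  smooth_inv : ContMDiffOn (𝓘(ℝ, ℂ).prod (𝓡∂ (2 * m + 2))) (Cor (2 * m + 4)) ∞ Φ
    ((U ∩ disk) ×ˢ univ)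
  left_inv : ∀ p, pr p ∈ U → Φ (pr p, Ψ p) = p
  right_inv : ∀ z ∈ U ∩ disk, ∀ x, pr (Φ (z, x)) = z ∧ Ψ (Φ (z, x)) = x

/-- The horizontal boundary over the regular part of the disk: the union of the
boundaries of the regular fibres. -/
def horizontalBoundary (m : ℕ) {E : Type*} (X : Type*) [TopologicalSpace E]
    [ChartedSpace (EuclideanQuadrant (2 * m + 4)) E] [TopologicalSpace X]
    [ChartedSpace (EuclideanHalfSpace (2 * m + 2)) X] (pr : E → ℂ) : Set E :=
  {p | pr p ∈ regularBase (2 * m + 4) pr ∧ ∃ (U : Set ℂ) (Φ : ℂ × X → E) (Ψ : E → X),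
    pr p ∈ U ∧ IsTrivialization m pr U Φ Ψ ∧ Ψ p ∈ (𝓡∂ (2 * m + 2)).boundary X}

/-- `(pr, E, da, a)`, restricted to the part over the regular values of `pr`, is an exact symplectic
fibration with fibre `X`. -/
structure IsExactSymplecticFibration [IsManifold (𝓡∂ (2 * m + 2)) ∞ X]
    (pr : E → ℂ) (a : OneForm (Cor (2 * m + 4)) E) : Prop where
  /-- `pr` is a smooth fibre bundle with fibre `X`. -/
  locally_trivial : ∀ z ∈ regularBase (2 * m + 4) pr, ∃ (U : Set ℂ) (Φ : ℂ × X → E) (Ψ : E → X),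
    z ∈ U ∧ IsTrivialization m pr U Φ Ψ
  /-- Each fibre, with the restriction of `a`, is an exact symplectic manifold. -/
  fibre_exact : ∀ z ∈ regularBase (2 * m + 4) pr, ∀ (U : Set ℂ) (Φ : ℂ × X → E) (Ψ : E → X),
    z ∈ U → IsTrivialization m pr U Φ Ψ →
    ∃ χ, IsExactSymplectic (I := 𝓡∂ (2 * m + 2)) (a.pullback (fun x ↦ Φ (z, x))) χ
  /-- Triviality near the horizontal boundary. The fibre over `z₀` is identified with `X` by
  `ι = Φ (z₀, ·)`. The fibre-preserving diffeomorphism `p ↦ (pr p, υ p)` from the neighbourhood `N`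
  of the horizontal boundary to a neighbourhood `O ∩ (regularBase (2 * m + 4) pr × X)` of the horizontal
  boundary of the trivial fibration has the inverse `Θ`. -/
  trivial_near_horizontal : ∃ (z₀ : ℂ) (U : Set ℂ) (Φ : ℂ × X → E) (Ψ : E → X),
    z₀ ∈ regularBase (2 * m + 4) pr ∧ z₀ ∈ U ∧ IsTrivialization m pr U Φ Ψ ∧
    ∃ (N : Set E) (O : Set (ℂ × X)) (υ : E → X) (Θ : ℂ × X → E),
      IsOpen N ∧ N ⊆ pr ⁻¹' regularBase (2 * m + 4) pr ∧ horizontalBoundary m X pr ⊆ N ∧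
      IsOpen O ∧ regularBase (2 * m + 4) pr ×ˢ (𝓡∂ (2 * m + 2)).boundary X ⊆ O ∧
      ContMDiffOn (Cor (2 * m + 4)) (𝓡∂ (2 * m + 2)) ∞ υ N ∧
      ContMDiffOn (𝓘(ℝ, ℂ).prod (𝓡∂ (2 * m + 2))) (Cor (2 * m + 4)) ∞ Θ
        (O ∩ regularBase (2 * m + 4) pr ×ˢ univ) ∧
      (∀ p ∈ N, (pr p, υ p) ∈ O ∧ Θ (pr p, υ p) = p) ∧
      (∀ z ∈ regularBase (2 * m + 4) pr, ∀ x, (z, x) ∈ O →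
        Θ (z, x) ∈ N ∧ pr (Θ (z, x)) = z ∧ υ (Θ (z, x)) = x) ∧
      (∀ p ∈ N, p ∈ horizontalBoundary m X pr ↔ υ p ∈ (𝓡∂ (2 * m + 2)).boundary X) ∧
      (∀ p ∈ N, pr p = z₀ → Φ (z₀, υ p) = p) ∧
      let f : E → E := fun p ↦ Φ (z₀, υ p)
      (∀ p ∈ N, ∀ v : TangentSpace (Cor (2 * m + 4)) p,
        a p v = a (f p) (mfderiv (Cor (2 * m + 4)) (Cor (2 * m + 4)) f p v)) ∧
      (∀ p ∈ N, ∀ u v : TangentSpace (Cor (2 * m + 4)) p,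
        a.d p u v = a.d (f p) (mfderiv (Cor (2 * m + 4)) (Cor (2 * m + 4)) f p u)
          (mfderiv (Cor (2 * m + 4)) (Cor (2 * m + 4)) f p v))

/-- Near the critical point `c`, the almost complex structures `J` on `E` and `j` on the disk are
integrable, given by holomorphic charts `ψ` (inverse `ψ'`) and `κ` (inverse `κ'`); the form `da`
is Kähler for `J`; and the complex Hessian of `pr` at `c` is nondegenerate. -/
def IsLefschetzCriticalPoint (pr : E → ℂ) (a : OneForm (Cor (2 * m + 4)) E)
    (J : ∀ p : E, TangentSpace (Cor (2 * m + 4)) p →L[ℝ] TangentSpace (Cor (2 * m + 4)) p)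
    (j : ℂ → ℂ →L[ℝ] ℂ) (c : E) : Prop :=
  ∃ (W : Set E) (ψ : E → (Fin (m + 2) → ℂ)) (ψ' : (Fin (m + 2) → ℂ) → E)
    (G : Set ℂ) (κ κ' : ℂ → ℂ),
    (IsOpen W ∧ c ∈ W ∧ IsOpen (ψ '' W) ∧
      ContMDiffOn (Cor (2 * m + 4)) 𝓘(ℝ, Fin (m + 2) → ℂ) ∞ ψ W ∧
      ContMDiffOn 𝓘(ℝ, Fin (m + 2) → ℂ) (Cor (2 * m + 4)) ∞ ψ' (ψ '' W) ∧
      (∀ p ∈ W, ψ' (ψ p) = p) ∧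
      ∀ p ∈ W,
        let D : TangentSpace (Cor (2 * m + 4)) p →L[ℝ] (Fin (m + 2) → ℂ) :=
          mfderiv (Cor (2 * m + 4)) 𝓘(ℝ, Fin (m + 2) → ℂ) ψ p
        ∀ v, D (J p v) = Complex.I • D v) ∧
    (IsOpen G ∧ pr c ∈ G ∧ G ⊆ disk ∧ IsOpen (κ '' G) ∧
      ContDiffOn ℝ ∞ κ G ∧ ContDiffOn ℝ ∞ κ' (κ '' G) ∧ (∀ z ∈ G, κ' (κ z) = z) ∧
      ∀ z ∈ G, ∀ v : ℂ, fderiv ℝ κ z (j z v) = Complex.I * fderiv ℝ κ z v) ∧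
    (∀ p ∈ W, ∀ u v : TangentSpace (Cor (2 * m + 4)) p, a.d p (J p u) (J p v) = a.d p u v) ∧
    (∀ p ∈ W, ∀ u : TangentSpace (Cor (2 * m + 4)) p, u ≠ 0 → 0 < a.d p u (J p u)) ∧
    let F : (Fin (m + 2) → ℂ) → ℂ := fun x ↦ κ (pr (ψ' x))
    ∀ u, (∀ v, fderiv ℂ (fderiv ℂ F) (ψ c) u v = 0) → u = 0

variable (m E X) in
/-- A compatible exact Lefschetz fibration over the disk, with total space `E` of dimension
`2n + 2` and regular fibre `X` of dimension `2n`, where `n = m + 1`.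

The exact Lefschetz fibration is `(pr, E, dα₀, α₀)`; the pair `(J, j)` of almost complex structures
agrees near the critical points, resp. values, with the integrable ones that belong to
the fibration; the compatible exact symplectic structure on `E` is `(dα, α, χ)`, with
`dα = dα₀ + pr^* (σ dx ∧ dy)` for a positive area form `σ dx ∧ dy` on the disk. -/
structure CompatibleExactLefschetzFibration [IsManifold (Cor (2 * m + 4)) ∞ E]
    [IsManifold (𝓡∂ (2 * m + 2)) ∞ X] where
  pr : E → ℂ
  α₀ : OneForm (Cor (2 * m + 4)) E
  J : ∀ p : E, TangentSpace (Cor (2 * m + 4)) p →L[ℝ] TangentSpace (Cor (2 * m + 4)) p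
  j : ℂ → ℂ →L[ℝ] ℂ
  σ : ℂ → ℝ
  α : OneForm (Cor (2 * m + 4)) E
  χ : ∀ p : E, TangentSpace (Cor (2 * m + 4)) p
  pr_smooth : ContMDiff (Cor (2 * m + 4)) 𝓘(ℝ, ℂ) ∞ pr
  pr_mem : ∀ p, pr p ∈ disk
  α₀_smooth : α₀.IsSmooth
  crit_finite : (critSet (2 * m + 4) pr).Finite
  crit_interior : critSet (2 * m + 4) pr ⊆ (Cor (2 * m + 4)).interior E
  crit_injOn : InjOn pr (critSet (2 * m + 4) pr)
  crit_model : ∀ c ∈ critSet (2 * m + 4) pr, IsLefschetzCriticalPoint pr α₀ J j c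
  fibration : IsExactSymplecticFibration (X := X) pr α₀
  J_smooth : ContMDiff (Cor (2 * m + 4)) ((Cor (2 * m + 4)).prod
      𝓘(ℝ, EuclideanSpace ℝ (Fin (2 * m + 4)) →L[ℝ] EuclideanSpace ℝ (Fin (2 * m + 4)))) ∞
    (fun p ↦ Bundle.TotalSpace.mk'
      (EuclideanSpace ℝ (Fin (2 * m + 4)) →L[ℝ] EuclideanSpace ℝ (Fin (2 * m + 4)))
      (E := fun p : E ↦ TangentSpace (Cor (2 * m + 4)) p →L[ℝ] TangentSpace (Cor (2 * m + 4)) p)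
      p (J p))
  J_sq : ∀ p v, J p (J p v) = -v
  j_smooth : ContDiffOn ℝ ∞ j disk
  j_sq : ∀ z ∈ disk, ∀ v, j z (j z v) = -v
  /-- `j` is positively oriented: `(v, j v)` is a positive basis of `ℂ`. -/
  j_pos : ∀ z ∈ disk, ∀ v : ℂ, v ≠ 0 → 0 < (conj v * j z v).im
  holomorphic : ∀ p v, dmap pr p (J p v) = j (pr p) (dmap pr p v)
  vert_symm : ∀ p, ∀ u ∈ vert pr p, ∀ v ∈ vert pr p, α₀.d p u (J p v) = α₀.d p v (J p u)
  vert_pos : ∀ p, ∀ u ∈ vert pr p, u ≠ 0 → 0 < α₀.d p u (J p u)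
  σ_smooth : ContDiffOn ℝ ∞ σ disk
  σ_pos : ∀ z ∈ disk, 0 < σ z
  exact_symplectic : IsExactSymplectic α χ
  dα_eq : ∀ p u v, α.d p u v = α₀.d p u v + σ (pr p) * (conj (dmap pr p u) * dmap pr p v).im
  tame : ∀ p, ∀ u : TangentSpace (Cor (2 * m + 4)) p, u ≠ 0 → 0 < α.d p u (J p u)

end Fibrations

/-! ### The induced open book on the boundary

The open book on `∂E` induced by `pr` has the binding `B = ∂(pr⁻¹(0)) = ∂E ∩ pr⁻¹(0)` and the
fibration `f = pr / |pr| : ∂E \ B → S¹`. The boundary of `E` has corners, and a page is smooth on each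
of the faces of `∂E`. -/

section OpenBook

variable {d : ℕ} {E : Type*} [TopologicalSpace E] [ChartedSpace (EuclideanQuadrant d) E]

/-- The binding. -/
def binding (d : ℕ) {E : Type*} [TopologicalSpace E]
    [ChartedSpace (EuclideanQuadrant d) E] (pr : E → ℂ) : Set E := {p | (∃ i : Fin d, IsFace p i) ∧ pr p = 0}

/-- The page `f⁻¹(t)`, `t ∈ S¹`. -/
def page (d : ℕ) {E : Type*} [TopologicalSpace E]
    [ChartedSpace (EuclideanQuadrant d) E] (pr : E → ℂ) (t : ℂ) : Set E :=
  {p | (∃ i : Fin d, IsFace p i) ∧ pr p ≠ 0 ∧ pr p / (‖pr p‖ : ℂ) = t}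

/-- The tangent space of the binding, in the face `i`, at a point of the binding. -/
noncomputable def bindingTangent (pr : E → ℂ) (p : E) (i : Fin d) :
    Submodule ℝ (TangentSpace (Cor d) p) :=
  faceTangent p i ⊓ vert pr p

/-- The tangent space at `p` of the part in the face `i` of the page through `p`: the kernel, in the
tangent space of the face, of the differential of `pr / |pr|`, or of the angle of `pr`. -/
noncomputable def pageTangent (pr : E → ℂ) (p : E) (i : Fin d) :
    Submodule ℝ (TangentSpace (Cor d) p) :=
  faceTangent p i ⊓ LinearMap.ker
    (Complex.imCLM.comp ((ContinuousLinearMap.mul ℝ ℂ (conj (pr p))).comp (dmap pr p))).toLinearMap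

/-- The contact form `b` on the boundary of the `(2n+2)`-dimensional manifold `E` is adapted to
the open book induced by `pr`; here `n = m + 1`. -/
structure IsAdapted {m : ℕ} {E : Type*} [TopologicalSpace E]
    [ChartedSpace (EuclideanQuadrant (2 * m + 4)) E] [IsManifold (Cor (2 * m + 4)) ∞ E]
    (pr : E → ℂ) (b : OneForm (Cor (2 * m + 4)) E) : Prop where
  /-- `b` restricts to a contact form on the binding, which has dimension `2n - 1`. -/
  binding_contact : ∀ p ∈ binding (2 * m + 4) pr, ∀ i, IsFace p i →
    IsContactOn m (bindingTangent pr p i) (b p) (b.d p)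
  /-- `db` restricts to a symplectic form on every page (on each of its smooth pieces, up to
  the corners of `∂E`); pages have dimension `2n`. -/
  page_symplectic : ∀ t : ℂ, ‖t‖ = 1 → ∀ p ∈ page (2 * m + 4) pr t, ∀ i, IsFace p i →
    IsSymplecticOn (m + 1) (pageTangent pr p i) (b.d p)
  /-- The orientations that `db` induces on the pieces of a page agree along the corners: `u` points
  from the corner into the piece in the face `i`, and `w` into the piece in the face `k`, so that
  `(u, e)` and `(w, e)` have to be oppositely oriented. -/
  page_oriented : ∀ t : ℂ, ‖t‖ = 1 → ∀ p ∈ page (2 * m + 4) pr t, ∀ i k, IsFace p i → IsFace p k → i ≠ k →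
    ∀ u ∈ pageTangent pr p i, 0 < dcoord p k u → ∀ w ∈ pageTangent pr p k, 0 < dcoord p i w →
    ∀ e : Fin (2 * m + 1) → TangentSpace (Cor (2 * m + 4)) p, LinearIndependent ℝ e →
      (∀ l, e l ∈ pageTangent pr p i ⊓ faceTangent p k) →
      wedgePow (m + 1) (b.d p) (Fin.cons u e : Fin (2 * m + 1 + 1) → _) *
        wedgePow (m + 1) (b.d p) (Fin.cons w e : Fin (2 * m + 1 + 1) → _) < 0
  /-- The orientation of the binding by `b ∧ (db)^(n-1)` is its orientation as the boundary of the
  closure of a page, oriented by `(db)^n`: let `w, e` be a frame of the page, continuous up to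
  the point `p` of the binding, such that `w p` points out of the page and the `e p` form a frame of
  the binding that is positive for `b ∧ (db)^(n-1)`; then `w, e` is positive for `(db)^n` at all
  points of the page near `p`. -/
  orientation : ∀ t : ℂ, ‖t‖ = 1 → ∀ p ∈ binding (2 * m + 4) pr, ∀ i, IsFace p i →
    ∀ (w : ∀ q : E, TangentSpace (Cor (2 * m + 4)) q)
      (e : Fin (2 * m + 1) → ∀ q : E, TangentSpace (Cor (2 * m + 4)) q),
      ContinuousWithinAt (fun q ↦ (⟨q, w q⟩ : TangentBundle (Cor (2 * m + 4)) E)) (page (2 * m + 4) pr t) p →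
      (∀ l, ContinuousWithinAt (fun q ↦ (⟨q, e l q⟩ : TangentBundle (Cor (2 * m + 4)) E))
        (page (2 * m + 4) pr t) p) →
      (∀ᶠ q in 𝓝[page (2 * m + 4) pr t] p, ∀ k, IsFace q k →
        w q ∈ pageTangent pr q k ∧ ∀ l, e l q ∈ pageTangent pr q k) →
      w p ∈ faceTangent p i → (∃ s : ℝ, 0 < s ∧ dmap pr p (w p) = -(s * t : ℂ)) →
      (∀ l, e l p ∈ bindingTangent pr p i) →
      0 < contactVol m (b p) (b.d p) (fun l ↦ e l p) →
      ∀ᶠ q in 𝓝[page (2 * m + 4) pr t] p,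
        0 < wedgePow (m + 1) (b.d q) (Fin.cons (w q) (fun l ↦ e l q) : Fin (2 * m + 1 + 1) → _)

end OpenBook

end ExactLefschetz

universe u

namespace ExactLefschetz

/-! ### Exterior powers of a `2`-form -/

section Pointwise

variable {V : Type*}

/-! The function is g = 5 − |π|²: it equals 1 over ∂D and its differential is negative on radial
lifts away from π = 0. What remains is linear algebra in single tangent spaces for d(gα) = g dα + dg
∧ α, once the position of each face relative to ker dπ is known.

At a noncritical point dα is symplectic on ker dπ, because J preserves ker dπ and is tamed
(`isSymplecticOn_vert`). So the tangent space is the sum of ker dπ and its dα-orthogonal complement,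
which dπ maps isomorphically onto ℂ. Critical points are interior, so this applies at every boundary
point.

The geometric input is the dichotomy `horizontal_or_vertical`. For each face with defining
coordinate x, either the vector Y with dα(Y, ·) = dx is vertical, or |π| = 2 and dx is a negative
multiple of d|π|². Over interior regular values the product structure near the horizontal boundary
provides lifts h that are tangent to the face and annihilated by dα₀. Evaluating dα(Y, h) for the
lift h of i·dπ(Y) gives σ|dπ(Y)|² = 0. Since Y depends continuously on the point, the conclusion
passes to limits, and this covers points over ∂D and over critical values.

If Y is vertical, the face contains the dα-orthogonal complement of ker dπ. Moreover the Liouville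
vector of the fibre has the same x-component as χ, so it points outward, and S = T(face) ∩ ker dπ is
a contact hyperplane of ker dπ. Away from the binding the page has tangent space S ⊕ ℝh, where h is
the orthogonal lift of the radial vector π. There dα(h, S) = 0, dg vanishes on S and dg(h) < 0, so
the top power of d(gα) is n gⁿ⁻¹ dg ∧ α ∧ (dα)ⁿ⁻¹ ≠ 0. On a vertical face the page has tangent space
ker dπ, where d(gα) = g dα. At the binding dg = 0 as well.

All orientation statements come from contracting the top power with one vector (`wedgePow_cons`).
Contraction with the Liouville vector turns (dα)ⁿ into α ∧ (dα)ⁿ⁻¹, and contraction of (d(gα))ⁿ with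
h gives dg(h) gⁿ⁻¹ α ∧ (dα)ⁿ⁻¹ on S. Signs are then read off from the outward or inward direction of
the vectors involved. -/

theorem wedgePow_congr {k : ℕ} {w w' : V → V → ℝ} {e : Fin (2 * k) → V}
    (h : ∀ i j, w (e i) (e j) = w' (e i) (e j)) : wedgePow k w e = wedgePow k w' e := by
  simp only [wedgePow, h]

theorem contactVol_congr {k : ℕ} {a a' : V → ℝ} {w w' : V → V → ℝ} {e : Fin (2 * k + 1) → V}
    (ha : ∀ i, a (e i) = a' (e i)) (h : ∀ i j, w (e i) (e j) = w' (e i) (e j)) :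
    contactVol k a w e = contactVol k a' w' e := by
  simp only [contactVol, h, ha]

theorem wedgePow_smul (k : ℕ) (c : ℝ) (w : V → V → ℝ) (e : Fin (2 * k) → V) :
    wedgePow k (fun x y ↦ c * w x y) e = c ^ k * wedgePow k w e := by
  simp only [wedgePow, Finset.prod_mul_distrib, Finset.prod_const, Finset.card_univ,
    Fintype.card_fin, Finset.mul_sum]
  exact Finset.sum_congr rfl fun s _ ↦ by ring

theorem contactVol_smul (k : ℕ) (b c : ℝ) (a : V → ℝ) (w : V → V → ℝ) (e : Fin (2 * k + 1) → V) :
    contactVol k (fun x ↦ b * a x) (fun x y ↦ c * w x y) e = b * c ^ k * contactVol k a w e := by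
  simp only [contactVol, Finset.prod_mul_distrib, Finset.prod_const, Finset.card_univ,
    Fintype.card_fin, Finset.mul_sum]
  exact Finset.sum_congr rfl fun s _ ↦ by ring

/-- Only permutations fixing 0 survive, since in every other term `a` is evaluated on some `f i`. -/
theorem contactVol_cons_of_forall_eq_zero {k : ℕ} {a : V → ℝ} (w : V → V → ℝ) (r : V)
    {f : Fin (2 * k) → V} (hf : ∀ i, a (f i) = 0) :
    contactVol k a w (Fin.cons r f : Fin (2 * k + 1) → V) = a r * wedgePow k w f := by
  rw [contactVol, ← Equiv.sum_comp Equiv.Perm.decomposeFin.symm, Fintype.sum_prod_type,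
    Fintype.sum_eq_single 0, wedgePow, Finset.mul_sum]
  · refine Finset.sum_congr rfl fun s _ ↦ ?_
    have : ∀ j : Fin (2 * k), (Fin.cons r f : Fin (2 * k + 1) → V)
        (Equiv.Perm.decomposeFin.symm (0, s) j.succ) = f (s j) := by
      intro j
      rw [Equiv.Perm.decomposeFin_symm_apply_succ, Equiv.swap_self]
      rfl
    rw [Equiv.Perm.decomposeFin.symm_sign, Equiv.Perm.decomposeFin_symm_apply_zero]
    simp only [if_true, one_mul, Fin.cons_zero]
    rw [mul_left_comm]
    congr 2
  · intro p hp
    refine Finset.sum_eq_zero fun s _ ↦ ?_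
    obtain ⟨l, rfl⟩ := Fin.exists_succ_eq.2 hp
    rw [Equiv.Perm.decomposeFin_symm_apply_zero, Fin.cons_succ, hf]
    ring

/-- The index `l` occurs in exactly one factor, as its first or its second argument. This is what
makes `pairProd` multilinear. -/
theorem prod_pair_update {k : ℕ} (w : V → V → ℝ) (e : Fin (2 * k) → V) (l : Fin (2 * k)) :
    ∃ (c : ℝ) (y : V), (∀ x, ∏ i : Fin k, w (Function.update e l x ⟨2 * i, by omega⟩)
      (Function.update e l x ⟨2 * i + 1, by omega⟩) = c * w x y) ∨
    (∀ x, ∏ i : Fin k, w (Function.update e l x ⟨2 * i, by omega⟩)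
      (Function.update e l x ⟨2 * i + 1, by omega⟩) = c * w y x) := by
  let i₀ : Fin k := ⟨l / 2, by omega⟩
  have hl : (l : ℕ) = 2 * i₀ ∨ (l : ℕ) = 2 * i₀ + 1 := by
    simp only [i₀]; omega
  have key : ∀ x : V, ∏ i ∈ Finset.univ.erase i₀,
      w (Function.update e l x ⟨2 * i, by omega⟩) (Function.update e l x ⟨2 * i + 1, by omega⟩) =
      ∏ i ∈ Finset.univ.erase i₀, w (e ⟨2 * i, by omega⟩) (e ⟨2 * i + 1, by omega⟩) := by
    intro x
    refine Finset.prod_congr rfl fun i hi ↦ ?_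
    have hi' : (i : ℕ) ≠ i₀ := fun h ↦ (Finset.mem_erase.1 hi).1 (Fin.ext h)
    rw [Function.update_of_ne, Function.update_of_ne] <;> (rw [Ne, Fin.ext_iff]; simp only; omega)
  rcases hl with hl | hl
  · refine ⟨∏ i ∈ Finset.univ.erase i₀, w (e ⟨2 * i, by omega⟩) (e ⟨2 * i + 1, by omega⟩),
      e ⟨2 * i₀ + 1, by omega⟩, Or.inl fun x ↦ ?_⟩
    have h1 : (⟨2 * i₀, by omega⟩ : Fin (2 * k)) = l := Fin.ext hl.symm
    have h2 : (⟨2 * i₀ + 1, by omega⟩ : Fin (2 * k)) ≠ l := by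
      rw [Ne, Fin.ext_iff]; simp only; omega
    rw [← Finset.prod_erase_mul _ _ (Finset.mem_univ i₀), key, Function.update_of_ne h2, h1,
      Function.update_self]
  · refine ⟨∏ i ∈ Finset.univ.erase i₀, w (e ⟨2 * i, by omega⟩) (e ⟨2 * i + 1, by omega⟩),
      e ⟨2 * i₀, by omega⟩, Or.inr fun x ↦ ?_⟩
    have h1 : (⟨2 * i₀ + 1, by omega⟩ : Fin (2 * k)) = l := Fin.ext hl.symm
    have h2 : (⟨2 * i₀, by omega⟩ : Fin (2 * k)) ≠ l := by
      rw [Ne, Fin.ext_iff]; simp only; omega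
    rw [← Finset.prod_erase_mul _ _ (Finset.mem_univ i₀), key, Function.update_of_ne h2, h1,
      Function.update_self]

/-- The summand of `wedgePow`. -/
def pairTerm (k : ℕ) (w : V → V → ℝ) (e : Fin (2 * k) → V) (s : Equiv.Perm (Fin (2 * k))) : ℝ :=
  ((Equiv.Perm.sign s : ℤ) : ℝ) *
    ∏ i : Fin k, w (e (s ⟨2 * i, by omega⟩)) (e (s ⟨2 * i + 1, by omega⟩))

/-- The sign of the transposition cancels against the antisymmetry of `w`. -/
theorem pairTerm_mul_swap_within {k : ℕ} {w : V → V → ℝ} (hw : ∀ x y, w x y = -w y x)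
    (e : Fin (2 * k) → V) (s : Equiv.Perm (Fin (2 * k))) (i : Fin k) :
    pairTerm k w e (s * Equiv.swap ⟨2 * i, by omega⟩ ⟨2 * i + 1, by omega⟩) = pairTerm k w e s := by
  have hne : (⟨2 * i, by omega⟩ : Fin (2 * k)) ≠ ⟨2 * i + 1, by omega⟩ := by
    rw [Ne, Fin.ext_iff]; simp
  rw [pairTerm, pairTerm, Equiv.Perm.sign_mul, Equiv.Perm.sign_swap hne,
    ← Finset.mul_prod_erase _ _ (Finset.mem_univ i),
    ← Finset.mul_prod_erase _ _ (Finset.mem_univ i)]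
  have key : ∏ j ∈ Finset.univ.erase i,
      w (e ((s * Equiv.swap (⟨2 * i, by omega⟩ : Fin (2 * k)) ⟨2 * i + 1, by omega⟩)
        ⟨2 * j, by omega⟩))
        (e ((s * Equiv.swap (⟨2 * i, by omega⟩ : Fin (2 * k)) ⟨2 * i + 1, by omega⟩)
        ⟨2 * j + 1, by omega⟩)) =
      ∏ j ∈ Finset.univ.erase i, w (e (s ⟨2 * j, by omega⟩)) (e (s ⟨2 * j + 1, by omega⟩)) := by
    refine Finset.prod_congr rfl fun j hj ↦ ?_
    have hj' : (j : ℕ) ≠ i := fun h ↦ (Finset.mem_erase.1 hj).1 (Fin.ext h)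
    rw [Equiv.Perm.mul_apply, Equiv.Perm.mul_apply, Equiv.swap_apply_of_ne_of_ne,
      Equiv.swap_apply_of_ne_of_ne] <;> (rw [Ne, Fin.ext_iff]; simp only; omega)
  rw [key, Equiv.Perm.mul_apply, Equiv.Perm.mul_apply, Equiv.swap_apply_left,
    Equiv.swap_apply_right, hw]
  push_cast
  ring

/-- Exchanging two whole pairs is an even permutation and only reorders the factors. -/
theorem pairTerm_mul_swap_pairs {k : ℕ} (w : V → V → ℝ)
    (e : Fin (2 * k) → V) (s : Equiv.Perm (Fin (2 * k))) {i j : Fin k} (hij : i ≠ j) :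
    pairTerm k w e (s * (Equiv.swap ⟨2 * i, by omega⟩ ⟨2 * j, by omega⟩ *
      Equiv.swap ⟨2 * i + 1, by omega⟩ ⟨2 * j + 1, by omega⟩)) = pairTerm k w e s := by
  have hij' : (i : ℕ) ≠ j := fun h ↦ hij (Fin.ext h)
  have h1 : (⟨2 * i, by omega⟩ : Fin (2 * k)) ≠ ⟨2 * j, by omega⟩ := by
    rw [Ne, Fin.ext_iff]; simp only; omega
  have h2 : (⟨2 * i + 1, by omega⟩ : Fin (2 * k)) ≠ ⟨2 * j + 1, by omega⟩ := by
    rw [Ne, Fin.ext_iff]; simp only; omega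
  rw [pairTerm, pairTerm, Equiv.Perm.sign_mul, Equiv.Perm.sign_mul, Equiv.Perm.sign_swap h1,
    Equiv.Perm.sign_swap h2, ← Equiv.prod_comp (Equiv.swap i j)]
  congr 1
  · simp
  refine Finset.prod_congr rfl fun l _ ↦ ?_
  have h3 : Equiv.swap (⟨2 * i + 1, by omega⟩ : Fin (2 * k)) ⟨2 * j + 1, by omega⟩
      ⟨2 * (Equiv.swap i j l : Fin k), by omega⟩ = ⟨2 * (Equiv.swap i j l : Fin k), by omega⟩ := by
    apply Equiv.swap_apply_of_ne_of_ne <;> (rw [Ne, Fin.ext_iff]; simp only; omega)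
  have h4 : Equiv.swap (⟨2 * i, by omega⟩ : Fin (2 * k)) ⟨2 * j, by omega⟩
      ⟨2 * (Equiv.swap i j l : Fin k), by omega⟩ = ⟨2 * l, by omega⟩ := by
    simp only [Equiv.swap_apply_def, Fin.ext_iff]
    split_ifs <;> simp_all
  have h5 : Equiv.swap (⟨2 * i + 1, by omega⟩ : Fin (2 * k)) ⟨2 * j + 1, by omega⟩
      ⟨2 * (Equiv.swap i j l : Fin k) + 1, by omega⟩ = ⟨2 * l + 1, by omega⟩ := by
    simp only [Equiv.swap_apply_def, Fin.ext_iff]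
    split_ifs <;> simp_all
  have h6 : Equiv.swap (⟨2 * i, by omega⟩ : Fin (2 * k)) ⟨2 * j, by omega⟩
      ⟨2 * l + 1, by omega⟩ = ⟨2 * l + 1, by omega⟩ := by
    apply Equiv.swap_apply_of_ne_of_ne <;> (rw [Ne, Fin.ext_iff]; simp only; omega)
  simp only [Equiv.Perm.mul_apply, h3, h4, h5, h6]

/-- These symmetries act transitively on the slots, so in `wedgePow_cons` a vector may be assumed to
sit in slot 0. -/
theorem exists_perm_pairTerm_mul {k : ℕ} {w : V → V → ℝ} (hw : ∀ x y, w x y = -w y x)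
    (e : Fin (2 * (k + 1)) → V) (j : Fin (2 * (k + 1))) :
    ∃ r : Equiv.Perm (Fin (2 * (k + 1))), r 0 = j ∧
      ∀ s, pairTerm (k + 1) w e (s * r) = pairTerm (k + 1) w e s := by
  have even : ∀ i : Fin (k + 1), ∃ r : Equiv.Perm (Fin (2 * (k + 1))),
      r 0 = ⟨2 * i, by omega⟩ ∧ ∀ s, pairTerm (k + 1) w e (s * r) = pairTerm (k + 1) w e s := by
    intro i
    by_cases hi : i = 0
    · subst hi
      exact ⟨1, rfl, fun s ↦ by rw [mul_one]⟩
    · refine ⟨_, ?_, fun s ↦ pairTerm_mul_swap_pairs w e s hi⟩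
      have hi' : (i : ℕ) ≠ 0 := fun h ↦ hi (Fin.ext h)
      have h1 : Equiv.swap (⟨2 * i + 1, by omega⟩ : Fin (2 * (k + 1)))
          ⟨2 * (0 : Fin (k + 1)) + 1, by simp; omega⟩ 0 = 0 := by
        apply Equiv.swap_apply_of_ne_of_ne <;> (rw [Ne, Fin.ext_iff]; simp)
      exact (congrArg _ h1).trans (Equiv.swap_apply_right _ _)
  let i : Fin (k + 1) := ⟨j / 2, by omega⟩
  obtain ⟨r, hr, hs⟩ := even i
  rcases Nat.even_or_odd' (j : ℕ) with ⟨l, hl | hl⟩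
  · exact ⟨r, hr.trans (Fin.ext (by simp only [i]; omega)), hs⟩
  · refine ⟨Equiv.swap ⟨2 * i, by omega⟩ ⟨2 * i + 1, by omega⟩ * r, ?_, fun s ↦ ?_⟩
    · rw [Equiv.Perm.mul_apply, hr, Equiv.swap_apply_left]
      exact Fin.ext (by simp only [i]; omega)
    · rw [← mul_assoc, hs, pairTerm_mul_swap_within hw]

/-- Contraction of `w^(k+1)` with a vector. -/
theorem wedgePow_cons {k : ℕ} {w : V → V → ℝ} (hw : ∀ x y, w x y = -w y x) (x : V)
    (e : Fin (2 * k + 1) → V) :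
    wedgePow (k + 1) w (Fin.cons x e : Fin (2 * k + 1 + 1) → V) =
      2 * (k + 1) * contactVol k (w x) w e := by
  let v : Fin (2 * (k + 1)) → V := (Fin.cons x e : Fin (2 * k + 1 + 1) → V)
  -- Terms are grouped by the slot `j` that holds `x`. Each of the `2 * (k + 1)` slots contributes
  -- equally, which is the factor in the formula.
  have fibre : ∀ j, ∑ s, (if s j = 0 then pairTerm (k + 1) w v s else 0) =
      contactVol k (w x) w e := by
    intro j
    obtain ⟨r, hr, hs⟩ := exists_perm_pairTerm_mul hw v j
    have h1 : ∑ s, (if s j = 0 then pairTerm (k + 1) w v s else 0) =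
        ∑ s : Equiv.Perm (Fin (2 * (k + 1))), (if s 0 = 0 then pairTerm (k + 1) w v s else 0) := by
      conv_rhs => rw [← Equiv.sum_comp (Equiv.mulRight r)]
      refine Finset.sum_congr rfl fun s _ ↦ ?_
      simp only [Equiv.coe_mulRight, Equiv.Perm.mul_apply, hr, hs]
    refine h1.trans ((Equiv.sum_comp (Equiv.Perm.decomposeFin (n := 2 * k + 1)).symm
      fun s : Equiv.Perm (Fin (2 * (k + 1))) ↦
        if s 0 = 0 then pairTerm (k + 1) w v s else 0).symm.trans ?_)
    rw [Fintype.sum_prod_type, Fintype.sum_eq_single 0]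
    · rw [contactVol]
      refine Finset.sum_congr rfl fun s _ ↦ ?_
      have h2 : (Equiv.Perm.decomposeFin.symm (0, s) : Equiv.Perm (Fin (2 * k + 1 + 1))) 0 = 0 :=
        Equiv.Perm.decomposeFin_symm_apply_zero _ _
      have h3 : ∀ j : Fin (2 * k + 1), v
          ((Equiv.Perm.decomposeFin.symm (0, s) : Equiv.Perm (Fin (2 * k + 1 + 1))) j.succ) =
            e (s j) := by
        intro j
        rw [Equiv.Perm.decomposeFin_symm_apply_succ, Equiv.swap_self]
        rfl
      refine (if_pos h2).trans ?_
      rw [pairTerm, Fin.prod_univ_succ, Equiv.Perm.decomposeFin.symm_sign]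
      simp only [if_true, one_mul]
      congr 2
    · intro p hp
      refine Finset.sum_eq_zero fun s _ ↦ if_neg ?_
      intro h
      exact hp ((Equiv.Perm.decomposeFin_symm_apply_zero p s).symm.trans h)
  have total : wedgePow (k + 1) w v =
      ∑ j, ∑ s, (if s j = 0 then pairTerm (k + 1) w v s else 0) := by
    rw [Finset.sum_comm]
    refine Finset.sum_congr rfl fun s _ ↦ ?_
    rw [Fintype.sum_eq_single (s.symm 0)]
    · simp [pairTerm]
    · intro j hj
      exact if_neg fun h ↦ hj (by rw [← h, Equiv.symm_apply_apply])
  rw [show wedgePow (k + 1) w (Fin.cons x e : Fin (2 * k + 1 + 1) → V) = wedgePow (k + 1) w v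
    from rfl, total, Finset.sum_congr rfl fun j _ ↦ fibre j]
  simp

end Pointwise

/-! ### Top powers as alternating maps, and their nonvanishing on symplectic spaces. -/

section WedgePow

variable {V : Type*} [AddCommGroup V] [Module ℝ V]

/-- The multilinear map `e ↦ ∏ w (e (2i)) (e (2i+1))`. -/
noncomputable def pairProd (k : ℕ) (w : V →ₗ[ℝ] V →ₗ[ℝ] ℝ) :
    MultilinearMap ℝ (fun _ : Fin (2 * k) ↦ V) ℝ :=
  MultilinearMap.mk'
    (fun e ↦ ∏ i : Fin k, w (e ⟨2 * i, by omega⟩) (e ⟨2 * i + 1, by omega⟩))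
    (fun e l x y ↦ by
      obtain ⟨c, z, h | h⟩ := prod_pair_update (fun x y ↦ w x y) e l <;>
        simp only [h, map_add, LinearMap.add_apply, mul_add])
    (fun e l b x ↦ by
      obtain ⟨c, z, h | h⟩ := prod_pair_update (fun x y ↦ w x y) e l <;>
        simp only [h, map_smul, LinearMap.smul_apply, smul_eq_mul] <;> ring)

/-- `wedgePow` of a bilinear form, as an alternating map. -/
noncomputable def wedgePowAlt (k : ℕ) (w : V →ₗ[ℝ] V →ₗ[ℝ] ℝ) : V [⋀^Fin (2 * k)]→ₗ[ℝ] ℝ :=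
  MultilinearMap.alternatization (pairProd k w)

theorem wedgePowAlt_apply (k : ℕ) (w : V →ₗ[ℝ] V →ₗ[ℝ] ℝ) (e : Fin (2 * k) → V) :
    wedgePowAlt k w e = wedgePow k (fun x y ↦ w x y) e := by
  simp [wedgePowAlt, wedgePow, MultilinearMap.alternatization_apply, Units.smul_def, pairProd]

theorem wedgePow_eq_zero_of_not_linearIndependent {k : ℕ} (w : V →ₗ[ℝ] V →ₗ[ℝ] ℝ)
    {e : Fin (2 * k) → V} (he : ¬ LinearIndependent ℝ e) :
    wedgePow k (fun x y ↦ w x y) e = 0 := by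
  rw [← wedgePowAlt_apply]
  exact AlternatingMap.map_linearDependent _ _ he

/-- An alternating map does not change if multiples of the first vector are added to
the other vectors. -/
theorem AlternatingMap.cons_add_smul {n : ℕ} (L : V [⋀^Fin (n + 1)]→ₗ[ℝ] ℝ) (x : V)
    (e : Fin n → V) (c : Fin n → ℝ) :
    L (Fin.cons x (fun l ↦ e l + c l • x) : Fin (n + 1) → V) =
      L (Fin.cons x e : Fin (n + 1) → V) := by
  classical
  have h1 : ∀ f : Fin n → V, L (Fin.cons x f : Fin (n + 1) → V) = L.curryLeft x f := fun f ↦ rfl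
  rw [h1, h1]
  -- In the multilinear expansion, every term other than the first has a multiple of `x` in a
  -- further slot and so a dependent frame.
  refine (MultilinearMap.map_add_univ (L.curryLeft x).toMultilinearMap e
    (fun l ↦ c l • x)).trans ?_
  rw [Fintype.sum_eq_single Finset.univ]
  · rw [Finset.piecewise_univ]; rfl
  · intro s hs
    obtain ⟨l, hl⟩ : ∃ l, l ∉ s := by
      by_contra! h
      exact hs (Finset.eq_univ_iff_forall.2 h)
    refine (h1 (s.piecewise e fun l ↦ c l • x)).symm.trans
      (AlternatingMap.map_linearDependent _ _ fun h ↦ ?_)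
    refine (linearIndependent_finCons.1 h).1.ne_zero l ?_ |>.elim
    have h2 : s.piecewise e (fun l ↦ c l • x) l = c l • x := Finset.piecewise_eq_of_notMem _ _ _ hl
    by_contra h0
    rw [h2] at h0
    have hc : c l ≠ 0 := fun hc ↦ h0 (by rw [hc, zero_smul])
    refine (linearIndependent_finCons.1 h).2 ?_
    have h3 : x = (c l)⁻¹ • s.piecewise e (fun l ↦ c l • x) l := by
      rw [h2, smul_smul, inv_mul_cancel₀ hc, one_smul]
    rw [h3]
    exact Submodule.smul_mem _ _ (Submodule.subset_span ⟨l, by rw [← h3]⟩)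

theorem AlternatingMap.cons_of_mem_span {n : ℕ} (L : V [⋀^Fin (n + 1)]→ₗ[ℝ] ℝ) {x : V}
    {e : Fin n → V} (hx : x ∈ Submodule.span ℝ (range e)) :
    L (Fin.cons x e : Fin (n + 1) → V) = 0 :=
  AlternatingMap.map_linearDependent _ _ fun h ↦ (linearIndependent_finCons.1 h).2 hx

theorem AlternatingMap.cons_smul_add {n : ℕ} (L : V [⋀^Fin (n + 1)]→ₗ[ℝ] ℝ) (c : ℝ) (x y : V)
    (e : Fin n → V) :
    L (Fin.cons (c • x + y) e : Fin (n + 1) → V) =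
      c * L (Fin.cons x e : Fin (n + 1) → V) + L (Fin.cons y e : Fin (n + 1) → V) := by
  have h1 : ∀ x, L (Fin.cons x e : Fin (n + 1) → V) = L.curryLeft x e := fun f ↦ rfl
  rw [h1, h1, h1, map_add, map_smul]
  rfl

/-- A nondegenerate `2`-form has a nonzero top exterior power. -/
theorem exists_wedgePow_ne_zero (k : ℕ) : ∀ {V : Type u} [AddCommGroup V] [Module ℝ V]
    (w : V →ₗ[ℝ] V →ₗ[ℝ] ℝ), (∀ x y, w x y = -w y x) → Module.finrank ℝ V = 2 * k →
    (∀ x, (∀ y, w x y = 0) → x = 0) → ∃ e : Fin (2 * k) → V,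
      wedgePow k (fun x y ↦ w x y) e ≠ 0 := by
  induction k with
  | zero =>
    intro V _ _ w _ _ _
    exact ⟨fun i ↦ 0, by simp [wedgePow]⟩
  | succ k ih =>
    intro V _ _ w hw hV hnd
    have : FiniteDimensional ℝ V := Module.finite_of_finrank_pos (by omega)
    have : Nontrivial V := Module.nontrivial_of_finrank_pos (R := ℝ) (by omega)
    obtain ⟨x, hx⟩ := exists_ne (0 : V)
    obtain ⟨r, hr⟩ : ∃ r, w x r ≠ 0 := by
      by_contra! h
      exact hx (hnd x h)
    have hself : ∀ v, w v v = 0 := fun v ↦ by linarith [hw v v]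
    -- `x` and `r` span a hyperbolic plane, and the kernel of `φ` is its symplectic complement, to
    -- which induction applies.
    let φ : V →ₗ[ℝ] ℝ × ℝ := (w x).prod (w r)
    have hφ : LinearMap.range φ = ⊤ := by
      rw [LinearMap.range_eq_top]
      rintro ⟨a, b⟩
      refine ⟨(a / w x r) • r - (b / w x r) • x, ?_⟩
      have h3 : w r x = - w x r := hw r x
      refine Prod.ext ?_ ?_ <;> simp [φ, hself, h3, hr]
    have hdim : Module.finrank ℝ (LinearMap.ker φ) = 2 * k := by
      have := φ.finrank_range_add_finrank_ker
      rw [hφ, finrank_top, Module.finrank_prod, Module.finrank_self, hV] at this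
      omega
    have hker : ∀ v, v ∈ LinearMap.ker φ ↔ w x v = 0 ∧ w r v = 0 := fun v ↦ by
      simp [φ, LinearMap.mem_ker]
    obtain ⟨f, hf⟩ := ih ((w.domRestrict (LinearMap.ker φ)).compl₂ (LinearMap.ker φ).subtype)
      (fun y z ↦ hw y z) hdim (by
        intro y hy
        refine Subtype.ext (hnd _ fun z ↦ ?_)
        have h0 : w x r ≠ 0 := hr
        have h3 : w r x = - w x r := hw r x
        have hz : z - (w x z / w x r) • r + (w r z / w x r) • x ∈ LinearMap.ker φ := by
          rw [hker]
          simp only [map_add, map_sub, map_smul, hself, h3, smul_eq_mul]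
          constructor <;> field_simp <;> ring
        have h4 := hy ⟨_, hz⟩
        have h5 : w y z - (w x z / w x r) * w y r + (w r z / w x r) * w y x = 0 := by
          simpa using h4
        have h6 := (hker y).1 y.2
        rw [hw y r, hw y x, h6.1, h6.2] at h5
        linarith)
    refine ⟨(Fin.cons x (Fin.cons r (fun i ↦ (f i : V)) : Fin (2 * k + 1) → V) :
      Fin (2 * k + 1 + 1) → V), ?_⟩
    rw [wedgePow_cons hw, contactVol_cons_of_forall_eq_zero _ _ fun i ↦ ((hker _).1 (f i).2).1]
    exact mul_ne_zero (by positivity) (mul_ne_zero hr hf)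

/-- The restriction to `T` is a nonzero alternating map of top degree, so it is nonzero on every
basis. -/
theorem wedgePow_ne_zero {V : Type u} [AddCommGroup V] [Module ℝ V] {k : ℕ} {T : Submodule ℝ V}
    {w : V →ₗ[ℝ] V →ₗ[ℝ] ℝ} (hw : ∀ x y, w x y = -w y x)
    (hT : IsSymplecticOn k T fun x y ↦ w x y) {e : Fin (2 * k) → V}
    (heT : ∀ i, e i ∈ T) (he : LinearIndependent ℝ e) :
    wedgePow k (fun x y ↦ w x y) e ≠ 0 := by
  let w' : T →ₗ[ℝ] T →ₗ[ℝ] ℝ := (w.domRestrict T).compl₂ T.subtype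
  obtain ⟨f, hf⟩ := exists_wedgePow_ne_zero k w' (fun y z ↦ hw y z) hT.1
    fun x hx ↦ Subtype.ext (hT.2 x x.2 fun y hy ↦ hx ⟨y, hy⟩)
  have hne : wedgePowAlt k w' ≠ 0 := by
    rintro h
    rw [← wedgePowAlt_apply, h] at hf
    exact hf rfl
  let e' : Fin (2 * k) → T := fun i ↦ ⟨e i, heT i⟩
  have he' : LinearIndependent ℝ e' := LinearIndependent.of_comp T.subtype he
  rcases Nat.eq_zero_or_pos k with rfl | hk
  · simp [wedgePow]
  have : Nonempty (Fin (2 * k)) := ⟨⟨0, by omega⟩⟩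
  have hb := (AlternatingMap.map_basis_ne_zero_iff
    (basisOfLinearIndependentOfCardEqFinrank he' (by rw [hT.1, Fintype.card_fin])) _).2 hne
  rw [coe_basisOfLinearIndependentOfCardEqFinrank, wedgePowAlt_apply] at hb
  exact hb

end WedgePow

/-! ### Contact hyperplanes of symplectic vector spaces -/

section LinearContact

variable {V : Type u} [AddCommGroup V] [Module ℝ V] {w : V →ₗ[ℝ] V →ₗ[ℝ] ℝ} {K : Submodule ℝ V}

theorem notMem_span_of_ne_zero {n : ℕ} {f : Fin n → V} (ν : V →ₗ[ℝ] ℝ) (hf : ∀ l, ν (f l) = 0)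
    {x : V} (hx : ν x ≠ 0) : x ∉ Submodule.span ℝ (range f) := by
  intro h
  have h2 : Submodule.span ℝ (range f) ≤ LinearMap.ker ν :=
    Submodule.span_le.2 (by rintro _ ⟨l, rfl⟩; exact hf l)
  exact hx (h2 h)

theorem AlternatingMap.cons_cons_swap {n : ℕ} (L : V [⋀^Fin (n + 1 + 1)]→ₗ[ℝ] ℝ) (x y : V)
    (f : Fin n → V) :
    L (Fin.cons x (Fin.cons y f : Fin (n + 1) → V) : Fin (n + 1 + 1) → V) =
      -L (Fin.cons y (Fin.cons x f : Fin (n + 1) → V) : Fin (n + 1 + 1) → V) := by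
  rw [← AlternatingMap.map_swap L _ (show (0 : Fin (n + 1 + 1)) ≠ 1 by simp)]
  congr 1
  ext l
  refine Fin.cases ?_ (fun l ↦ Fin.cases ?_ (fun l ↦ ?_) l) l
  · simp
  · simp
  · rw [Function.comp_apply, Equiv.swap_apply_of_ne_of_ne]
    · rfl
    · exact Fin.succ_ne_zero _
    · rw [← Fin.succ_zero_eq_one]
      exact fun h ↦ Fin.succ_ne_zero l (Fin.succ_injective _ h)

/-- Used with `y` the radial lift: it moves `y` to the front and removes the `y`-component of `x`.
-/
theorem AlternatingMap.cons_cons_sub_smul {n : ℕ} (L : V [⋀^Fin (n + 1 + 1)]→ₗ[ℝ] ℝ) (x y : V)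
    (f : Fin n → V) (t : ℝ) :
    L (Fin.cons x (Fin.cons y f : Fin (n + 1) → V) : Fin (n + 1 + 1) → V) =
      -L (Fin.cons y (Fin.cons (x - t • y) f : Fin (n + 1) → V) : Fin (n + 1 + 1) → V) := by
  have h1 := AlternatingMap.cons_smul_add L t y (x - t • y) (Fin.cons y f : Fin (n + 1) → V)
  rwa [add_sub_cancel, AlternatingMap.cons_of_mem_span L
    (x := y) (e := (Fin.cons y f : Fin (n + 1) → V)) (Submodule.subset_span ⟨0, rfl⟩), mul_zero,
    zero_add, AlternatingMap.cons_cons_swap L (x - t • y)] at h1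

/-- The `2`-form `d(g a) = g da + dg ∧ a`. -/
def mulFunForm (g : ℝ) (δ a : V →ₗ[ℝ] ℝ) (w : V →ₗ[ℝ] V →ₗ[ℝ] ℝ) : V →ₗ[ℝ] V →ₗ[ℝ] ℝ :=
  g • w + (LinearMap.smulRight δ a - LinearMap.smulRight a δ)

theorem mulFunForm_apply (g : ℝ) (δ a : V →ₗ[ℝ] ℝ) (w : V →ₗ[ℝ] V →ₗ[ℝ] ℝ) (x y : V) :
    mulFunForm g δ a w x y = g * w x y + (δ x * a y - δ y * a x) := by
  simp [mulFunForm, mul_comm (a x)]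

theorem mulFunForm_antisymm (hw : ∀ x y, w x y = -w y x) (g : ℝ) (δ a : V →ₗ[ℝ] ℝ) (x y : V) :
    mulFunForm g δ a w x y = -mulFunForm g δ a w y x := by
  rw [mulFunForm_apply, mulFunForm_apply, hw x y]
  ring

variable [FiniteDimensional ℝ V]

theorem finrank_inf_ker_add_one {ν : V →ₗ[ℝ] ℝ} {Z : V} (hZ : Z ∈ K) (hν : ν Z ≠ 0) :
    Module.finrank ℝ (K ⊓ LinearMap.ker ν : Submodule ℝ V) + 1 = Module.finrank ℝ K := by
  have h1 := (ν.domRestrict K).finrank_range_add_finrank_ker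
  have h2 : LinearMap.range (ν.domRestrict K) = ⊤ := by
    refine LinearMap.range_eq_top.2 (LinearMap.surjective ?_)
    intro h
    exact hν (by simpa using congrArg (fun f ↦ f ⟨Z, hZ⟩) h)
  rw [h2, finrank_top, Module.finrank_self, LinearMap.ker_domRestrict] at h1
  have h3 : Module.finrank ℝ ((LinearMap.ker ν).comap K.subtype) =
      Module.finrank ℝ (K ⊓ LinearMap.ker ν : Submodule ℝ V) := by
    rw [← Submodule.map_comap_subtype]
    exact (Submodule.finrank_map_subtype_eq _ _).symm
  change _ + Module.finrank ℝ ((LinearMap.ker ν).comap K.subtype) = _ at h1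
  omega

/-- A hyperplane transverse to the Liouville vector of a symplectic vector space
is a contact space. -/
theorem isContactOn_of_liouville {k : ℕ} (hw : ∀ x y, w x y = -w y x)
    (hK : IsSymplecticOn (k + 1) K fun x y ↦ w x y) {Z : V} (hZ : Z ∈ K) {a : V → ℝ}
    (ha : ∀ x ∈ K, w Z x = a x) {ν : V →ₗ[ℝ] ℝ} (hν : ν Z ≠ 0) :
    IsContactOn k (K ⊓ LinearMap.ker ν) a fun x y ↦ w x y := by
  have hself : ∀ v, w v v = 0 := fun v ↦ by linarith [hw v v]
  have hproj : ∀ y ∈ K, y - (ν y / ν Z) • Z ∈ K ⊓ LinearMap.ker ν := by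
    intro y hy
    refine ⟨K.sub_mem hy (K.smul_mem _ hZ), ?_⟩
    simp [hν]
  have hZ0 : Z ≠ 0 := by rintro rfl; simp at hν
  obtain ⟨r, hr, hr0⟩ : ∃ r ∈ K ⊓ LinearMap.ker ν, a r ≠ 0 := by
    by_contra! h
    refine hZ0 (hK.2 Z hZ fun y hy ↦ ?_)
    have h1 := h _ (hproj y hy)
    rw [← ha _ (hproj y hy).1, map_sub, map_smul, hself, smul_zero, sub_zero] at h1
    exact h1
  have hdim := finrank_inf_ker_add_one hZ hν
  refine ⟨by rw [hK.1] at hdim; omega, ⟨r, hr, hr0⟩, fun x hx hx0 h ↦ ?_⟩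
  have hr1 : w Z r ≠ 0 := by rwa [ha r hr.1]
  have hZx : w Z x = 0 := by rw [ha x hx.1, hx0]
  -- This `c` makes `x - c • Z` orthogonal to `r`. It is also orthogonal to the rest of the
  -- hyperplane, where `a = 0`, and to `Z`, because `w Z x = a x = 0`. These span `K`, so `x = c •
  -- Z`, and applying `ν` forces `c = 0`.
  let c := w x r / w Z r
  have key : x - c • Z = 0 := by
    refine hK.2 _ (K.sub_mem hx.1 (K.smul_mem _ hZ)) fun y hy ↦ ?_
    have h1 := hproj y hy
    set y' := y - (ν y / ν Z) • Z with hy'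
    have h2 : y' - (w Z y' / w Z r) • r ∈ K ⊓ LinearMap.ker ν :=
      Submodule.sub_mem _ h1 (Submodule.smul_mem _ _ hr)
    have h3 : w x (y' - (w Z y' / w Z r) • r) = 0 := by
      refine h _ h2 ?_
      rw [← ha _ h2.1]
      simp [hr1]
    have h4 : y = (y' - (w Z y' / w Z r) • r) + (w Z y' / w Z r) • r + (ν y / ν Z) • Z := by
      rw [hy']; abel
    have h5 : w x Z = 0 := by rw [hw, hZx, neg_zero]
    rw [h4]
    simp only [map_add, map_smul, map_sub, LinearMap.sub_apply, LinearMap.smul_apply, smul_eq_mul,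
      hself, h5] at h3 ⊢
    simp only [c]
    field_simp
    field_simp at h3
    linear_combination (ν Z) * h3
  have hc : c = 0 := by
    have h1 : ν x = 0 := hx.2
    have h2 : ν (x - c • Z) = 0 := by rw [key, map_zero]
    rw [map_sub, map_smul, h1, smul_eq_mul, zero_sub, neg_eq_zero] at h2
    exact (mul_eq_zero.1 h2).resolve_right hν
  rwa [hc, zero_smul, sub_zero] at key

theorem mem_span_of_linearIndependent {S : Submodule ℝ V} {n : ℕ} {e : Fin n → V}
    (heS : ∀ l, e l ∈ S) (he : LinearIndependent ℝ e) (hS : Module.finrank ℝ S = n) {x : V}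
    (hx : x ∈ S) : x ∈ Submodule.span ℝ (range e) := by
  have h1 : Submodule.span ℝ (range e) ≤ S := Submodule.span_le.2 (by rintro _ ⟨l, rfl⟩; exact heS l)
  have h2 : Submodule.span ℝ (range e) = S :=
    Submodule.eq_of_le_of_finrank_eq h1 (by rw [finrank_span_eq_card he, hS, Fintype.card_fin])
  rwa [h2]

/-- The value of an alternating form of top degree on a frame of a hyperplane completed
by a vector depends only on the transverse component of this vector. -/
theorem wedgePow_cons_eq_of_hyperplane {k : ℕ} (w : V →ₗ[ℝ] V →ₗ[ℝ] ℝ) {S : Submodule ℝ V}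
    (hS : Module.finrank ℝ S = 2 * k + 1) {e : Fin (2 * k + 1) → V} (he : ∀ l, e l ∈ S) {x z : V}
    {c : ℝ} (hx : x - c • z ∈ S) :
    wedgePow (k + 1) (fun x y ↦ w x y) (Fin.cons x e : Fin (2 * k + 1 + 1) → V) =
      c * wedgePow (k + 1) (fun x y ↦ w x y) (Fin.cons z e : Fin (2 * k + 1 + 1) → V) := by
  by_cases hli : LinearIndependent ℝ e
  · have h := AlternatingMap.cons_smul_add (wedgePowAlt (k + 1) w) c z (x - c • z) e
    rw [add_sub_cancel, AlternatingMap.cons_of_mem_span (wedgePowAlt (k + 1) w)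
      (mem_span_of_linearIndependent he hli hS hx), add_zero] at h
    rwa [wedgePowAlt_apply, wedgePowAlt_apply] at h
  · have h : ∀ y : V, wedgePow (k + 1) (fun x y ↦ w x y)
        (Fin.cons y e : Fin (2 * k + 1 + 1) → V) = 0 := fun y ↦
      wedgePow_eq_zero_of_not_linearIndependent (k := k + 1) w
        fun h ↦ hli (linearIndependent_finCons.1 h).1
    rw [h, h, mul_zero]

/-- The orientations of a symplectic vector space by `w^(k+1)` and of a hyperplane transverse
to the Liouville vector `Z` by `a ∧ w^k`. -/
theorem wedgePow_cons_of_liouville {k : ℕ} (hw : ∀ x y, w x y = -w y x)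
    (hK : Module.finrank ℝ K = 2 * (k + 1)) {Z : V} (hZ : Z ∈ K) {a : V → ℝ}
    (ha : ∀ x ∈ K, w Z x = a x) {ν : V →ₗ[ℝ] ℝ} (hν : ν Z ≠ 0) {e : Fin (2 * k + 1) → V}
    (he : ∀ l, e l ∈ K ⊓ LinearMap.ker ν) {x : V} (hx : x ∈ K) :
    wedgePow (k + 1) (fun x y ↦ w x y) (Fin.cons x e : Fin (2 * k + 1 + 1) → V) =
      ν x / ν Z * (2 * (k + 1) * contactVol k a (fun x y ↦ w x y) e) := by
  have hdim := finrank_inf_ker_add_one hZ hν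
  -- Modulo the hyperplane, `x` is `(ν x / ν Z) • Z`; contracting with `Z` then replaces `w Z` by
  -- `a`.
  rw [wedgePow_cons_eq_of_hyperplane w (c := ν x / ν Z) (z := Z) (by omega) he
    ⟨K.sub_mem hx (K.smul_mem _ hZ), by simp [hν]⟩, wedgePow_cons hw]
  congr 2
  exact contactVol_congr (fun i ↦ ha _ (he i).1) fun _ _ ↦ rfl

/-- The orientation by `(d(g a))^(k+1)` of the sum of a contact space `S`, on which `dg = 0`, and a
`da`-orthogonal line. -/
theorem wedgePow_mulFunForm_cons {k : ℕ} (hw : ∀ x y, w x y = -w y x) {S : Submodule ℝ V}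
    (hS : Module.finrank ℝ S = 2 * k + 1) {g : ℝ} {δ a : V →ₗ[ℝ] ℝ} (hδ : ∀ x ∈ S, δ x = 0)
    {h : V} (hh : ∀ x ∈ S, w h x = 0) {e : Fin (2 * k + 1) → V} (he : ∀ l, e l ∈ S)
    {x : V} {c : ℝ} (hx : x - c • h ∈ S) :
    wedgePow (k + 1) (fun x y ↦ mulFunForm g δ a w x y)
      (Fin.cons x e : Fin (2 * k + 1 + 1) → V) =
      c * (2 * (k + 1) * (δ h * g ^ k * contactVol k a (fun x y ↦ w x y) e)) := by
  -- On `S` the contraction of `d(g a)` with `h` is `δ h * a`, and `d(g a)` itself is `g * w`.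
  rw [wedgePow_cons_eq_of_hyperplane _ hS he hx, wedgePow_cons (mulFunForm_antisymm hw g δ a),
    ← contactVol_smul]
  congr 2
  refine contactVol_congr (fun i ↦ ?_) fun i j ↦ ?_
  · rw [mulFunForm_apply, hδ _ (he i), hh _ (he i)]; ring
  · rw [mulFunForm_apply, hδ _ (he i), hδ _ (he j)]; ring

/-- `d(g a)` is symplectic on the sum of a contact space `S`, on which `dg = 0`, and a
`da`-orthogonal line on which `dg ≠ 0`. -/
theorem isSymplecticOn_mulFunForm {k : ℕ} (hw : ∀ x y, w x y = -w y x) {T S : Submodule ℝ V}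
    {g : ℝ} (hg : g ≠ 0) {δ a : V →ₗ[ℝ] ℝ} (hS : IsContactOn k S a fun x y ↦ w x y) (hST : S ≤ T)
    (hδ : ∀ x ∈ S, δ x = 0) {h : V} (hhT : h ∈ T) (hh : ∀ x ∈ S, w h x = 0) (hδh : δ h ≠ 0)
    (hT : ∀ x ∈ T, ∃ c : ℝ, x - c • h ∈ S) :
    IsSymplecticOn (k + 1) T fun x y ↦ mulFunForm g δ a w x y := by
  have hself : ∀ v, w v v = 0 := fun v ↦ by linarith [hw v v]
  constructor
  · have h1 : T ⊓ LinearMap.ker δ = S := by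
      refine le_antisymm (fun x hx ↦ ?_) fun x hx ↦ ⟨hST hx, hδ x hx⟩
      obtain ⟨c, hc⟩ := hT x hx.1
      have h2 := hδ _ hc
      rw [map_sub, map_smul, show δ x = 0 from hx.2, zero_sub, neg_eq_zero, smul_eq_mul] at h2
      rwa [(mul_eq_zero.1 h2).resolve_right hδh, zero_smul, sub_zero] at hc
    have h2 := finrank_inf_ker_add_one hhT hδh
    rw [h1, hS.1] at h2
    omega
  · intro x hx hxT
    obtain ⟨c, hc⟩ := hT x hx
    set x' := x - c • h with hx'
    have hxx : x = x' + c • h := by rw [hx']; abel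
    -- The vector `x' + c • h` is paired in turn with `h`, with `S ∩ ker a`, and with a vector of
    -- `S` outside `ker a`; this kills `a x'`, `x'` and `c`.
    have ha : a x' = 0 := by
      have h1 := hxT h hhT
      rw [hxx] at h1
      simp only [mulFunForm_apply, map_add, map_smul, LinearMap.add_apply, LinearMap.smul_apply,
        hself, smul_eq_mul, hδ _ hc, hw x' h, hh _ hc] at h1
      have h2 : δ h * a x' = 0 := by linarith
      exact (mul_eq_zero.1 h2).resolve_left hδh
    have hval : ∀ y ∈ S, g * w x' y + c * (δ h * a y) = 0 := by
      intro y hy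
      have h1 := hxT y (hST hy)
      rw [hxx] at h1
      simp only [mulFunForm_apply, map_add, map_smul, LinearMap.add_apply, LinearMap.smul_apply,
        smul_eq_mul, hδ _ hc, hδ _ hy, hh _ hy] at h1
      linarith
    have h0 : x' = 0 := by
      refine hS.2.2 _ hc ha fun y hy hay ↦ ?_
      have h1 := hval y hy
      rw [hay, mul_zero, mul_zero, add_zero] at h1
      exact (mul_eq_zero.1 h1).resolve_left hg
    obtain ⟨r, hr, hr0⟩ := hS.2.1
    have h1 := hval r hr
    rw [h0, map_zero, LinearMap.zero_apply, mul_zero, zero_add] at h1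
    have hc0 : c = 0 := (mul_eq_zero.1 h1).resolve_right (mul_ne_zero hδh hr0)
    rw [hxx, h0, hc0, zero_smul, add_zero]

theorem contactVol_ne_zero_of_liouville {k : ℕ} (hw : ∀ x y, w x y = -w y x)
    (hK : IsSymplecticOn (k + 1) K fun x y ↦ w x y) {Z : V} (hZ : Z ∈ K) {a : V → ℝ}
    (ha : ∀ x ∈ K, w Z x = a x) {ν : V →ₗ[ℝ] ℝ} (hν : ν Z ≠ 0) {e : Fin (2 * k + 1) → V}
    (he : ∀ l, e l ∈ K ⊓ LinearMap.ker ν) (hli : LinearIndependent ℝ e) :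
    contactVol k a (fun x y ↦ w x y) e ≠ 0 := by
  intro h0
  have h1 := wedgePow_cons_of_liouville hw hK.1 hZ ha hν he hZ
  rw [h0, mul_zero, mul_zero] at h1
  refine wedgePow_ne_zero hw hK (e := (Fin.cons Z e : Fin (2 * k + 1 + 1) → V)) ?_ ?_ h1
  · exact Fin.cases hZ fun l ↦ (he l).1
  · refine linearIndependent_finCons.2 ⟨hli, fun hm ↦ hν ?_⟩
    have h2 : Submodule.span ℝ (range e) ≤ LinearMap.ker ν :=
      Submodule.span_le.2 (by rintro _ ⟨l, rfl⟩; exact (he l).2)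
    exact h2 hm

/-- The constant is the determinant of the change of frame. It does not depend on `x`, so it appears
squared when two values with different first vectors are multiplied. -/
theorem exists_forall_wedgePow_cons_eq {k : ℕ} (w : V →ₗ[ℝ] V →ₗ[ℝ] ℝ) {b e : Fin (2 * k + 1) → V}
    (hb : LinearIndependent ℝ b) (he : LinearIndependent ℝ e)
    (heb : ∀ l, e l ∈ Submodule.span ℝ (range b)) :
    ∃ c : ℝ, c ≠ 0 ∧ ∀ x, wedgePow (k + 1) (fun x y ↦ w x y)
        (Fin.cons x e : Fin (2 * k + 1 + 1) → V) =
      c * wedgePow (k + 1) (fun x y ↦ w x y) (Fin.cons x b : Fin (2 * k + 1 + 1) → V) := by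
  let B := Module.Basis.span hb
  let e' : Fin (2 * k + 1) → Submodule.span ℝ (range b) := fun l ↦ ⟨e l, heb l⟩
  have hB : ∀ l, (B l : V) = b l := fun l ↦
    congrArg Subtype.val (Module.Basis.span_apply hb l)
  have he' : LinearIndependent ℝ e' := LinearIndependent.of_comp (Submodule.subtype _) he
  refine ⟨B.det e', ?_, fun x ↦ ?_⟩
  · refine ((Module.Basis.is_basis_iff_det B).1 ⟨he', ?_⟩).ne_zero
    exact he'.span_eq_top_of_card_eq_finrank' (by rw [finrank_span_eq_card hb])
  · let A := ((wedgePowAlt (k + 1) w).curryLeft x).compLinearMap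
      (Submodule.span ℝ (range b)).subtype
    have h1 := congrArg (fun f ↦ f e') (AlternatingMap.eq_smul_basis_det B A)
    have h2 : ∀ v : Fin (2 * k + 1) → Submodule.span ℝ (range b), A v =
        wedgePow (k + 1) (fun x y ↦ w x y)
          (Fin.cons x (fun l ↦ (v l : V)) : Fin (2 * k + 1 + 1) → V) :=
      fun v ↦ wedgePowAlt_apply _ _ _
    simp only [AlternatingMap.smul_apply, smul_eq_mul, h2, hB] at h1
    exact h1.trans (mul_comm _ _)

/-- Sign bookkeeping for the corner of two horizontal faces: `h` forces `c₁` and `c₂` to have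
opposite signs, and the remaining factors form a square. -/
theorem mul_neg_of_proportional {k : ℕ} {c₁ c₂ p q d t : ℝ} (ht : t ≠ 0) (hd : d ≠ 0) (hp : p < 0)
    (hq : q < 0) (h : p * (2 * (k + 1) * c₁) = -(q * (2 * (k + 1) * c₂)))
    (h0 : p * (2 * (k + 1) * c₁) ≠ 0) :
    d * -(1 * (2 * (k + 1) * (t * c₁))) * (d * -(1 * (2 * (k + 1) * (t * c₂)))) < 0 := by
  have hk : (0 : ℝ) < 2 * (k + 1) := by positivity
  set n : ℝ := 2 * (k + 1)
  have h1 : p * c₁ = -(q * c₂) := mul_left_cancel₀ hk.ne' (by linarith)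
  have h2 : c₁ ≠ 0 := by
    rintro rfl
    simp at h0
  have h3 : q * (c₁ * c₂) = -(p * (c₁ * c₁)) := by linear_combination c₁ * h1
  have h4 : 0 < -(p * (c₁ * c₁)) := neg_pos.2 (mul_neg_of_neg_of_pos hp (mul_self_pos.2 h2))
  have h5 : c₁ * c₂ < 0 := by
    by_contra! h12
    linarith [mul_nonpos_of_nonpos_of_nonneg hq.le h12]
  have h8 : 0 < (d * n * t) ^ 2 := by positivity
  calc _ = (d * n * t) ^ 2 * (c₁ * c₂) := by ring
    _ < 0 := mul_neg_of_pos_of_neg h8 h5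

theorem exists_linearIndependent_of_finrank_eq {S : Submodule ℝ V} {n : ℕ}
    (hS : Module.finrank ℝ S = n) : ∃ f : Fin n → V, (∀ l, f l ∈ S) ∧ LinearIndependent ℝ f := by
  obtain ⟨F⟩ : Nonempty (Module.Basis (Fin n) ℝ S) := ⟨Module.finBasisOfFinrankEq ℝ S hS⟩
  exact ⟨fun l ↦ F l, fun l ↦ (F l).2, F.linearIndependent.map' S.subtype (Submodule.ker_subtype _)⟩

/-- At a corner where two hypersurfaces containing the `da`-orthogonal line `h` meet, the
orientations of the two pages by `d(g a)` agree. -/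
theorem wedgePow_mul_neg_of_two_horizontal {k : ℕ} (hw : ∀ x y, w x y = -w y x)
    (hK : IsSymplecticOn (k + 1) K fun x y ↦ w x y) {Z : V} (hZ : Z ∈ K) {a : V →ₗ[ℝ] ℝ}
    (ha : ∀ x ∈ K, w Z x = a x) {ν μ : V →ₗ[ℝ] ℝ} (hν : ν Z < 0) (hμ : μ Z < 0)
    {g : ℝ} (hg : 0 < g) {δ : V →ₗ[ℝ] ℝ} (hδ : ∀ x ∈ K, δ x = 0)
    {h : V} (hh : ∀ x ∈ K, w h x = 0) (hδh : δ h ≠ 0) (hνh : ν h = 0) (hμh : μ h = 0)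
    {u v : V} {b c : ℝ} (hu : u - b • h ∈ K ⊓ LinearMap.ker ν)
    (hv : v - c • h ∈ K ⊓ LinearMap.ker μ) (hμu : 0 < μ u) (hνv : 0 < ν v)
    {e : Fin (2 * k + 1) → V} (heli : LinearIndependent ℝ e)
    (he : ∀ l, ∃ c : ℝ, e l - c • h ∈ K ⊓ LinearMap.ker ν ⊓ LinearMap.ker μ) :
    wedgePow (k + 1) (fun x y ↦ mulFunForm g δ a w x y)
        (Fin.cons u e : Fin (2 * k + 1 + 1) → V) *
      wedgePow (k + 1) (fun x y ↦ mulFunForm g δ a w x y)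
        (Fin.cons v e : Fin (2 * k + 1 + 1) → V) < 0 := by
  set u' := u - b • h with hu'
  set v' := v - c • h with hv'
  have hμu' : 0 < μ u' := by simpa [hu', hμh] using hμu
  have hνv' : 0 < ν v' := by simpa [hv', hνh] using hνv
  have dim1 := finrank_inf_ker_add_one hZ hν.ne
  have dim2 := finrank_inf_ker_add_one hu hμu'.ne'
  have dim3 := finrank_inf_ker_add_one hZ hμ.ne
  rw [hK.1] at dim1 dim3
  obtain ⟨f, hfS, hfli⟩ := exists_linearIndependent_of_finrank_eq
    (S := K ⊓ LinearMap.ker ν ⊓ LinearMap.ker μ) (n := 2 * k) (by omega)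
  have hfK : ∀ l, f l ∈ K := fun l ↦ (hfS l).1.1
  have hfν : ∀ l, ν (f l) = 0 := fun l ↦ (hfS l).1.2
  have hfμ : ∀ l, μ (f l) = 0 := fun l ↦ (hfS l).2
  have hbli : LinearIndependent ℝ (Fin.cons h f : Fin (2 * k + 1) → V) :=
    linearIndependent_finCons.2 ⟨hfli, notMem_span_of_ne_zero δ (fun l ↦ hδ _ (hfK l)) hδh⟩
  -- `h` is tangent to both hypersurfaces, so the frame `e` of the corner can be exchanged for `h`
  -- followed by a frame `f` of the corner of the fibre.
  obtain ⟨d, hd, hde⟩ := exists_forall_wedgePow_cons_eq (mulFunForm g δ a w) hbli heli (by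
    intro l
    obtain ⟨c, hc⟩ := he l
    have h1 : e l - c • h ∈ Submodule.span ℝ (range f) :=
      mem_span_of_linearIndependent (S := K ⊓ LinearMap.ker ν ⊓ LinearMap.ker μ)
        hfS hfli (by omega) hc
    have h2 : Submodule.span ℝ (range f) ≤
        Submodule.span ℝ (range (Fin.cons h f : Fin (2 * k + 1) → V)) :=
      Submodule.span_mono (by rintro _ ⟨l, rfl⟩; exact ⟨l.succ, rfl⟩)
    rw [← sub_add_cancel (e l) (c • h)]
    exact Submodule.add_mem _ (h2 h1) (Submodule.smul_mem _ _ (Submodule.subset_span ⟨0, rfl⟩)))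
  have swap : ∀ (x : V) (t : ℝ), wedgePow (k + 1) (fun x y ↦ mulFunForm g δ a w x y)
      (Fin.cons x (Fin.cons h f : Fin (2 * k + 1) → V) : Fin (2 * k + 1 + 1) → V) =
      -wedgePow (k + 1) (fun x y ↦ mulFunForm g δ a w x y)
      (Fin.cons h (Fin.cons (x - t • h) f : Fin (2 * k + 1) → V) : Fin (2 * k + 1 + 1) → V) := by
    intro x t
    have h1 := AlternatingMap.cons_cons_sub_smul (wedgePowAlt (k + 1) (mulFunForm g δ a w)) x h f t
    rwa [wedgePowAlt_apply, wedgePowAlt_apply] at h1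
  have huf : ∀ l, (Fin.cons u' f : Fin (2 * k + 1) → V) l ∈ K ⊓ LinearMap.ker ν :=
    Fin.cases hu fun l ↦ ⟨hfK l, hfν l⟩
  have hvf : ∀ l, (Fin.cons v' f : Fin (2 * k + 1) → V) l ∈ K ⊓ LinearMap.ker μ :=
    Fin.cases hv fun l ↦ ⟨hfK l, hfμ l⟩
  rw [hde, hde, swap u b, swap v c, ← hu', ← hv',
    wedgePow_mulFunForm_cons (S := K ⊓ LinearMap.ker ν) (c := 1) (h := h) hw (by omega)
      (fun x hx ↦ hδ x hx.1) (fun x hx ↦ hh x hx.1) huf (by simp),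
    wedgePow_mulFunForm_cons (S := K ⊓ LinearMap.ker μ) (c := 1) (h := h) hw (by omega)
      (fun x hx ↦ hδ x hx.1) (fun x hx ↦ hh x hx.1) hvf (by simp)]
  -- The frames `(v', u', f)` and `(u', v', f)` of `K` are oppositely oriented. Each is evaluated
  -- through the Liouville vector, with a negative coefficient because `Z` points outward and `v'`,
  -- `u'` point inward. Hence the contact volumes of `(u', f)` and `(v', f)` have opposite signs.
  have h1 := wedgePow_cons_of_liouville hw hK.1 hZ ha hν.ne huf hv.1
  have h2 := wedgePow_cons_of_liouville hw hK.1 hZ ha hμ.ne hvf hu.1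
  have h3 := AlternatingMap.cons_cons_swap (wedgePowAlt (k + 1) w) v' u' f
  rw [wedgePowAlt_apply, wedgePowAlt_apply] at h3
  have h4 : wedgePow (k + 1) (fun x y ↦ w x y)
      (Fin.cons v' (Fin.cons u' f : Fin (2 * k + 1) → V) : Fin (2 * k + 1 + 1) → V) ≠ 0 := by
    refine wedgePow_ne_zero hw hK ?_ ?_
    · exact Fin.cases hv.1 (Fin.cases hu.1 hfK)
    · refine linearIndependent_finCons.2 ⟨linearIndependent_finCons.2 ⟨hfli, ?_⟩, ?_⟩
      · exact notMem_span_of_ne_zero μ hfμ hμu'.ne'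
      · exact notMem_span_of_ne_zero ν (fun l ↦ (huf l).2) hνv'.ne'
  have h3 := h1.symm.trans (h3.trans (congrArg Neg.neg h2))
  have h4 := fun h0 ↦ h4 (h1.trans h0)
  set C₁ := contactVol k (fun x ↦ a x) (fun x y ↦ w x y) (Fin.cons u' f : Fin (2 * k + 1) → V)
  set C₂ := contactVol k (fun x ↦ a x) (fun x y ↦ w x y) (Fin.cons v' f : Fin (2 * k + 1) → V)
  have h5 : ν v' / ν Z < 0 := div_neg_of_pos_of_neg hνv' hν
  have h6 : μ u' / μ Z < 0 := div_neg_of_pos_of_neg hμu' hμ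
  exact mul_neg_of_proportional (k := k) (mul_ne_zero hδh (pow_pos hg k).ne') hd h5 h6 h3 h4

/-- At a corner where a hypersurface containing the `da`-orthogonal line `h` meets a page with
tangent space `K`, the orientations of the two pages by `d(g a)` agree. -/
theorem wedgePow_mul_neg_of_horizontal_vertical {k : ℕ} (hw : ∀ x y, w x y = -w y x)
    (hK : IsSymplecticOn (k + 1) K fun x y ↦ w x y) {Z : V} (hZ : Z ∈ K) {a : V →ₗ[ℝ] ℝ}
    (ha : ∀ x ∈ K, w Z x = a x) {ν : V →ₗ[ℝ] ℝ} (hν : ν Z < 0)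
    {g : ℝ} (hg : 0 < g) {δ : V →ₗ[ℝ] ℝ} (hδ : ∀ x ∈ K, δ x = 0)
    {h : V} (hh : ∀ x ∈ K, w h x = 0) (hδh : δ h < 0)
    {u v : V} {b : ℝ} (hu : u - b • h ∈ K ⊓ LinearMap.ker ν) (hb : b < 0)
    (hv : v ∈ K) (hνv : 0 < ν v)
    {e : Fin (2 * k + 1) → V} (heli : LinearIndependent ℝ e)
    (he : ∀ l, e l ∈ K ⊓ LinearMap.ker ν) :
    wedgePow (k + 1) (fun x y ↦ mulFunForm g δ a w x y)
        (Fin.cons u e : Fin (2 * k + 1 + 1) → V) *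
      wedgePow (k + 1) (fun x y ↦ mulFunForm g δ a w x y)
        (Fin.cons v e : Fin (2 * k + 1 + 1) → V) < 0 := by
  have dim1 := finrank_inf_ker_add_one hZ hν.ne
  rw [hK.1] at dim1
  have hC := contactVol_ne_zero_of_liouville hw hK hZ ha hν.ne he heli
  have hmem : ∀ l, (Fin.cons v e : Fin (2 * k + 1 + 1) → V) l ∈ K :=
    Fin.cases hv fun l ↦ (he l).1
  have h1 : wedgePow (k + 1) (fun x y ↦ mulFunForm g δ a w x y)
      (Fin.cons v e : Fin (2 * k + 1 + 1) → V) = g ^ (k + 1) * wedgePow (k + 1) (fun x y ↦ w x y)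
      (Fin.cons v e : Fin (2 * k + 1 + 1) → V) := by
    rw [← wedgePow_smul]
    refine wedgePow_congr fun i j ↦ ?_
    rw [mulFunForm_apply]
    erw [hδ _ (hmem i), hδ _ (hmem j)]
    rw [zero_mul, zero_mul, sub_zero, add_zero]
  rw [h1, wedgePow_cons_of_liouville hw hK.1 hZ ha hν.ne he hv,
    wedgePow_mulFunForm_cons (S := K ⊓ LinearMap.ker ν) hw (by omega) (fun x hx ↦ hδ x hx.1)
      (fun x hx ↦ hh x hx.1) he hu]
  set C := contactVol k (fun x ↦ a x) (fun x y ↦ w x y) e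
  -- The page in the horizontal hypersurface contributes `b * δ h > 0`, the page tangent to `K`
  -- contributes `ν v / ν Z < 0`, and both multiply the same contact volume `C`.
  have h5 : ν v / ν Z < 0 := div_neg_of_pos_of_neg hνv hν
  have h2 : 0 < b * δ h := mul_pos_of_neg_of_neg hb hδh
  have h3 : 0 < (2 * ((k : ℝ) + 1)) ^ 2 * g ^ k * g ^ (k + 1) * (C * C) :=
    mul_pos (by positivity) (mul_self_pos.2 hC)
  calc _ = (b * δ h) * ((2 * ((k : ℝ) + 1)) ^ 2 * g ^ k * g ^ (k + 1) * (C * C)) * (ν v / ν Z) := by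
        ring
    _ < 0 := mul_neg_of_pos_of_neg (mul_pos h2 h3) h5

/-- The orientation of a page near the binding. -/
theorem wedgePow_mulFunForm_cons_of_transverse {k : ℕ} (hw : ∀ x y, w x y = -w y x)
    {S : Submodule ℝ V} (hS : Module.finrank ℝ S = 2 * k + 1) {a : V →ₗ[ℝ] ℝ} {g : ℝ}
    {δ : V →ₗ[ℝ] ℝ} (hδ : ∀ x ∈ S, δ x = 0) {h : V} (hh : ∀ x ∈ S, w h x = 0)
    {l : V →ₗ[ℝ] ℝ} (hl : ∀ x ∈ S, l x = 0) (hlh : l h ≠ 0) {u : V} (hlu : l u ≠ 0)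
    (hu : ∃ c : ℝ, u - c • h ∈ S) {e : Fin (2 * k + 1) → V} (he : ∀ i, ∃ c : ℝ, e i - c • h ∈ S) :
    wedgePow (k + 1) (fun x y ↦ mulFunForm g δ a w x y)
        (Fin.cons u e : Fin (2 * k + 1 + 1) → V) =
      l u / l h * (2 * (k + 1) * (δ h * g ^ k * contactVol k a (fun x y ↦ w x y)
        fun i ↦ e i + (-(l (e i) / l u)) • u)) := by
  have hc : ∀ x c, x - c • h ∈ S → c = l x / l h := by
    intro x c hx
    have h1 := hl _ hx
    rw [map_sub, map_smul, smul_eq_mul, sub_eq_zero] at h1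
    rw [h1, mul_div_cancel_right₀ _ hlh]
  obtain ⟨b, hb⟩ := hu
  -- Since `l` vanishes on `S`, it measures the `h`-component; subtracting this multiple of `u`
  -- cancels that component. Using `u` instead of `h` matters in the limit at the binding, where the
  -- radial lift no longer has a nonzero image.
  have he' : ∀ i, e i + (-(l (e i) / l u)) • u ∈ S := by
    intro i
    obtain ⟨c, hci⟩ := he i
    have h1 : e i + (-(l (e i) / l u)) • u = (e i - c • h) + (-(l (e i) / l u)) • (u - b • h) := by
      rw [hc _ _ hb, hc _ _ hci, smul_sub, smul_smul, neg_mul, neg_smul, neg_smul,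
        div_mul_div_cancel₀ hlu]
      abel
    rw [h1]
    exact S.add_mem hci (S.smul_mem _ hb)
  have h1 := AlternatingMap.cons_add_smul (wedgePowAlt (k + 1) (mulFunForm g δ a w)) u e
    fun i ↦ -(l (e i) / l u)
  rw [wedgePowAlt_apply, wedgePowAlt_apply] at h1
  rw [← hc _ _ hb, ← wedgePow_mulFunForm_cons hw hS hδ hh he' hb]
  exact h1.symm

end LinearContact

/-! ### Exterior derivatives and changes of charts -/

section FormsInCharts

variable {V H M : Type*} [NormedAddCommGroup V] [NormedSpace ℝ V] [TopologicalSpace H]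
  {I : ModelWithCorners ℝ V H} [TopologicalSpace M] [ChartedSpace H M]

/-- Tangent spaces at different points are all the model space `V`, so equal points can be exchanged
after reading the vectors in `V`. -/
theorem OneForm.apply_congr (a : OneForm I M) {q q' : M} (h : q = q') {u u' : V} (hu : u = u') :
    a q (show TangentSpace I q from u) = a q' (show TangentSpace I q' from u') := by
  subst h hu
  rfl

/-- The derivative at `x` of the inverse of the preferred chart at `p`. -/
noncomputable def chartFrame (I : ModelWithCorners ℝ V H) (p : M) (x : V) :
    V →L[ℝ] TangentSpace I ((extChartAt I p).symm x) :=
  mfderivWithin 𝓘(ℝ, V) I (extChartAt I p).symm (range I) x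

/-- The exterior derivative of a `1`-form on a part of a vector space. -/
noncomputable def dWithin (b : V → V →L[ℝ] ℝ) (s : Set V) (x u v : V) : ℝ :=
  fderivWithin ℝ b s x u v - fderivWithin ℝ b s x v u

/-- Differentiating the pull-back gives the pulled-back derivative of `b` plus a term with the
second derivative of `φ`. That term is symmetric and drops out. Symmetry at boundary points needs
`x` to be a limit of interior points of `s`. -/
theorem dWithin_pullback {b c : V → V →L[ℝ] ℝ} {φ : V → V} {s t : Set V} {x : V}
    (hs : UniqueDiffOn ℝ s) (hx : x ∈ s) (hxs : x ∈ closure (interior s)) (hφ : ContDiffWithinAt ℝ ∞ φ s x)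
    (hφt : MapsTo φ s t) (hb : DifferentiableWithinAt ℝ b t (φ x))
    (hc : ∀ᶠ y in 𝓝[s] x, c y = (b (φ y)).comp (fderivWithin ℝ φ s y)) (u v : V) :
    dWithin c s x u v =
      dWithin b t (φ x) (fderivWithin ℝ φ s x u) (fderivWithin ℝ φ s x v) := by
  have h1 : DifferentiableWithinAt ℝ φ s x := hφ.differentiableWithinAt (by simp)
  have h2 : DifferentiableWithinAt ℝ (fderivWithin ℝ φ s) s x :=
    (hφ.fderivWithin_right (m := 1) hs (by norm_cast) hx).differentiableWithinAt one_ne_zero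
  have h3 := hφ.isSymmSndFDerivWithinAt (n := ∞)
    (by rw [minSmoothness_of_isRCLikeNormedField]; norm_cast) hs hxs hx
  have h4 : fderivWithin ℝ c s x =
      fderivWithin ℝ (fun y ↦ (b (φ y)).comp (fderivWithin ℝ φ s y)) s x :=
    Filter.EventuallyEq.fderivWithin_eq hc (hc.self_of_nhdsWithin hx)
  have h5 : DifferentiableWithinAt ℝ (fun y ↦ b (φ y)) s x := hb.comp x h1 hφt
  have h6 : fderivWithin ℝ (fun y ↦ b (φ y)) s x =
      (fderivWithin ℝ b t (φ x)).comp (fderivWithin ℝ φ s x) :=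
    fderivWithin_comp x hb h1 hφt (hs x hx)
  simp only [dWithin, h4, fderivWithin_clm_comp (hs x hx) h5 h2, h6]
  simp only [_root_.add_apply, ContinuousLinearMap.comp_apply,
    ContinuousLinearMap.compL_apply, ContinuousLinearMap.flip_apply, h3.eq u v]
  ring

theorem dWithin_smul {f : V → ℝ} {b : V → V →L[ℝ] ℝ} {s : Set V} {x : V}
    (hs : UniqueDiffWithinAt ℝ s x) (hf : DifferentiableWithinAt ℝ f s x)
    (hb : DifferentiableWithinAt ℝ b s x) (u v : V) :
    dWithin (f • b) s x u v = f x * dWithin b s x u v +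
      (fderivWithin ℝ f s x u * b x v - fderivWithin ℝ f s x v * b x u) := by
  simp only [dWithin, fderivWithin_smul hs hf hb, _root_.add_apply, _root_.smul_apply,
    ContinuousLinearMap.smulRight_apply, smul_eq_mul]
  ring

theorem OneForm.d_congr (a : OneForm I M) {q q' : M} (h : q = q') {u u' v v' : V} (hu : u = u')
    (hv : v = v') :
    a.d q (show TangentSpace I q from u) (show TangentSpace I q from v) =
      a.d q' (show TangentSpace I q' from u') (show TangentSpace I q' from v') := by
  subst h hu hv
  rfl

/-- The bilinear form `dWithin`. -/
noncomputable def dWithinForm (b : V → V →L[ℝ] ℝ) (s : Set V) (x : V) : V →ₗ[ℝ] V →ₗ[ℝ] ℝ :=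
  LinearMap.mk₂ ℝ (dWithin b s x)
    (fun u u' v ↦ by simp only [dWithin, map_add, _root_.add_apply]; ring)
    (fun c u v ↦ by simp only [dWithin, map_smul, _root_.smul_apply, smul_eq_mul]; ring)
    (fun u v v' ↦ by simp only [dWithin, map_add, _root_.add_apply]; ring)
    (fun c u v ↦ by simp only [dWithin, map_smul, _root_.smul_apply, smul_eq_mul]; ring)

/-- The exterior derivative of a `1`-form, as a bilinear form. -/
noncomputable def OneForm.dForm (a : OneForm I M) (p : M) :
    TangentSpace I p →ₗ[ℝ] TangentSpace I p →ₗ[ℝ] ℝ :=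
  (dWithinForm (V := V) (a.inChart p) (range I) (extChartAt I p p) : V →ₗ[ℝ] V →ₗ[ℝ] ℝ)

theorem OneForm.dForm_apply (a : OneForm I M) (p : M) (u v : TangentSpace I p) :
    a.dForm p u v = a.d p u v := rfl

theorem OneForm.d_antisymm (a : OneForm I M) (p : M) (u v : TangentSpace I p) :
    a.d p u v = -a.d p v u :=
  (neg_sub _ _).symm

theorem OneForm.d_add_smul (a : OneForm I M) (q : M) (x y w : TangentSpace I q) (r s : ℝ) :
    a.d q (x + r • w) (y + s • w) = a.d q x y + s * a.d q x w + r * a.d q w y := by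
  have h1 : a.dForm q w w = 0 := self_eq_neg.1 (a.d_antisymm q w w)
  have h2 : a.dForm q (x + r • w) (y + s • w) = a.dForm q x y + s * a.dForm q x w +
      (r * a.dForm q w y + r * (s * a.dForm q w w)) := by
    simp only [map_add, map_smul, LinearMap.add_apply, LinearMap.smul_apply, smul_eq_mul]
    ring
  rw [h1, mul_zero, mul_zero, add_zero] at h2
  exact h2

/-- The differential of a function with values in a vector space. -/
noncomputable def differential (I : ModelWithCorners ℝ V H) {F : Type*} [NormedAddCommGroup F]
    [NormedSpace ℝ F] (f : M → F) (p : M) : TangentSpace I p →L[ℝ] F :=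
  mfderiv I 𝓘(ℝ, F) f p

variable [IsManifold I ∞ M]

theorem OneForm.IsSmooth.contDiffOn_inChart {a : OneForm I M} (ha : a.IsSmooth) (p : M) :
    ContDiffOn ℝ ∞ (a.inChart p) (extChartAt I p).target := by
  let e := trivializationAt (V →L[ℝ] ℝ) (fun p : M ↦ TangentSpace I p →L[ℝ] ℝ) p
  have h1 : ContMDiffOn I 𝓘(ℝ, V →L[ℝ] ℝ) ∞ (fun q ↦ (e ⟨q, a q⟩).2) e.baseSet :=
    (e.contMDiffOn_section_baseSet_iff).1 ha.contMDiffOn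
  have hb : ∀ x ∈ (extChartAt I p).target, (extChartAt I p).symm x ∈ (chartAt H p).source := by
    intro x hx
    rw [← extChartAt_source I]
    exact (extChartAt I p).map_target hx
  rw [← contMDiffOn_iff_contDiffOn]
  refine (h1.comp (contMDiffOn_extChartAt_symm p) fun x hx ↦ ?_).congr fun x hx ↦ ?_
  · exact ⟨hb x hx, trivial⟩
  -- The form in the bundle trivialization and the form pulled back by the inverse chart agree,
  -- because the trivialization of the tangent bundle is the derivative of the chart.
  · ext v
    have h2 : ∀ y, y = x → (show V from chartFrame I p y v) = chartFrame I p x v := by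
      rintro _ rfl; rfl
    have h3 := h2 _ ((extChartAt I p).right_inv hx)
    have h4 : ∀ q, (e ⟨q, a q⟩).2 v =
        a q ((trivializationAt V (TangentSpace I) p).symmL ℝ q v) := by
      intro q
      simp only [e, hom_trivializationAt_apply, ContinuousLinearMap.inCoordinates,
        ContinuousLinearMap.comp_apply]
      exact congrArg (fun f : ℝ →L[ℝ] ℝ ↦ f _)
        (Bundle.Trivial.continuousLinearMapAt_trivialization ℝ M ℝ q)
    have h5 := congrArg (fun f ↦ f v) (TangentBundle.symmL_trivializationAt (I := I) (hb x hx))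
    exact (a.apply_congr rfl (h5.trans h3)).symm.trans (h4 _).symm

theorem chartFrame_self (p : M) (v : V) :
    (show V from chartFrame I p (extChartAt I p p) v) = v :=
  congrArg (fun f : TangentSpace 𝓘(ℝ, V) (extChartAt I p p) →L[ℝ] TangentSpace I p ↦ f v)
    (mfderivWithin_range_extChartAt_symm (I := I) (x := p))

theorem OneForm.inChart_self (a : OneForm I M) (p : M) :
    a.inChart p (extChartAt I p p) = a p := by
  ext v
  exact a.apply_congr (extChartAt_to_inv p) (chartFrame_self p v)

theorem fderivWithin_extChartAt_comp_symm (p q : M) {y : V} (hy : y ∈ (extChartAt I p).target)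
    (hyq : (extChartAt I p).symm y ∈ (extChartAt I q).source) (v : V) :
    fderivWithin ℝ (extChartAt I q ∘ (extChartAt I p).symm) (range I) y v =
      mfderiv I 𝓘(ℝ, V) (extChartAt I q) ((extChartAt I p).symm y) (chartFrame I p y v) := by
  rw [← mfderivWithin_eq_fderivWithin, mfderiv_comp_mfderivWithin (I' := I)]
  · rfl
  · exact mdifferentiableAt_extChartAt (by rwa [← extChartAt_source I])
  · exact mdifferentiableWithinAt_extChartAt_symm hy
  · exact I.uniqueMDiffOn _ (extChartAt_target_subset_range p hy)

theorem OneForm.inChart_eq_comp (a : OneForm I M) (p q : M) {y : V}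
    (hy : y ∈ (extChartAt I p).target)
    (hyq : (extChartAt I p).symm y ∈ (extChartAt I q).source) :
    a.inChart p y = (a.inChart q ((extChartAt I q ∘ (extChartAt I p).symm) y)).comp
      (fderivWithin ℝ (extChartAt I q ∘ (extChartAt I p).symm) (range I) y) := by
  ext v
  rw [ContinuousLinearMap.comp_apply, fderivWithin_extChartAt_comp_symm p q hy hyq]
  have h1 := congrArg (fun f ↦ f (chartFrame I p y v))
    (mfderivWithin_extChartAt_symm_comp_mfderiv_extChartAt' hyq)
  exact a.apply_congr ((extChartAt I q).left_inv hyq).symm h1.symm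

/-- The exterior derivative can be computed in any chart. -/
theorem OneForm.IsSmooth.dWithin_inChart {a : OneForm I M} (ha : a.IsSmooth) (p : M) {x : V}
    (hx : x ∈ (extChartAt I p).target) (u v : V) :
    dWithin (a.inChart p) (range I) x u v =
      a.d ((extChartAt I p).symm x) (chartFrame I p x u) (chartFrame I p x v) := by
  -- `a.d q` is defined in the preferred chart at `q`, so `d` is compared across the transition map.
  -- The derivative of the chart at its own base point is the identity, hence the derivative of the
  -- transition at `x` is `chartFrame`.
  let q := (extChartAt I p).symm x
  have hxr := extChartAt_target_subset_range p hx
  have hq : q ∈ (extChartAt I q).source := mem_extChartAt_source q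
  have hφ : ContDiffWithinAt ℝ ∞ (extChartAt I q ∘ (extChartAt I p).symm) (range I) x := by
    refine contDiffWithinAt_ext_coord_change q p ?_
    simp only [PartialEquiv.trans_source, PartialEquiv.symm_source]
    exact ⟨hx, hq⟩
  have hφ' : ∀ v, fderivWithin ℝ (extChartAt I q ∘ (extChartAt I p).symm) (range I) x v =
      chartFrame I p x v := by
    intro v
    rw [fderivWithin_extChartAt_comp_symm p q hx hq]
    exact congrArg (fun f : TangentSpace I q →L[ℝ] V ↦ f (chartFrame I p x v))
      (mfderiv_extChartAt_self (I := I) (x := q))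
  have h1 := dWithin_pullback (b := a.inChart q) (c := a.inChart p) (t := range I) I.uniqueDiffOn
    hxr (I.range_subset_closure_interior hxr) hφ (fun y _ ↦ by simp) (by
      exact ((ha.contDiffOn_inChart q).contDiffWithinAt (mem_extChartAt_target q)
        |>.differentiableWithinAt (by simp)).mono_of_mem_nhdsWithin
          (extChartAt_target_mem_nhdsWithin q)) (by
      have h2 : ∀ᶠ y in 𝓝[range I] x, (extChartAt I p).symm y ∈ (extChartAt I q).source :=
        ((continuousOn_extChartAt_symm p x hx).mono_of_mem_nhdsWithin
          (extChartAt_target_mem_nhdsWithin_of_mem hx)).preimage_mem_nhdsWithin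
          (extChartAt_source_mem_nhds q)
      filter_upwards [h2, extChartAt_target_mem_nhdsWithin_of_mem hx] with y hy1 hy2
      exact a.inChart_eq_comp p q hy2 hy1) u v
  rw [h1, hφ', hφ']
  rfl

/-- A tangent vector at `q`, read in the preferred chart at `p`. -/
noncomputable def inChartAt (p : M) {q : M} (u : TangentSpace I q) : V :=
  mfderiv I 𝓘(ℝ, V) (extChartAt I p) q u

theorem chartFrame_inChartAt (p : M) {q : M} (hq : q ∈ (extChartAt I p).source)
    (u : TangentSpace I q) :
    (show V from chartFrame I p (extChartAt I p q) (inChartAt p u)) = u :=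
  congrArg (fun f ↦ f u) (mfderivWithin_extChartAt_symm_comp_mfderiv_extChartAt' hq)

theorem continuousWithinAt_inChartAt {s : Set M} {p : M} {u : ∀ q : M, TangentSpace I q}
    (hu : ContinuousWithinAt (fun q ↦ (⟨q, u q⟩ : TangentBundle I M)) s p) :
    ContinuousWithinAt (fun q ↦ inChartAt p (u q)) s p := by
  have h1 := ((FiberBundle.continuousWithinAt_totalSpace V _).1 hu).2
  have h2 : ∀ q ∈ (extChartAt I p).source, inChartAt p (u q) =
      (trivializationAt V (TangentSpace I) p ⟨q, u q⟩).2 := by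
    intro q hq
    rw [extChartAt_source] at hq
    have h3 := congrArg (fun f ↦ f (u q))
      (TangentBundle.continuousLinearMapAt_trivializationAt (I := I) hq)
    refine h3.symm.trans ?_
    exact Bundle.Trivialization.continuousLinearMapAt_apply_of_mem (R := ℝ) _ hq (u q)
  refine h1.congr_of_eventuallyEq ?_ (h2 p (mem_extChartAt_source p))
  filter_upwards [mem_nhdsWithin_of_mem_nhds (extChartAt_source_mem_nhds (I := I) p)] with q hq
  exact h2 q hq

theorem OneForm.apply_eq_inChart (a : OneForm I M) (p : M) {q : M}
    (hq : q ∈ (extChartAt I p).source) (u : TangentSpace I q) :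
    a q u = a.inChart p (extChartAt I p q) (inChartAt p u) :=
  (a.apply_congr ((extChartAt I p).left_inv hq) (chartFrame_inChartAt p hq u)).symm

theorem OneForm.IsSmooth.d_eq_inChart {a : OneForm I M} (ha : a.IsSmooth) (p : M) {q : M}
    (hq : q ∈ (extChartAt I p).source) (u v : TangentSpace I q) :
    a.d q u v = dWithin (a.inChart p) (range I) (extChartAt I p q) (inChartAt p u)
      (inChartAt p v) := by
  rw [ha.dWithin_inChart p ((extChartAt I p).map_source hq)]
  exact (a.d_congr ((extChartAt I p).left_inv hq) (chartFrame_inChartAt p hq u)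
    (chartFrame_inChartAt p hq v)).symm

theorem OneForm.IsSmooth.continuousWithinAt_fderivWithin_inChart {a : OneForm I M}
    (ha : a.IsSmooth) (p : M) :
    ContinuousWithinAt (fderivWithin ℝ (a.inChart p) (range I)) (range I) (extChartAt I p p) := by
  have h1 : ContDiffWithinAt ℝ ∞ (a.inChart p) (range I) (extChartAt I p p) :=
    ((ha.contDiffOn_inChart p).contDiffWithinAt (mem_extChartAt_target p)).mono_of_mem_nhdsWithin
      (extChartAt_target_mem_nhdsWithin p)
  exact (h1.fderivWithin_right (m := 1) I.uniqueDiffOn (by norm_cast)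
    (mem_range_self _)).continuousWithinAt

theorem OneForm.IsSmooth.continuousWithinAt_apply {a : OneForm I M} (ha : a.IsSmooth) {s : Set M}
    {p : M} {u : ∀ q : M, TangentSpace I q}
    (hu : ContinuousWithinAt (fun q ↦ (⟨q, u q⟩ : TangentBundle I M)) s p) :
    ContinuousWithinAt (fun q ↦ a q (u q)) s p := by
  have h1 : ContinuousWithinAt (a.inChart p) (range I) (extChartAt I p p) :=
    ((ha.contDiffOn_inChart p).continuousOn _ (mem_extChartAt_target p)).mono_of_mem_nhdsWithin
      (extChartAt_target_mem_nhdsWithin p)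
  have h2 : ContinuousWithinAt (fun q ↦ a.inChart p (extChartAt I p q)) s p :=
    h1.comp (continuousAt_extChartAt p).continuousWithinAt fun q _ ↦ by simp
  have h3 := h2.clm_apply (continuousWithinAt_inChartAt hu)
  refine h3.congr_of_eventuallyEq ?_ (a.apply_eq_inChart p (mem_extChartAt_source p) _)
  filter_upwards [mem_nhdsWithin_of_mem_nhds (extChartAt_source_mem_nhds (I := I) p)] with q hq
  exact a.apply_eq_inChart p hq _

/-- The definition of `a.d q` uses a chart that jumps with `q`; chart independence allows the single
chart at `p` instead. -/
theorem OneForm.IsSmooth.continuousWithinAt_d {a : OneForm I M} (ha : a.IsSmooth) {s : Set M}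
    {p : M} {u v : ∀ q : M, TangentSpace I q}
    (hu : ContinuousWithinAt (fun q ↦ (⟨q, u q⟩ : TangentBundle I M)) s p)
    (hv : ContinuousWithinAt (fun q ↦ (⟨q, v q⟩ : TangentBundle I M)) s p) :
    ContinuousWithinAt (fun q ↦ a.d q (u q) (v q)) s p := by
  have h2 : ContinuousWithinAt
      (fun q ↦ fderivWithin ℝ (a.inChart p) (range I) (extChartAt I p q)) s p :=
    (ha.continuousWithinAt_fderivWithin_inChart p).comp
      (continuousAt_extChartAt p).continuousWithinAt fun q _ ↦ by simp
  have h3 := continuousWithinAt_inChartAt hu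
  have h4 := continuousWithinAt_inChartAt hv
  refine (((h2.clm_apply h3).clm_apply h4).sub
    ((h2.clm_apply h4).clm_apply h3)).congr_of_eventuallyEq ?_
      (ha.d_eq_inChart p (mem_extChartAt_source p) _ _)
  filter_upwards [mem_nhdsWithin_of_mem_nhds (extChartAt_source_mem_nhds (I := I) p)] with q hq
  exact ha.d_eq_inChart p hq _ _

theorem continuousWithinAt_mfderiv_apply {F : Type*} [NormedAddCommGroup F] [NormedSpace ℝ F]
    {f : M → F} (hf : ContMDiff I 𝓘(ℝ, F) ∞ f) {s : Set M} {p : M} {u : ∀ q : M, TangentSpace I q}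
    (hu : ContinuousWithinAt (fun q ↦ (⟨q, u q⟩ : TangentBundle I M)) s p) :
    ContinuousWithinAt (fun q ↦ differential I f q (u q)) s p := by
  have h1 : Continuous (tangentMap I 𝓘(ℝ, F) f) := hf.continuous_tangentMap (by simp)
  have h2 : Continuous fun z : TangentBundle 𝓘(ℝ, F) F ↦ z.2 :=
    continuous_snd.comp (tangentBundleModelSpaceHomeomorph 𝓘(ℝ, F)).continuous
  exact (h2.comp h1).continuousAt.comp_continuousWithinAt hu

theorem OneForm.IsSmooth.mulFun_d {a : OneForm I M} (ha : a.IsSmooth) {g : M → ℝ}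
    (hg : ContMDiff I 𝓘(ℝ, ℝ) ∞ g) (p : M) (u v : TangentSpace I p) :
    (a.mulFun g).d p u v = g p * a.d p u v +
      (differential I g p u * a p v - differential I g p v * a p u) := by
  have hgp : MDifferentiableAt I 𝓘(ℝ, ℝ) g p := hg.mdifferentiableAt (by simp)
  have h1 : DifferentiableWithinAt ℝ (g ∘ (extChartAt I p).symm) (range I) (extChartAt I p p) :=
    hgp.differentiableWithinAt_writtenInExtChartAt
  have h2 : DifferentiableWithinAt ℝ (a.inChart p) (range I) (extChartAt I p p) :=
    ((ha.contDiffOn_inChart p).contDiffWithinAt (mem_extChartAt_target p)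
      |>.differentiableWithinAt (by simp)).mono_of_mem_nhdsWithin
          (extChartAt_target_mem_nhdsWithin p)
  have h3 : ∀ w : TangentSpace I p, differential I g p w =
      fderivWithin ℝ (g ∘ (extChartAt I p).symm) (range I) (extChartAt I p p) w := by
    intro w
    rw [differential, hgp.mfderiv]
    rfl
  have h0 : UniqueDiffWithinAt ℝ (range I) (extChartAt I p p) := I.uniqueDiffOn _ (mem_range_self _)
  have h4 := dWithin_smul h0 h1 h2 u v
  rw [Function.comp_apply, extChartAt_to_inv, a.inChart_self] at h4
  rw [h3, h3]
  exact h4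

end FormsInCharts

/-! ### Local minima of functions on manifolds with boundary -/

section LocalMin

variable {V H M : Type*} [NormedAddCommGroup V] [NormedSpace ℝ V] [TopologicalSpace H]
  {I : ModelWithCorners ℝ V H} [TopologicalSpace M] [ChartedSpace H M]
  {F : Type*} [NormedAddCommGroup F] [NormedSpace ℝ F]

theorem differential_mfderiv_eq_zero_of_isLocalMin {f : M → ℝ} {s : F → M} {z : F}
    (hs : MDifferentiableAt 𝓘(ℝ, F) I s z) (hf : MDifferentiableAt I 𝓘(ℝ, ℝ) f (s z))
    (hmin : IsLocalMin f (s z)) (c : F) :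
    differential I f (s z) (mfderiv 𝓘(ℝ, F) I s z c) = 0 := by
  have h1 : IsLocalMin (f ∘ s) z := hs.continuousAt.eventually hmin
  have h2 := h1.fderiv_eq_zero
  rw [← mfderiv_eq_fderiv, mfderiv_comp z hf hs] at h2
  exact congrArg (fun A : F →L[ℝ] ℝ ↦ A c) h2

/-- A function with a local minimum at `q` has zero differential if a neighbourhood of `q` is
parametrized by an open subset of a vector space. -/
theorem differential_eq_zero_of_isLocalMin {f : M → ℝ} {q : M} {γ : F → M} {δ : M → F}
    (hγ : MDifferentiableAt 𝓘(ℝ, F) I γ (δ q)) (hδ : MDifferentiableAt I 𝓘(ℝ, F) δ q)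
    (hγδ : ∀ᶠ q' in 𝓝 q, γ (δ q') = q')
    (hf : MDifferentiableAt I 𝓘(ℝ, ℝ) f q) (hmin : IsLocalMin f q) :
    differential I f q = 0 := by
  have hq : γ (δ q) = q := hγδ.self_of_nhds
  have hf' : MDifferentiableAt I 𝓘(ℝ, ℝ) f (γ (δ q)) := by rwa [hq]
  have hmin' : IsLocalMin f (γ (δ q)) := by rwa [hq]
  have h1 : IsLocalMin (f ∘ γ) (δ q) := hγ.continuousAt.eventually hmin'
  have h2 := h1.fderiv_eq_zero
  have h3 : f =ᶠ[𝓝 q] (f ∘ γ) ∘ δ := by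
    filter_upwards [hγδ] with q' hq'
    simp [hq']
  have h4 : mfderiv I 𝓘(ℝ, ℝ) f q = mfderiv I 𝓘(ℝ, ℝ) ((f ∘ γ) ∘ δ) q := h3.mfderiv_eq
  rw [mfderiv_comp q (hf'.comp (δ q) hγ) hδ, mfderiv_eq_fderiv, h2] at h4
  have h5 : ∀ v : TangentSpace I q, differential I f q v = 0 := fun v ↦
    congrArg (fun A : TangentSpace I q →L[ℝ] ℝ ↦ A v) h4
  exact ContinuousLinearMap.ext h5

end LocalMin

/-! ### Coordinate functions on manifolds with corners -/

section ChartCoord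

variable {d : ℕ} {E : Type*} [TopologicalSpace E] [ChartedSpace (EuclideanQuadrant d) E]

theorem mem_range_cor {y : EuclideanSpace ℝ (Fin d)} : y ∈ range (Cor d) ↔ ∀ i, 0 ≤ y i := by
  change y ∈ range (Subtype.val : EuclideanQuadrant d → _) ↔ _
  rw [range_euclideanQuadrant]
  rfl

theorem interior_range_cor : interior (range (Cor d)) = {y | ∀ i, 0 < y i} := by
  change interior (range (Subtype.val : EuclideanQuadrant d → _)) = _
  rw [range_euclideanQuadrant, interior_euclideanQuadrant]

/-- The `i`-th coordinate of the preferred chart at `p`. -/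
noncomputable def chartCoord (p : E) (i : Fin d) (q : E) : ℝ := extChartAt (Cor d) p q i

theorem chartCoord_nonneg (p : E) (i : Fin d) (q : E) : 0 ≤ chartCoord p i q :=
  mem_range_cor.1 (by simp) i

theorem IsFace.notMem_interior {p : E} {i : Fin d} (h : IsFace p i) :
    p ∉ (Cor d).interior E := by
  intro hp
  change extChartAt (Cor d) p p ∈ interior (range (Cor d)) at hp
  rw [interior_range_cor] at hp
  exact (hp i).ne' h

/-- Moving along `-v` must make the `i`-th coordinate positive, starting from 0. -/
theorem PointsOutward.dcoord_neg {p : E} {v : TangentSpace (Cor d) p} (hv : PointsOutward p v)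
    {i : Fin d} (h : IsFace p i) : dcoord p i v < 0 := by
  obtain ⟨t, h1, h2⟩ := (hv.and self_mem_nhdsWithin).exists
  rw [interior_range_cor] at h1
  have h3 : 0 < (extChartAt (Cor d) p p) i - t * dcoord p i v := h1 i
  rw [h] at h3
  have h4 : (0 : ℝ) < t := h2
  nlinarith

theorem differential_chartCoord {p : E} [IsManifold (Cor d) ∞ E] (i : Fin d) {q : E}
    (hq : q ∈ (extChartAt (Cor d) p).source) :
    MDifferentiableAt (Cor d) 𝓘(ℝ, ℝ) (chartCoord p i) q ∧
      ∀ v, differential (Cor d) (chartCoord p i) q v = inChartAt p v i := by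
  have h1 : MDifferentiableAt (Cor d) 𝓘(ℝ, EuclideanSpace ℝ (Fin d)) (extChartAt (Cor d) p) q :=
    mdifferentiableAt_extChartAt (by rwa [← extChartAt_source (Cor d)])
  let P : EuclideanSpace ℝ (Fin d) →L[ℝ] ℝ := EuclideanSpace.proj i
  have h2 : HasMFDerivAt 𝓘(ℝ, EuclideanSpace ℝ (Fin d)) 𝓘(ℝ, ℝ) P (extChartAt (Cor d) p q) P :=
    P.hasMFDerivAt
  have h3 : HasMFDerivAt (Cor d) 𝓘(ℝ, ℝ) (chartCoord p i) q _ := h2.comp q h1.hasMFDerivAt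
  refine ⟨h3.mdifferentiableAt, fun v ↦ ?_⟩
  rw [differential, h3.mfderiv]
  rfl

end ChartCoord

/-! ### The horizontal boundary -/

section Horizontal

variable {m : ℕ} {E X : Type*}
  [TopologicalSpace E] [ChartedSpace (EuclideanQuadrant (2 * m + 4)) E]
  [TopologicalSpace X] [ChartedSpace (EuclideanHalfSpace (2 * m + 2)) X]
  [IsManifold (𝓡∂ (2 * m + 2)) ∞ X]

theorem disk_mem_nhds {z : ℂ} (hz : ‖z‖ < 2) : disk ∈ 𝓝 z :=
  Metric.closedBall_mem_nhds_of_mem (by simpa using hz)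

/-- At a boundary point of the total space over the interior of the disk, the point of the fibre
is a boundary point of the fibre. -/
theorem IsTrivialization.mem_boundary {pr : E → ℂ} {U : Set ℂ} {Φ : ℂ × X → E} {Ψ : E → X}
    (h : IsTrivialization m pr U Φ Ψ) (hpr : ContMDiff (Cor (2 * m + 4)) 𝓘(ℝ, ℂ) ∞ pr)
    {q : E} (hqU : pr q ∈ U) (hq : ‖pr q‖ < 2) {f : E → ℝ}
    (hf : MDifferentiableAt (Cor (2 * m + 4)) 𝓘(ℝ, ℝ) f q) (hmin : IsLocalMin f q)
    (hdf : differential (Cor (2 * m + 4)) f q ≠ 0) :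
    Ψ q ∈ (𝓡∂ (2 * m + 2)).boundary X := by
  by_contra hb
  rw [← ModelWithCorners.compl_interior, Set.mem_compl_iff, not_not] at hb
  apply hdf
  let ψ := extChartAt (𝓡∂ (2 * m + 2)) (Ψ q)
  have hΨ : MDifferentiableAt (Cor (2 * m + 4)) (𝓡∂ (2 * m + 2)) Ψ q :=
    (h.smooth_toFun.contMDiffAt ((h.isOpen.preimage hpr.continuous).mem_nhds hqU)).mdifferentiableAt
      (by simp)
  have hψ : MDifferentiableAt (𝓡∂ (2 * m + 2)) 𝓘(ℝ, EuclideanSpace ℝ (Fin (2 * m + 2))) ψ (Ψ q) :=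
    mdifferentiableAt_extChartAt (mem_chart_source _ _)
  have hψ' : MDifferentiableAt 𝓘(ℝ, EuclideanSpace ℝ (Fin (2 * m + 2))) (𝓡∂ (2 * m + 2)) ψ.symm
      (ψ (Ψ q)) :=
    (mdifferentiableWithinAt_extChartAt_symm (mem_extChartAt_target (Ψ q))).mdifferentiableAt
      (range_mem_nhds_isInteriorPoint hb)
  have hΦ : MDifferentiableAt (𝓘(ℝ, ℂ).prod (𝓡∂ (2 * m + 2))) (Cor (2 * m + 4)) Φ (pr q, Ψ q) := by
    refine (h.smooth_inv.contMDiffAt (prod_mem_nhds (inter_mem (h.isOpen.mem_nhds hqU)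
      (disk_mem_nhds hq)) univ_mem)).mdifferentiableAt (by simp)
  have hψq : ψ.symm (ψ (Ψ q)) = Ψ q := extChartAt_to_inv (Ψ q)
  -- If `Ψ q` were interior, `δ` and `γ` would parametrize a neighbourhood of `q` by a vector space,
  -- and a local minimum there would have zero differential.
  let δ : E → ℂ × EuclideanSpace ℝ (Fin (2 * m + 2)) := fun q' ↦ (pr q', ψ (Ψ q'))
  let γ : ℂ × EuclideanSpace ℝ (Fin (2 * m + 2)) → E := fun y ↦ Φ (y.1, ψ.symm y.2)
  have hδ : MDifferentiableAt (Cor (2 * m + 4)) 𝓘(ℝ, ℂ × EuclideanSpace ℝ (Fin (2 * m + 2))) δ q :=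
    (hpr.mdifferentiableAt (by simp)).prodMk_space (hψ.comp q hΨ)
  have hγ : MDifferentiableAt 𝓘(ℝ, ℂ × EuclideanSpace ℝ (Fin (2 * m + 2))) (Cor (2 * m + 4)) γ
      (δ q) := by
    have h1 : MDifferentiableAt 𝓘(ℝ, ℂ × EuclideanSpace ℝ (Fin (2 * m + 2))) 𝓘(ℝ, ℂ)
        (fun y : ℂ × EuclideanSpace ℝ (Fin (2 * m + 2)) ↦ y.1) (δ q) :=
      differentiableAt_fst.mdifferentiableAt
    have h2 : MDifferentiableAt 𝓘(ℝ, ℂ × EuclideanSpace ℝ (Fin (2 * m + 2)))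
        𝓘(ℝ, EuclideanSpace ℝ (Fin (2 * m + 2)))
        (fun y : ℂ × EuclideanSpace ℝ (Fin (2 * m + 2)) ↦ y.2) (δ q) :=
      differentiableAt_snd.mdifferentiableAt
    have h3 : MDifferentiableAt 𝓘(ℝ, ℂ × EuclideanSpace ℝ (Fin (2 * m + 2)))
        (𝓡∂ (2 * m + 2))
        (fun y : ℂ × EuclideanSpace ℝ (Fin (2 * m + 2)) ↦ ψ.symm y.2) (δ q) :=
      MDifferentiableAt.comp (δ q) (g := ψ.symm) hψ' h2
    have h4 := h1.prodMk h3
    refine MDifferentiableAt.comp_of_eq (δ q) hΦ h4 ?_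
    simp only [δ, hψq]
  refine differential_eq_zero_of_isLocalMin hγ hδ ?_ hf hmin
  have h5 : ∀ᶠ q' in 𝓝 q, Ψ q' ∈ ψ.source :=
    hΨ.continuousAt.eventually (extChartAt_source_mem_nhds (I := 𝓡∂ (2 * m + 2)) (Ψ q))
  filter_upwards [h5, (h.isOpen.preimage hpr.continuous).mem_nhds hqU] with q' h6 h7
  simp only [γ, δ]
  rw [ψ.left_inv h6]
  exact h.left_inv q' h7

end Horizontal

/-! ### Vertical Hamiltonian vector fields over the interior of the disk -/

section Lifts

variable {m : ℕ} {E X : Type*}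
  [TopologicalSpace E] [ChartedSpace (EuclideanQuadrant (2 * m + 4)) E]
  [IsManifold (Cor (2 * m + 4)) ∞ E]
  [TopologicalSpace X] [ChartedSpace (EuclideanHalfSpace (2 * m + 2)) X]
  [IsManifold (𝓡∂ (2 * m + 2)) ∞ X]

namespace CompatibleExactLefschetzFibration

variable (L : CompatibleExactLefschetzFibration m E X)
include L

theorem regularBase_mem_nhds {z : ℂ} (hz : z ∈ regularBase (2 * m + 4) L.pr) (hz2 : ‖z‖ < 2) :
    regularBase (2 * m + 4) L.pr ∈ 𝓝 z :=
  inter_mem (disk_mem_nhds hz2)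
    ((L.crit_finite.image L.pr).isClosed.isOpen_compl.mem_nhds hz.2)

theorem mem_horizontalBoundary {q : E} (hq : L.pr q ∈ regularBase (2 * m + 4) L.pr)
    (hq2 : ‖L.pr q‖ < 2) {f : E → ℝ}
    (hf : MDifferentiableAt (Cor (2 * m + 4)) 𝓘(ℝ, ℝ) f q) (hmin : IsLocalMin f q)
    (hdf : differential (Cor (2 * m + 4)) f q ≠ 0) :
    q ∈ horizontalBoundary m X L.pr := by
  obtain ⟨U, Φ, Ψ, hU, h⟩ := L.fibration.locally_trivial _ hq
  exact ⟨hq, U, Φ, Ψ, hU, h, h.mem_boundary L.pr_smooth hU hq2 hf hmin hdf⟩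

/-- Horizontal lifts at a point of the horizontal boundary are tangent to the boundary. -/
theorem exists_horizontal_lift {q : E} (hq : L.pr q ∈ regularBase (2 * m + 4) L.pr)
    (hq2 : ‖L.pr q‖ < 2) {f : E → ℝ}
    (hf : MDifferentiableAt (Cor (2 * m + 4)) 𝓘(ℝ, ℝ) f q) (hmin : IsLocalMin f q)
    (hdf : differential (Cor (2 * m + 4)) f q ≠ 0) (c : ℂ) :
    ∃ h, dmap L.pr q h = c ∧ (∀ v, L.α₀.d q h v = 0) ∧
      differential (Cor (2 * m + 4)) f q h = 0 := by
  obtain ⟨z₀, U, Φ, Ψ, hz₀, hU, hΦ, N, O, υ, Θ, hN, hNr, hhN, hO, hOb, hυ, hΘ, hNO, hON, -, -, -,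
    hinv⟩ := L.fibration.trivial_near_horizontal
  have hqN : q ∈ N := hhN (L.mem_horizontalBoundary hq hq2 hf hmin hdf)
  obtain ⟨hqO, hΘq⟩ := hNO q hqN
  have hreg := L.regularBase_mem_nhds hq hq2
  -- The constant section of the product structure through `q`; its velocity is the required lift.
  let s : ℂ → E := fun z ↦ Θ (z, υ q)
  have hsq : s (L.pr q) = q := hΘq
  have hΘ' : MDifferentiableAt (𝓘(ℝ, ℂ).prod (𝓡∂ (2 * m + 2))) (Cor (2 * m + 4)) Θ
      (L.pr q, υ q) := by
    refine (hΘ.contMDiffAt (inter_mem (hO.mem_nhds hqO)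
      (prod_mem_nhds hreg univ_mem))).mdifferentiableAt (by simp)
  have hs : MDifferentiableAt 𝓘(ℝ, ℂ) (Cor (2 * m + 4)) s (L.pr q) :=
    MDifferentiableAt.comp (L.pr q) hΘ'
      ((mdifferentiableAt_id (I := 𝓘(ℝ, ℂ))).prodMk (mdifferentiableAt_const (c := υ q)))
  have hev : ∀ᶠ z in 𝓝 (L.pr q), L.pr (s z) = z ∧ υ (s z) = υ q := by
    have h1 : ∀ᶠ z in 𝓝 (L.pr q), (z, υ q) ∈ O :=
      (Continuous.prodMk_left (υ q)).continuousAt.preimage_mem_nhds (hO.mem_nhds hqO)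
    filter_upwards [h1, hreg] with z hz hz'
    exact (hON z hz' _ hz).2
  have hpr : MDifferentiableAt (Cor (2 * m + 4)) 𝓘(ℝ, ℂ) L.pr (s (L.pr q)) :=
    L.pr_smooth.mdifferentiableAt (by simp)
  let h0 : TangentSpace (Cor (2 * m + 4)) (s (L.pr q)) :=
    mfderiv 𝓘(ℝ, ℂ) (Cor (2 * m + 4)) s (L.pr q) c
  have e1 : dmap L.pr (s (L.pr q)) h0 = c := by
    have h1 : (L.pr ∘ s) =ᶠ[𝓝 (L.pr q)] id := hev.mono fun z hz ↦ hz.1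
    have h2 := h1.mfderiv_eq (I := 𝓘(ℝ, ℂ)) (I' := 𝓘(ℝ, ℂ))
    rw [mfderiv_comp _ hpr hs, mfderiv_id] at h2
    exact congrArg (fun A : ℂ →L[ℝ] ℂ ↦ A c) h2
  have e2 : ∀ v, L.α₀.d (s (L.pr q)) h0 v = 0 := by
    intro v
    have hsN : s (L.pr q) ∈ N := by rwa [hsq]
    rw [hinv _ hsN]
    have h3 : mfderiv (Cor (2 * m + 4)) (Cor (2 * m + 4)) (fun p ↦ Φ (z₀, υ p)) (s (L.pr q)) h0
        = 0 := by
      -- The projection to the reference fibre is constant along `s`, so it kills `h0`. Without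
      -- differentiability its `mfderiv` is 0 by default and the same holds.
      by_cases hF : MDifferentiableAt (Cor (2 * m + 4)) (Cor (2 * m + 4))
          (fun p ↦ Φ (z₀, υ p)) (s (L.pr q))
      · have h1 : ((fun p ↦ Φ (z₀, υ p)) ∘ s) =ᶠ[𝓝 (L.pr q)] fun _ ↦ Φ (z₀, υ q) := by
          filter_upwards [hev] with z hz
          simp [hz.2]
        have h2 := h1.mfderiv_eq (I := 𝓘(ℝ, ℂ)) (I' := Cor (2 * m + 4))
        rw [mfderiv_comp _ hF hs] at h2
        have h4 := congrArg (fun A : ℂ →L[ℝ] EuclideanSpace ℝ (Fin (2 * m + 4)) ↦ A c) h2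
        refine h4.trans ?_
        exact congrArg (fun A : ℂ →L[ℝ] EuclideanSpace ℝ (Fin (2 * m + 4)) ↦ A c) mfderiv_const
      · rw [mfderiv_zero_of_not_mdifferentiableAt hF]
        rfl
    have h5 := LinearMap.map_zero₂ (L.α₀.dForm (Φ (z₀, υ (s (L.pr q)))))
      (mfderiv (Cor (2 * m + 4)) (Cor (2 * m + 4)) (fun p ↦ Φ (z₀, υ p)) (s (L.pr q)) v)
    exact (L.α₀.d_congr rfl h3 rfl).trans h5
  have e3 : differential (Cor (2 * m + 4)) f (s (L.pr q)) h0 = 0 :=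
    differential_mfderiv_eq_zero_of_isLocalMin hs (by rwa [hsq]) (by rwa [hsq]) c
  have key : ∀ q', q' = q → (∃ h, dmap L.pr q' h = c ∧ (∀ v, L.α₀.d q' h v = 0) ∧
      differential (Cor (2 * m + 4)) f q' h = 0) → ∃ h, dmap L.pr q h = c ∧
      (∀ v, L.α₀.d q h v = 0) ∧ differential (Cor (2 * m + 4)) f q h = 0 := by
    rintro _ rfl h
    exact h
  exact key _ hsq ⟨h0, e1, e2, e3⟩

/-- The Hamiltonian vector field of a function that vanishes on the horizontal boundary
is vertical. -/
theorem dmap_hamiltonian_eq_zero {q : E} (hq : L.pr q ∈ regularBase (2 * m + 4) L.pr)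
    (hq2 : ‖L.pr q‖ < 2) {f : E → ℝ}
    (hf : MDifferentiableAt (Cor (2 * m + 4)) 𝓘(ℝ, ℝ) f q) (hmin : IsLocalMin f q)
    (hdf : differential (Cor (2 * m + 4)) f q ≠ 0) {Y : TangentSpace (Cor (2 * m + 4)) q}
    (hY : ∀ w, L.α.d q Y w = differential (Cor (2 * m + 4)) f q w) : dmap L.pr q Y = 0 := by
  -- Lifting `I * dmap L.pr q Y` makes the base term of `dα(Y, h)` equal to `σ` times `|dπ(Y)|²`;
  -- the `α₀` term vanishes and the total is `df(h) = 0`.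
  obtain ⟨h, h1, h2, h3⟩ := L.exists_horizontal_lift hq hq2 hf hmin hdf
    (Complex.I * dmap L.pr q Y)
  have h4 := hY h
  rw [h3, L.dα_eq, L.α₀.d_antisymm, h2, neg_zero, zero_add, h1] at h4
  have h5 := (mul_eq_zero.1 h4).resolve_left (L.σ_pos _ (L.pr_mem q)).ne'
  have h6 : (conj (dmap L.pr q Y) * (Complex.I * dmap L.pr q Y)).im =
      Complex.normSq (dmap L.pr q Y) := by
    simp [Complex.normSq_apply]
  rw [h6] at h5
  exact Complex.normSq_eq_zero.1 h5

end CompatibleExactLefschetzFibration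
end Lifts

/-! ### Inverting symplectic forms in a chart -/

section Invertible

variable {V : Type*} [NormedAddCommGroup V] [NormedSpace ℝ V] [FiniteDimensional ℝ V]

theorem isInvertible_of_forall_eq_zero (A : V →L[ℝ] V →L[ℝ] ℝ) (hA : ∀ u, A u = 0 → u = 0) :
    A.IsInvertible := by
  have h1 : Module.finrank ℝ V = Module.finrank ℝ (V →L[ℝ] ℝ) := by
    rw [← (LinearMap.toContinuousLinearMap (𝕜 := ℝ) (E := V) (F' := ℝ)).finrank_eq]
    exact (Subspace.dual_finrank_eq (K := ℝ) (V := V)).symm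
  have h2 : Function.Injective A.toLinearMap := (injective_iff_map_eq_zero _).2 hA
  let e := LinearEquiv.ofInjectiveOfFinrankEq A.toLinearMap h2 h1
  exact ⟨e.toContinuousLinearEquiv, by ext; rfl⟩

end Invertible

theorem continuousWithinAt_sub_flip {V : Type*} [NormedAddCommGroup V] [NormedSpace ℝ V]
    {A : V → V →L[ℝ] V →L[ℝ] ℝ} {s : Set V} {x : V} (hA : ContinuousWithinAt A s x) :
    ContinuousWithinAt (fun y ↦ A y - (A y).flip) s x :=
  haveI h : IsTopologicalAddGroup (V →L[ℝ] V →L[ℝ] ℝ) :=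
    ContinuousLinearMap.topologicalAddGroup
  haveI : ContinuousSub (V →L[ℝ] V →L[ℝ] ℝ) := h.to_continuousSub
  hA.sub ((ContinuousLinearMap.flipₗᵢ ℝ V V ℝ).continuous.continuousAt.comp_continuousWithinAt hA)

/-! ### Hamiltonian vector fields of faces -/

section HamiltonianLimit

variable {m : ℕ} {E X : Type*}
  [TopologicalSpace E] [ChartedSpace (EuclideanQuadrant (2 * m + 4)) E]
  [IsManifold (Cor (2 * m + 4)) ∞ E]
  [TopologicalSpace X] [ChartedSpace (EuclideanHalfSpace (2 * m + 2)) X]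
  [IsManifold (𝓡∂ (2 * m + 2)) ∞ X]

theorem fderivWithin_comp_extChartAt_symm {pr : E → ℂ}
    (hpr : ContMDiff (Cor (2 * m + 4)) 𝓘(ℝ, ℂ) ∞ pr) (p : E)
    {x : EuclideanSpace ℝ (Fin (2 * m + 4))} (hx : x ∈ (extChartAt (Cor (2 * m + 4)) p).target)
    (v : EuclideanSpace ℝ (Fin (2 * m + 4))) :
    fderivWithin ℝ (pr ∘ (extChartAt (Cor (2 * m + 4)) p).symm) (range (Cor (2 * m + 4))) x v =
      dmap pr ((extChartAt (Cor (2 * m + 4)) p).symm x) (chartFrame (Cor (2 * m + 4)) p x v) := by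
  rw [← mfderivWithin_eq_fderivWithin, mfderiv_comp_mfderivWithin (I' := Cor (2 * m + 4))]
  · rfl
  · exact hpr.mdifferentiableAt (by simp)
  · exact mdifferentiableWithinAt_extChartAt_symm hx
  · exact (Cor (2 * m + 4)).uniqueMDiffOn _ (extChartAt_target_subset_range p hx)

theorem contDiffWithinAt_comp_extChartAt_symm {pr : E → ℂ}
    (hpr : ContMDiff (Cor (2 * m + 4)) 𝓘(ℝ, ℂ) ∞ pr) (p : E) :
    ContDiffWithinAt ℝ ∞ (pr ∘ (extChartAt (Cor (2 * m + 4)) p).symm) (range (Cor (2 * m + 4)))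
      (extChartAt (Cor (2 * m + 4)) p p) := by
  have h1 := hpr.comp_contMDiffOn (contMDiffOn_extChartAt_symm (I := Cor (2 * m + 4)) (n := ∞) p)
  rw [contMDiffOn_iff_contDiffOn] at h1
  exact (h1 _ (mem_extChartAt_target p)).mono_of_mem_nhdsWithin
    (extChartAt_target_mem_nhdsWithin p)

/-- The coordinate functional `i`. -/
noncomputable abbrev coordFun (m : ℕ) (i : Fin (2 * m + 4)) :
    EuclideanSpace ℝ (Fin (2 * m + 4)) →L[ℝ] ℝ := EuclideanSpace.proj i

namespace CompatibleExactLefschetzFibration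

variable (L : CompatibleExactLefschetzFibration m E X)
include L

/-- The symplectic form in the preferred chart at `p`. -/
noncomputable def formInChart (p : E) (x : EuclideanSpace ℝ (Fin (2 * m + 4))) :
    EuclideanSpace ℝ (Fin (2 * m + 4)) →L[ℝ] EuclideanSpace ℝ (Fin (2 * m + 4)) →L[ℝ] ℝ :=
  fderivWithin ℝ (L.α.inChart p) (range (Cor (2 * m + 4))) x -
    (fderivWithin ℝ (L.α.inChart p) (range (Cor (2 * m + 4))) x).flip

theorem formInChart_apply (p : E) {x : EuclideanSpace ℝ (Fin (2 * m + 4))}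
    (hx : x ∈ (extChartAt (Cor (2 * m + 4)) p).target)
    (u v : EuclideanSpace ℝ (Fin (2 * m + 4))) :
    L.formInChart p x u v = L.α.d ((extChartAt (Cor (2 * m + 4)) p).symm x)
      (chartFrame (Cor (2 * m + 4)) p x u) (chartFrame (Cor (2 * m + 4)) p x v) :=
  L.exact_symplectic.smooth.dWithin_inChart p hx u v

theorem isInvertible_formInChart (p : E) {x : EuclideanSpace ℝ (Fin (2 * m + 4))}
    (hx : x ∈ (extChartAt (Cor (2 * m + 4)) p).target) : (L.formInChart p x).IsInvertible := by
  apply isInvertible_of_forall_eq_zero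
  intro u hu
  obtain ⟨A, hA⟩ : (chartFrame (Cor (2 * m + 4)) p x).IsInvertible :=
    isInvertible_mfderivWithin_extChartAt_symm hx
  have h1 : chartFrame (Cor (2 * m + 4)) p x u = 0 := by
    apply L.exact_symplectic.nondegenerate
    intro w
    obtain ⟨v, hv⟩ := A.surjective w
    have hv' : chartFrame (Cor (2 * m + 4)) p x v = w := by rw [← hA]; exact hv
    rw [← hv', ← L.formInChart_apply p hx, hu]
    rfl
  rw [← hA] at h1
  exact A.map_eq_zero_iff.1 h1

theorem continuousWithinAt_formInChart (p : E) :
    ContinuousWithinAt (L.formInChart p) (range (Cor (2 * m + 4)))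
      (extChartAt (Cor (2 * m + 4)) p p) := by
  exact continuousWithinAt_sub_flip
    (L.exact_symplectic.smooth.continuousWithinAt_fderivWithin_inChart p)

/-- If the face `i` at `p` is approximated by points over interior regular values, then
its characteristic direction is vertical. -/
theorem exists_vertical_hamiltonian (p : E) (i : Fin (2 * m + 4))
    (hp : ∃ᶠ x in 𝓝[range (Cor (2 * m + 4))] extChartAt (Cor (2 * m + 4)) p p, x i = 0 ∧
      L.pr ((extChartAt (Cor (2 * m + 4)) p).symm x) ∈ regularBase (2 * m + 4) L.pr ∧
      ‖L.pr ((extChartAt (Cor (2 * m + 4)) p).symm x)‖ < 2) :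
    ∃ Y, dmap L.pr p Y = 0 ∧ ∀ w, L.α.d p Y w = dcoord p i w := by
  let x₀ := extChartAt (Cor (2 * m + 4)) p p
  have hx₀ : x₀ ∈ (extChartAt (Cor (2 * m + 4)) p).target := mem_extChartAt_target p
  -- The Hamiltonian vector field of the `i`-th coordinate, continuous at `x₀` because inversion of
  -- linear maps is. Thus the closed condition `G = 0` passes from nearby face points to `x₀`.
  let y := fun x ↦ (L.formInChart p x).inverse (coordFun m i)
  have hy : ∀ x ∈ (extChartAt (Cor (2 * m + 4)) p).target, L.formInChart p x (y x) =
      coordFun m i := by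
    intro x hx
    obtain ⟨e, he⟩ := L.isInvertible_formInChart p hx
    simp only [y, ← he, ContinuousLinearMap.inverse_equiv]
    exact e.apply_symm_apply _
  have hyc : ContinuousWithinAt y (range (Cor (2 * m + 4))) x₀ := by
    obtain ⟨e, he⟩ := L.isInvertible_formInChart p hx₀
    have h1 : ContinuousAt ContinuousLinearMap.inverse (L.formInChart p x₀) := by
      rw [← he]
      exact (contDiffAt_map_inverse (n := 1) e).continuousAt
    exact (h1.comp_continuousWithinAt (L.continuousWithinAt_formInChart p)).clm_apply
      continuousWithinAt_const
  let G := fun x ↦ fderivWithin ℝ (L.pr ∘ (extChartAt (Cor (2 * m + 4)) p).symm)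
    (range (Cor (2 * m + 4))) x (y x)
  have hGc : ContinuousWithinAt G (range (Cor (2 * m + 4))) x₀ :=
    (((contDiffWithinAt_comp_extChartAt_symm L.pr_smooth p).fderivWithin_right (m := 1)
      (Cor (2 * m + 4)).uniqueDiffOn (by norm_cast) (mem_range_self _)).continuousWithinAt).clm_apply
        hyc
  have hG : ∃ᶠ x in 𝓝[range (Cor (2 * m + 4))] x₀, G x ∈ ({0} : Set ℂ) := by
    refine (hp.and_eventually (extChartAt_target_mem_nhdsWithin p)).mono ?_
    rintro x ⟨⟨hxi, hxr, hx2⟩, hx⟩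
    have hq : (extChartAt (Cor (2 * m + 4)) p).symm x ∈ (extChartAt (Cor (2 * m + 4)) p).source :=
      (extChartAt (Cor (2 * m + 4)) p).map_target hx
    obtain ⟨hf1, hf2⟩ := differential_chartCoord i hq
    have hf0 : chartCoord p i ((extChartAt (Cor (2 * m + 4)) p).symm x) = 0 := by
      rw [chartCoord, (extChartAt (Cor (2 * m + 4)) p).right_inv hx, hxi]
    have hframe : ∀ v, inChartAt p (chartFrame (Cor (2 * m + 4)) p x v) = v := fun v ↦
      congrArg (fun f ↦ f v) (mfderiv_extChartAt_comp_mfderivWithin_extChartAt_symm hx)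
    have hY : ∀ w, L.α.d _ (chartFrame (Cor (2 * m + 4)) p x (y x)) w =
        differential (Cor (2 * m + 4)) (chartCoord p i) _ w := by
      intro w
      obtain ⟨A, hA⟩ : (chartFrame (Cor (2 * m + 4)) p x).IsInvertible :=
        isInvertible_mfderivWithin_extChartAt_symm hx
      obtain ⟨v, hv⟩ := A.surjective w
      have hv' : chartFrame (Cor (2 * m + 4)) p x v = w := by rw [← hA]; exact hv
      rw [← hv', ← L.formInChart_apply p hx, hy x hx, hf2, hframe]
      rfl
    have hdf : differential (Cor (2 * m + 4)) (chartCoord p i)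
        ((extChartAt (Cor (2 * m + 4)) p).symm x) ≠ 0 := by
      intro h
      have h1 := hf2 (chartFrame (Cor (2 * m + 4)) p x (EuclideanSpace.single i 1))
      rw [h, hframe] at h1
      have h2 : (0 : ℝ) = 1 := h1.trans (by simp)
      exact zero_ne_one h2
    rw [mem_singleton_iff]
    refine (fderivWithin_comp_extChartAt_symm L.pr_smooth p hx _).trans ?_
    -- The coordinate is nonnegative everywhere, even off the chart domain, because chart values lie
    -- in the quadrant; it vanishes on the face and so is minimal there.
    refine L.dmap_hamiltonian_eq_zero hxr hx2 hf1 (Eventually.of_forall fun q ↦ ?_) hdf hY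
    rw [hf0]
    exact chartCoord_nonneg p i q
  have hG0 : G x₀ ∈ ({0} : Set ℂ) := isClosed_singleton.mem_of_frequently_of_tendsto hG hGc
  refine ⟨y x₀, ?_, fun w ↦ ?_⟩
  · have h1 := fderivWithin_comp_extChartAt_symm L.pr_smooth p hx₀ (y x₀)
    have h2 : ∀ q, q = p → ∀ (u v : EuclideanSpace ℝ (Fin (2 * m + 4))), u = v →
        dmap L.pr q u = dmap L.pr p v := by
      rintro _ rfl _ _ rfl; rfl
    have h3 := h2 _ (extChartAt_to_inv (I := Cor (2 * m + 4)) p) _ _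
      (chartFrame_self (I := Cor (2 * m + 4)) p (y x₀))
    exact h3.symm.trans (h1.symm.trans hG0)
  · exact congrArg (fun A ↦ A w) (hy x₀ hx₀)

end CompatibleExactLefschetzFibration
end HamiltonianLimit

theorem eventually_lt_of_hasDerivWithinAt {r : ℝ → ℝ} {r' : ℝ}
    (hr : HasDerivWithinAt r r' (Ici 0) 0) (hr' : r' < 0) : ∀ᶠ t in 𝓝[>] 0, r t < r 0 := by
  have h1 := (hasDerivWithinAt_iff_tendsto_slope' (lt_irrefl (0 : ℝ))).1 hr.Ioi_of_Ici
  filter_upwards [h1.eventually (gt_mem_nhds hr'), self_mem_nhdsWithin] with t ht ht0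
  have h3 : (0 : ℝ) < t := ht0
  rw [slope_def_field, sub_zero, div_neg_iff] at ht
  rcases ht with h | h <;> linarith

theorem hasDerivWithinAt_normSq_curve {z : ℝ → ℂ} {z' : ℂ} (hz : HasDerivWithinAt z z' (Ici 0) 0) :
    HasDerivWithinAt (fun t ↦ ‖z t‖ ^ 2) (2 * (conj (z 0) * z').re) (Ici 0) 0 := by
  have h := hz.norm_sq
  rwa [Complex.inner, mul_comm z' (conj (z 0))] at h

/-- A functional that does not vanish on the face `i` does not vanish on some vector in
its interior. -/
theorem exists_coord_pos_apply_ne_zero {d : ℕ} (ℓ : EuclideanSpace ℝ (Fin d) →ₗ[ℝ] ℝ) {i : Fin d}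
    {v₁ : EuclideanSpace ℝ (Fin d)} (hv₁ : v₁ i = 0) (hℓ : ℓ v₁ ≠ 0) :
    ∃ v : EuclideanSpace ℝ (Fin d), v i = 0 ∧ (∀ j, 0 ≤ v j) ∧ ℓ v ≠ 0 := by
  -- `v₀` is so far inside the face that `v₀ + v₁` still has nonnegative coordinates; `ℓ` cannot
  -- vanish on both.
  let v₀ : EuclideanSpace ℝ (Fin d) := WithLp.toLp 2 fun j ↦ if j = i then 0 else ‖v₁‖
  have h0 : ∀ j, v₀ j = if j = i then 0 else ‖v₁‖ := fun j ↦ rfl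
  have hle : ∀ j, |v₁ j| ≤ ‖v₁‖ := fun j ↦ PiLp.norm_apply_le v₁ j
  by_cases h : ℓ v₀ = 0
  · refine ⟨v₀ + v₁, by simp [h0, hv₁], fun j ↦ ?_, by simpa [h] using hℓ⟩
    have h1 := abs_le.1 (hle j)
    by_cases hj : j = i
    · simp [hj, h0, hv₁]
    · simp only [PiLp.add_apply, h0, hj, if_false]
      linarith
  · refine ⟨v₀, by simp [h0], fun j ↦ ?_, h⟩
    rw [h0]
    split_ifs
    · exact le_rfl
    · exact norm_nonneg _

/-! ### Horizontal and vertical faces -/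

section Dichotomy

variable {m : ℕ} {E X : Type*}
  [TopologicalSpace E] [ChartedSpace (EuclideanQuadrant (2 * m + 4)) E]

/-- The curve in `E` that starts at `p` in the direction `v`, in the preferred chart at `p`. -/
noncomputable def chartCurve (p : E) (v : EuclideanSpace ℝ (Fin (2 * m + 4))) (t : ℝ) : E :=
  (extChartAt (Cor (2 * m + 4)) p).symm (extChartAt (Cor (2 * m + 4)) p p + t • v)

theorem chartCurve_zero (p : E) (v : EuclideanSpace ℝ (Fin (2 * m + 4))) :
    chartCurve p v 0 = p := by
  simp [chartCurve]

theorem add_smul_mem_range_cor (p : E) {v : EuclideanSpace ℝ (Fin (2 * m + 4))}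
    (hv : ∀ j, 0 ≤ v j) {t : ℝ} (ht : 0 ≤ t) :
    extChartAt (Cor (2 * m + 4)) p p + t • v ∈ range (Cor (2 * m + 4)) := by
  refine mem_range_cor.2 fun j ↦ ?_
  have h1 : 0 ≤ extChartAt (Cor (2 * m + 4)) p p j := chartCoord_nonneg p j p
  have h2 := mul_nonneg ht (hv j)
  simp only [PiLp.add_apply, PiLp.smul_apply, smul_eq_mul]
  linarith

variable [IsManifold (Cor (2 * m + 4)) ∞ E]

theorem hasDerivWithinAt_chartCurve {pr : E → ℂ}
    (hpr : ContMDiff (Cor (2 * m + 4)) 𝓘(ℝ, ℂ) ∞ pr) (p : E)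
    {v : EuclideanSpace ℝ (Fin (2 * m + 4))} (hv : ∀ j, 0 ≤ v j) :
    HasDerivWithinAt (fun t ↦ pr (chartCurve p v t)) (dmap pr p v) (Ici 0) 0 := by
  let x₀ := extChartAt (Cor (2 * m + 4)) p p
  have h1 := ((contDiffWithinAt_comp_extChartAt_symm hpr p).differentiableWithinAt
    (by simp)).hasFDerivWithinAt
  have h2 : HasDerivWithinAt (fun t : ℝ ↦ x₀ + t • v) ((1 : ℝ) • v) (Ici 0) 0 :=
    (((hasDerivAt_id (0 : ℝ)).smul_const v).const_add x₀).hasDerivWithinAt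
  have h3 := h1.comp_hasDerivWithinAt_of_eq 0 h2 (fun t ht ↦ add_smul_mem_range_cor p hv ht)
    (by simp [x₀])
  have h4 := fderivWithin_comp_extChartAt_symm hpr p (mem_extChartAt_target p) v
  have h5 : ∀ q, q = p → ∀ (u v : EuclideanSpace ℝ (Fin (2 * m + 4))), u = v →
      dmap pr q u = dmap pr p v := by
    rintro _ rfl _ _ rfl; rfl
  have h6 := h5 _ (extChartAt_to_inv (I := Cor (2 * m + 4)) p) _ _
    (chartFrame_self (I := Cor (2 * m + 4)) p v)
  rw [one_smul] at h3
  have h7 := h4.trans h6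
  rw [h7] at h3
  exact h3

variable [TopologicalSpace X] [ChartedSpace (EuclideanHalfSpace (2 * m + 2)) X]
  [IsManifold (𝓡∂ (2 * m + 2)) ∞ X]

namespace CompatibleExactLefschetzFibration

variable (L : CompatibleExactLefschetzFibration m E X)
include L

theorem norm_pr_le (p : E) : ‖L.pr p‖ ≤ 2 := by simpa using L.pr_mem p

theorem dmap_surjective_of_isFace {p : E} {i : Fin (2 * m + 4)} (h : IsFace p i) :
    Function.Surjective (dmap (d := 2 * m + 4) L.pr p) := by
  by_contra hc
  exact h.notMem_interior (L.crit_interior hc)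

/-- The chart curve from `p` along `v` stays in the face `i`. Its image has nonzero initial
velocity, so it leaves the finite set of critical values at once, and `p` is a limit of face points
over interior regular values. -/
theorem exists_vertical_hamiltonian_of_curve {p : E} {i : Fin (2 * m + 4)} (h : IsFace p i)
    {v : EuclideanSpace ℝ (Fin (2 * m + 4))} (hvi : v i = 0) (hv : ∀ j, 0 ≤ v j)
    (hD : dmap L.pr p v ≠ 0) (hlt : ∀ᶠ t in 𝓝[>] 0, ‖L.pr (chartCurve p v t)‖ < 2) :
    ∃ Y, dmap L.pr p Y = 0 ∧ ∀ w, L.α.d p Y w = dcoord p i w := by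
  apply L.exists_vertical_hamiltonian p i
  let x₀ := extChartAt (Cor (2 * m + 4)) p p
  have h1 : Tendsto (fun t : ℝ ↦ x₀ + t • v) (𝓝[>] 0) (𝓝[range (Cor (2 * m + 4))] x₀) := by
    refine tendsto_nhdsWithin_iff.2 ⟨?_, ?_⟩
    · have h2 : Continuous fun t : ℝ ↦ x₀ + t • v := by fun_prop
      have h3 := h2.tendsto 0
      simp only [zero_smul, add_zero] at h3
      exact h3.mono_left nhdsWithin_le_nhds
    · filter_upwards [self_mem_nhdsWithin] with t ht
      exact add_smul_mem_range_cor p hv (le_of_lt ht)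
  refine h1.frequently (Eventually.frequently ?_)
  have h2 : ∀ᶠ t in 𝓝[>] (0 : ℝ), ∀ c ∈ L.pr '' critSet (2 * m + 4) L.pr,
      L.pr (chartCurve p v t) ≠ c := by
    rw [eventually_all_finite (L.crit_finite.image _)]
    intro c _
    have h3 := (hasDerivWithinAt_chartCurve L.pr_smooth p hv).eventually_ne (c := c) hD
    rwa [Ici_sdiff_left] at h3
  filter_upwards [h2, hlt] with t ht ht'
  refine ⟨?_, ⟨L.pr_mem _, fun hc ↦ ht _ hc rfl⟩, ht'⟩
  have h4 : x₀ i = 0 := h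
  simp [h4, hvi]

/-- `|π|` attains its maximum 2 at `p`, so its square cannot increase along a direction into the
quadrant. -/
theorem re_conj_mul_dmap_nonpos {p : E} (hp : ‖L.pr p‖ = 2)
    {v : EuclideanSpace ℝ (Fin (2 * m + 4))} (hv : ∀ j, 0 ≤ v j) :
    (conj (L.pr p) * dmap L.pr p v).re ≤ 0 := by
  by_contra! hc
  have h1 := (hasDerivWithinAt_normSq_curve (hasDerivWithinAt_chartCurve L.pr_smooth p hv)).neg
  have h2 := eventually_lt_of_hasDerivWithinAt h1 (by rw [chartCurve_zero]; linarith)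
  obtain ⟨t, ht⟩ := h2.exists
  simp only [Pi.neg_apply, chartCurve_zero, hp] at ht
  have h3 := L.norm_pr_le (chartCurve p v t)
  nlinarith [norm_nonneg (L.pr (chartCurve p v t))]

/-- Every face of the boundary is horizontal (with vertical characteristic direction), or
part of the vertical boundary. -/
theorem horizontal_or_vertical {p : E} {i : Fin (2 * m + 4)} (h : IsFace p i) :
    (∃ Y, dmap L.pr p Y = 0 ∧ ∀ w, L.α.d p Y w = dcoord p i w) ∨
      (‖L.pr p‖ = 2 ∧ ∃ c < 0, ∀ v, (conj (L.pr p) * dmap L.pr p v).re = c * dcoord p i v) := by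
  let V := EuclideanSpace ℝ (Fin (2 * m + 4))
  let D : V →L[ℝ] ℂ := dmap L.pr p
  have hDs : Function.Surjective D := L.dmap_surjective_of_isFace h
  let e : V := EuclideanSpace.single i 1
  have he : e i = 1 := by simp [e]
  rcases (L.norm_pr_le p).lt_or_eq with hlt | heq
  · left
    -- Otherwise `D` would factor through one real coordinate and could not be onto `ℂ`.
    have h1 : ∃ v : V, v i = 0 ∧ D v ≠ 0 := by
      by_contra! hc
      have h2 : ∀ v : V, D v = v i • D e := by
        intro v
        have h3 := hc (v - v i • e) (by
          change v i - v i * e i = 0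
          rw [he, mul_one, sub_self])
        rw [map_sub, map_smul, sub_eq_zero] at h3
        exact h3
      obtain ⟨v, hv⟩ := hDs 1
      obtain ⟨v', hv'⟩ := hDs Complex.I
      rw [h2] at hv hv'
      have h4 : v i * (D e).im = 0 := by simpa using congrArg Complex.im hv
      have h5 : v i * (D e).re = 1 := by simpa using congrArg Complex.re hv
      have h6 : v' i * (D e).im = 1 := by simpa using congrArg Complex.im hv'
      rcases mul_eq_zero.1 h4 with h7 | h7 <;> simp [h7] at h5 h6
    obtain ⟨v₁, hv₁, hDv₁⟩ := h1
    let ℓ : V →ₗ[ℝ] ℝ := (Complex.reCLM.comp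
      ((ContinuousLinearMap.mul ℝ ℂ (conj (D v₁))).comp D)).toLinearMap
    have hℓ : ∀ v, ℓ v = (conj (D v₁) * D v).re := fun v ↦ rfl
    have hℓ₁ : ℓ v₁ ≠ 0 := by
      rw [hℓ, mul_comm, Complex.mul_conj, Complex.ofReal_re]
      exact fun hc ↦ hDv₁ (Complex.normSq_eq_zero.1 hc)
    obtain ⟨v, hvi, hv, hℓv⟩ := exists_coord_pos_apply_ne_zero ℓ hv₁ hℓ₁
    refine L.exists_vertical_hamiltonian_of_curve h hvi hv (fun hc ↦ hℓv ?_) ?_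
    · have hc' : D v = 0 := hc
      rw [hℓ, hc', mul_zero, Complex.zero_re]
    · have h2 := (hasDerivWithinAt_chartCurve L.pr_smooth p hv).continuousWithinAt
      have h3 : Tendsto (fun t ↦ ‖L.pr (chartCurve p v t)‖) (𝓝[>] 0) (𝓝 ‖L.pr p‖) := by
        have h4 := h2.norm.mono_left (nhdsWithin_mono 0 Ioi_subset_Ici_self)
        simpa only [chartCurve_zero] using h4
      exact h3.eventually (gt_mem_nhds hlt)
  · let ℓ : V →ₗ[ℝ] ℝ := (Complex.reCLM.comp
      ((ContinuousLinearMap.mul ℝ ℂ (conj (L.pr p))).comp D)).toLinearMap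
    have hℓ : ∀ v, ℓ v = (conj (L.pr p) * D v).re := fun v ↦ rfl
    -- `ℓ` is half the differential of `|π|²`. Either it is a multiple of the face coordinate, and
    -- the face is vertical, or some direction in the face enters `|π| < 2`, and the limit argument
    -- applies.
    by_cases hz : ∀ v : V, v i = 0 → ℓ v = 0
    · right
      have h2 : ∀ v : V, ℓ v = ℓ e * v i := by
        intro v
        have h3 := hz (v - v i • e) (by
          change v i - v i * e i = 0
          rw [he, mul_one, sub_self])
        rw [map_sub, map_smul, sub_eq_zero] at h3
        rw [h3, smul_eq_mul, mul_comm]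
      have h3 : ℓ e ≤ 0 := by
        refine L.re_conj_mul_dmap_nonpos heq fun j ↦ ?_
        by_cases hj : j = i
        · rw [hj, he]; exact zero_le_one
        · simp [e, hj]
      have h4 : ℓ e ≠ 0 := by
        intro hc
        obtain ⟨v, hv⟩ := hDs (L.pr p)
        have h5 := h2 v
        rw [hc, zero_mul, hℓ, hv, mul_comm, Complex.mul_conj, Complex.ofReal_re,
          Complex.normSq_eq_norm_sq, heq] at h5
        norm_num at h5
      exact ⟨heq, ℓ e, lt_of_le_of_ne h3 h4, h2⟩
    · left
      push Not at hz
      obtain ⟨v₁, hv₁, hℓ₁⟩ := hz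
      obtain ⟨v, hvi, hv, hℓv⟩ := exists_coord_pos_apply_ne_zero ℓ hv₁ hℓ₁
      have hneg : (conj (L.pr p) * dmap L.pr p v).re < 0 :=
        lt_of_le_of_ne (L.re_conj_mul_dmap_nonpos heq hv) hℓv
      refine L.exists_vertical_hamiltonian_of_curve h hvi hv (fun hc ↦ hℓv ?_) ?_
      · have hc' : D v = 0 := hc
        rw [hℓ, hc', mul_zero, Complex.zero_re]
      · have h1 := hasDerivWithinAt_normSq_curve (hasDerivWithinAt_chartCurve L.pr_smooth p hv)
        filter_upwards [eventually_lt_of_hasDerivWithinAt h1 (by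
          rw [chartCurve_zero]; linarith)] with t ht
        rw [chartCurve_zero, heq] at ht
        nlinarith [norm_nonneg (L.pr (chartCurve p v t))]

end CompatibleExactLefschetzFibration
end Dichotomy

/-! ### Duality on symplectic subspaces and rescaling of contact forms -/

section Linear

variable {V : Type*} [AddCommGroup V] [Module ℝ V]

theorem IsSymplecticOn.exists_mem_eq [FiniteDimensional ℝ V] {k : ℕ} {K : Submodule ℝ V}
    {w : V →ₗ[ℝ] V →ₗ[ℝ] ℝ} (hK : IsSymplecticOn k K fun x y ↦ w x y) (φ : V →ₗ[ℝ] ℝ) :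
    ∃ Z ∈ K, ∀ x ∈ K, w Z x = φ x := by
  let A : K →ₗ[ℝ] Module.Dual ℝ K := (w.domRestrict K).compl₂ K.subtype
  have hA : Function.Injective A := by
    refine (injective_iff_map_eq_zero A).2 fun x hx ↦ Subtype.ext (hK.2 x x.2 fun y hy ↦ ?_)
    exact congrArg (fun B ↦ B ⟨y, hy⟩) hx
  have hA' := (LinearMap.injective_iff_surjective_of_finrank_eq_finrank
    (Subspace.dual_finrank_eq (K := ℝ) (V := K)).symm).1 hA
  obtain ⟨Z, hZ⟩ := hA' (φ.domRestrict K)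
  exact ⟨Z, Z.2, fun x hx ↦ congrArg (fun B ↦ B ⟨x, hx⟩) hZ⟩

theorem IsContactOn.smul {k : ℕ} {T : Submodule ℝ V} {a : V → ℝ} {w : V → V → ℝ}
    (h : IsContactOn k T a w) {c : ℝ} (hc : c ≠ 0) :
    IsContactOn k T (fun x ↦ c * a x) (fun x y ↦ c * w x y) := by
  obtain ⟨h1, ⟨x, hx, hax⟩, h3⟩ := h
  refine ⟨h1, ⟨x, hx, mul_ne_zero hc hax⟩, fun y hy hay hwy ↦ h3 y hy ?_ fun y' hy' hay' ↦ ?_⟩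
  · exact (mul_eq_zero.1 hay).resolve_left hc
  · exact (mul_eq_zero.1 (hwy y' hy' (mul_eq_zero_of_right c hay'))).resolve_left hc

end Linear

/-! ### Linear algebra at points of the boundary -/

section BoundaryPoints

instance {d : ℕ} {E : Type*} [TopologicalSpace E] [ChartedSpace (EuclideanQuadrant d) E] (p : E) :
    FiniteDimensional ℝ (TangentSpace (Cor d) p) :=
  inferInstanceAs (FiniteDimensional ℝ (EuclideanSpace ℝ (Fin d)))

theorem finrank_tangentSpace {d : ℕ} {E : Type*} [TopologicalSpace E]
    [ChartedSpace (EuclideanQuadrant d) E] (p : E) :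
    Module.finrank ℝ (TangentSpace (Cor d) p) = d :=
  finrank_euclideanSpace_fin (𝕜 := ℝ) (n := d)

variable {m : ℕ} {E X : Type*}
  [TopologicalSpace E] [ChartedSpace (EuclideanQuadrant (2 * m + 4)) E]
  [IsManifold (Cor (2 * m + 4)) ∞ E]
  [TopologicalSpace X] [ChartedSpace (EuclideanHalfSpace (2 * m + 2)) X]
  [IsManifold (𝓡∂ (2 * m + 2)) ∞ X]

namespace CompatibleExactLefschetzFibration

variable (L : CompatibleExactLefschetzFibration m E X)

/-- The face `i` through `p` belongs to the horizontal boundary: its characteristic direction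
is vertical. -/
def IsHorizontalFace (p : E) (i : Fin (2 * m + 4)) : Prop :=
  ∃ Y ∈ vert L.pr p, ∀ w, L.α.d p Y w = dcoord p i w

/-- The face `i` through `p` belongs to the vertical boundary. -/
def IsVerticalFace (p : E) (i : Fin (2 * m + 4)) : Prop :=
  ‖L.pr p‖ = 2 ∧ ∃ c < 0, ∀ v, (conj (L.pr p) * dmap L.pr p v).re = c * dcoord p i v

/-- Holomorphy makes `J` preserve `ker dπ`, so a nonzero vertical `x` pairs positively with the
vertical vector `J x`. -/
theorem isSymplecticOn_vert {p : E} (hp : Function.Surjective (dmap (d := 2 * m + 4) L.pr p)) :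
    IsSymplecticOn (m + 1) (vert L.pr p) (L.α.d p) := by
  refine ⟨?_, fun x hx h ↦ ?_⟩
  · have h1 := LinearMap.finrank_range_add_finrank_ker (dmap (d := 2 * m + 4) L.pr p).toLinearMap
    rw [LinearMap.range_eq_top.2 hp, finrank_top, Complex.finrank_real_complex,
      finrank_tangentSpace] at h1
    exact Nat.add_left_cancel (n := 2) (h1.trans (by ring))
  · by_contra hx0
    have hx' : dmap L.pr p x = 0 := hx
    have hJ : L.J p x ∈ vert L.pr p := by
      change dmap L.pr p (L.J p x) = 0
      rw [L.holomorphic, hx', map_zero]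
    exact (L.tame p x hx0).ne' (h _ hJ)

section Noncritical

variable {p : E} (hp : Function.Surjective (dmap (d := 2 * m + 4) L.pr p))
include hp

theorem exists_liouville_vert :
    ∃ Z ∈ vert L.pr p, ∀ x ∈ vert L.pr p, L.α.d p Z x = L.α p x :=
  IsSymplecticOn.exists_mem_eq (w := L.α.dForm p) (L.isSymplecticOn_vert hp) (L.α p).toLinearMap

/-- Any lift is corrected by the vertical vector representing its pairing with `ker dπ`. -/
theorem exists_orthogonal_lift (c : ℂ) :
    ∃ h, dmap L.pr p h = c ∧ ∀ x ∈ vert L.pr p, L.α.d p h x = 0 := by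
  obtain ⟨h, hh⟩ := hp c
  obtain ⟨Z, hZ, hZh⟩ := IsSymplecticOn.exists_mem_eq (w := L.α.dForm p) (L.isSymplecticOn_vert hp)
    (L.α.dForm p h)
  have hZ' : dmap L.pr p Z = 0 := hZ
  refine ⟨h - Z, by rw [map_sub, hh, hZ', sub_zero], fun x hx ↦ ?_⟩
  rw [← L.α.dForm_apply, map_sub, LinearMap.sub_apply, hZh x hx, sub_self]

end Noncritical

variable {L} {p : E} {i : Fin (2 * m + 4)}

/-- The face is the dα-orthogonal of a vertical vector, so it contains everything orthogonal to `ker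
dπ`. -/
theorem IsHorizontalFace.dcoord_eq_zero (hi : L.IsHorizontalFace p i)
    {h : TangentSpace (Cor (2 * m + 4)) p} (hh : ∀ x ∈ vert L.pr p, L.α.d p h x = 0) :
    dcoord p i h = 0 := by
  obtain ⟨Y, hY, hYw⟩ := hi
  rw [← hYw, L.α.d_antisymm, hh Y hY, neg_zero]

theorem dcoord_χ_neg (hf : IsFace p i) : dcoord p i (L.χ p) < 0 := by
  refine PointsOutward.dcoord_neg (L.exact_symplectic.outward p ?_) hf
  rw [← ModelWithCorners.compl_interior]
  exact hf.notMem_interior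

/-- The fibre Liouville vector and `χ` both pair with the vertical `Y` to give `α(Y)`; hence they
have the same face coordinate, and that of `χ` is negative. -/
theorem IsHorizontalFace.dcoord_neg (hi : L.IsHorizontalFace p i) (hf : IsFace p i)
    {Z : TangentSpace (Cor (2 * m + 4)) p} (hZ : ∀ x ∈ vert L.pr p, L.α.d p Z x = L.α p x) :
    dcoord p i Z < 0 := by
  obtain ⟨Y, hY, hYw⟩ := hi
  have h1 : dcoord p i Z = dcoord p i (L.χ p) := by
    rw [← hYw, ← hYw, L.α.d_antisymm, hZ Y hY, L.α.d_antisymm p Y, L.exact_symplectic.liouville]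
  rw [h1]
  exact dcoord_χ_neg hf

theorem IsHorizontalFace.of_norm_lt (hf : IsFace p i) (hp : ‖L.pr p‖ < 2) :
    L.IsHorizontalFace p i := by
  rcases L.horizontal_or_vertical hf with h | h
  · exact h
  · exact absurd h.1 hp.ne

theorem isContactOn_faceTangent (hf : IsFace p i) :
    IsContactOn (m + 1) (faceTangent p i) (L.α p) (L.α.d p) := by
  have h1 : IsSymplecticOn (m + 1 + 1) (⊤ : Submodule ℝ (TangentSpace (Cor (2 * m + 4)) p))
      (fun x y ↦ L.α.dForm p x y) := by
    refine ⟨?_, fun x _ hx ↦ L.exact_symplectic.nondegenerate p x fun v ↦ hx v trivial⟩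
    rw [finrank_top, finrank_tangentSpace]
    lia
  have h2 := isContactOn_of_liouville (k := m + 1) (w := L.α.dForm p) (K := ⊤) (Z := L.χ p)
    (a := L.α p) (ν := (dcoord p i).toLinearMap) (fun x y ↦ L.α.d_antisymm p x y) h1 trivial
    (fun x _ ↦ L.exact_symplectic.liouville p x) (dcoord_χ_neg hf).ne
  rw [top_inf_eq] at h2
  exact h2

theorem IsHorizontalFace.isContactOn_bindingTangent (hi : L.IsHorizontalFace p i)
    (hf : IsFace p i) : IsContactOn m (bindingTangent L.pr p i) (L.α p) (L.α.d p) := by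
  have hp := L.dmap_surjective_of_isFace hf
  obtain ⟨Z, hZ, hZa⟩ := L.exists_liouville_vert hp
  have h2 := isContactOn_of_liouville (k := m) (w := L.α.dForm p) (K := vert L.pr p) (Z := Z)
    (a := L.α p) (ν := (dcoord p i).toLinearMap) (fun x y ↦ L.α.d_antisymm p x y)
    (L.isSymplecticOn_vert hp) hZ hZa (hi.dcoord_neg hf hZa).ne
  rw [inf_comm] at h2
  exact h2

theorem IsHorizontalFace.wedgePow_cons_pos (hi : L.IsHorizontalFace p i) (hf : IsFace p i)
    {w : TangentSpace (Cor (2 * m + 4)) p} (hw : w ∈ vert L.pr p) (hwi : dcoord p i w < 0)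
    {e : Fin (2 * m + 1) → TangentSpace (Cor (2 * m + 4)) p}
    (he : ∀ l, e l ∈ bindingTangent L.pr p i) (hpos : 0 < contactVol m (L.α p) (L.α.d p) e) :
    0 < wedgePow (m + 1) (L.α.d p) (Fin.cons w e : Fin (2 * m + 1 + 1) → _) := by
  have hp := L.dmap_surjective_of_isFace hf
  obtain ⟨Z, hZ, hZa⟩ := L.exists_liouville_vert hp
  have h1 := hi.dcoord_neg hf hZa
  have h2 := wedgePow_cons_of_liouville (k := m) (w := L.α.dForm p) (K := vert L.pr p) (Z := Z)
    (a := L.α p) (ν := (dcoord p i).toLinearMap) (fun x y ↦ L.α.d_antisymm p x y)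
    (L.isSymplecticOn_vert hp).1 hZ hZa h1.ne (e := e) (fun l ↦ ⟨(he l).2, (he l).1⟩) hw
  have h3 : 0 < dcoord p i w / dcoord p i Z := div_pos_of_neg_of_neg hwi h1
  refine lt_of_lt_of_eq ?_ h2.symm
  exact mul_pos h3 (mul_pos (by positivity) hpos)

end CompatibleExactLefschetzFibration
end BoundaryPoints

/-! ### The adapted contact form -/

section Adapted

variable {m : ℕ} {E X : Type*}
  [TopologicalSpace E] [ChartedSpace (EuclideanQuadrant (2 * m + 4)) E]
  [IsManifold (Cor (2 * m + 4)) ∞ E]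
  [TopologicalSpace X] [ChartedSpace (EuclideanHalfSpace (2 * m + 2)) X]
  [IsManifold (𝓡∂ (2 * m + 2)) ∞ X]

namespace CompatibleExactLefschetzFibration

variable (L : CompatibleExactLefschetzFibration m E X)

/-- The function `5 - |pr|²`. -/
noncomputable def factor (p : E) : ℝ := 5 - ‖L.pr p‖ ^ 2

theorem contMDiff_factor : ContMDiff (Cor (2 * m + 4)) 𝓘(ℝ, ℝ) ∞ L.factor := by
  have h : ContDiff ℝ ∞ fun z : ℂ ↦ 5 - ‖z‖ ^ 2 := contDiff_const.sub (contDiff_norm_sq ℝ)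
  exact h.contMDiff.comp L.pr_smooth

/-- Any constant above 4 would give positivity on the disk; 5 normalizes the value over its boundary
circle to 1. -/
theorem factor_pos (p : E) : 0 < L.factor p := by
  have h := L.norm_pr_le p
  have h' := norm_nonneg (L.pr p)
  rw [factor]
  nlinarith

theorem factor_eq_one {p : E} (hp : ‖L.pr p‖ = 2) : L.factor p = 1 := by
  rw [factor, hp]
  norm_num

theorem differential_factor (p : E) (v : TangentSpace (Cor (2 * m + 4)) p) :
    differential (Cor (2 * m + 4)) L.factor p v = -2 * (conj (L.pr p) * dmap L.pr p v).re := by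
  have h1 : HasFDerivAt (fun z : ℂ ↦ 5 - ‖z‖ ^ 2) (-(2 • innerSL ℝ (L.pr p))) (L.pr p) :=
    (hasStrictFDerivAt_norm_sq (L.pr p)).hasFDerivAt.const_sub 5
  have h2 : MDifferentiableAt (Cor (2 * m + 4)) 𝓘(ℝ, ℂ) L.pr p :=
    L.pr_smooth.mdifferentiableAt (by simp)
  have h3 : HasMFDerivAt (Cor (2 * m + 4)) 𝓘(ℝ, ℝ) L.factor p _ :=
    h1.hasMFDerivAt.comp p h2.hasMFDerivAt
  rw [differential, h3.mfderiv]
  have h4 : inner ℝ (L.pr p) (dmap L.pr p v) = (conj (L.pr p) * dmap L.pr p v).re := by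
    rw [Complex.inner, mul_comm]
  rw [← h4]
  change -((2 : ℕ) • inner ℝ (L.pr p) (dmap L.pr p v)) = _
  rw [nsmul_eq_mul]
  push_cast
  ring

/-- The differential of `factor`, as a linear form. -/
noncomputable abbrev dFactor (p : E) : TangentSpace (Cor (2 * m + 4)) p →ₗ[ℝ] ℝ :=
  (differential (Cor (2 * m + 4)) L.factor p).toLinearMap

theorem dFactor_apply (p : E) (v : TangentSpace (Cor (2 * m + 4)) p) :
    L.dFactor p v = -2 * (conj (L.pr p) * dmap L.pr p v).re := L.differential_factor p v

theorem dFactor_eq_zero {p : E} {v : TangentSpace (Cor (2 * m + 4)) p} (hv : v ∈ vert L.pr p) :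
    L.dFactor p v = 0 := by
  have hv' : dmap L.pr p v = 0 := hv
  rw [L.dFactor_apply, hv', mul_zero, Complex.zero_re, mul_zero]

theorem dFactor_lift {p : E} {h : TangentSpace (Cor (2 * m + 4)) p}
    (hh : dmap L.pr p h = L.pr p) : L.dFactor p h = -2 * Complex.normSq (L.pr p) := by
  rw [L.dFactor_apply, hh, mul_comm (conj _), Complex.mul_conj, Complex.ofReal_re]

theorem mulFun_factor_d (p : E) : (L.α.mulFun L.factor).d p =
    fun x y ↦ mulFunForm (L.factor p) (L.dFactor p) (L.α p).toLinearMap (L.α.dForm p) x y := by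
  funext x y
  rw [mulFunForm_apply]
  exact L.exact_symplectic.smooth.mulFun_d L.contMDiff_factor p x y

theorem mulFun_factor_d_binding {p : E} (hp : L.pr p = 0) :
    (L.α.mulFun L.factor).d p = fun x y ↦ L.factor p * L.α.d p x y := by
  funext x y
  rw [L.mulFun_factor_d]
  beta_reduce
  rw [mulFunForm_apply, L.dFactor_apply, L.dFactor_apply, hp]
  simp only [map_zero, zero_mul, Complex.zero_re, mul_zero, sub_self, add_zero]
  rfl

variable {L} {p : E} {i : Fin (2 * m + 4)}

theorem mem_pageTangent {v : TangentSpace (Cor (2 * m + 4)) p} :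
    v ∈ pageTangent L.pr p i ↔ dcoord p i v = 0 ∧ (conj (L.pr p) * dmap L.pr p v).im = 0 :=
  Iff.rfl

/-- A vector tangent to a page decomposes into a multiple of the radial lift `h` and a
vertical vector. -/
theorem dmap_sub_smul_eq_zero (hz : L.pr p ≠ 0) {v h : TangentSpace (Cor (2 * m + 4)) p}
    (hv : (conj (L.pr p) * dmap L.pr p v).im = 0) (hh : dmap L.pr p h = L.pr p) :
    v - ((conj (L.pr p) * dmap L.pr p v).re / Complex.normSq (L.pr p)) • h ∈ vert L.pr p := by
  change dmap L.pr p (v - _ • h) = 0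
  have hn : (Complex.normSq (L.pr p) : ℂ) ≠ 0 := by
    exact_mod_cast fun h ↦ hz (Complex.normSq_eq_zero.1 h)
  have h1 : ((conj (L.pr p) * dmap L.pr p v).re : ℂ) = conj (L.pr p) * dmap L.pr p v :=
    Complex.ext (by simp) (by rw [Complex.ofReal_im, hv])
  rw [map_sub, map_smul, hh, Complex.real_smul, Complex.ofReal_div, h1, sub_eq_zero,
    div_mul_eq_mul_div, eq_div_iff hn, ← Complex.mul_conj]
  ring

theorem IsHorizontalFace.exists_sub_smul_mem (hi : L.IsHorizontalFace p i) (hz : L.pr p ≠ 0)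
    {v h : TangentSpace (Cor (2 * m + 4)) p} (hv : v ∈ pageTangent L.pr p i)
    (hh : dmap L.pr p h = L.pr p) (hhv : ∀ x ∈ vert L.pr p, L.α.d p h x = 0) :
    v - ((conj (L.pr p) * dmap L.pr p v).re / Complex.normSq (L.pr p)) • h ∈
      vert L.pr p ⊓ LinearMap.ker (dcoord p i).toLinearMap := by
  refine ⟨dmap_sub_smul_eq_zero hz hv.2 hh, ?_⟩
  change dcoord p i (v - _ • h) = 0
  rw [map_sub, map_smul, hi.dcoord_eq_zero hhv, (mem_pageTangent.1 hv).1, smul_zero, sub_zero]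

/-- Tangency to the face removes the radial part of `dπ(v)`, tangency to the page its angular part.
-/
theorem IsVerticalFace.mem_vert_of_dcoord (hi : L.IsVerticalFace p i)
    {v : TangentSpace (Cor (2 * m + 4)) p} (hv : dcoord p i v = 0)
    (hv' : (conj (L.pr p) * dmap L.pr p v).im = 0) : v ∈ vert L.pr p := by
  obtain ⟨hp, c, hc, h⟩ := hi
  have h1 : conj (L.pr p) * dmap L.pr p v = 0 :=
    Complex.ext (by rw [h, hv, mul_zero, Complex.zero_re]) hv'
  have h2 : conj (L.pr p) ≠ 0 := by
    rw [Ne, map_eq_zero]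
    intro h0
    simp [h0] at hp
  exact (mul_eq_zero.1 h1).resolve_left h2

theorem IsVerticalFace.pageTangent_eq (hi : L.IsVerticalFace p i) :
    pageTangent L.pr p i = vert L.pr p := by
  ext v
  refine ⟨fun hv ↦ hi.mem_vert_of_dcoord hv.1 hv.2, fun hv ↦ ?_⟩
  have hv' : dmap L.pr p v = 0 := hv
  obtain ⟨hp, c, hc, h⟩ := hi
  have h1 := h v
  rw [hv', mul_zero] at h1
  exact mem_pageTangent.2 ⟨(mul_eq_zero.1 h1.symm).resolve_left hc.ne, by
    rw [hv', mul_zero, Complex.zero_im]⟩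

theorem isHorizontalFace_or_isVerticalFace (hf : IsFace p i) :
    L.IsHorizontalFace p i ∨ L.IsVerticalFace p i :=
  L.horizontal_or_vertical hf

theorem not_isVerticalFace_of_ne {k : Fin (2 * m + 4)} (hik : i ≠ k) (hi : L.IsVerticalFace p i)
    (hk : L.IsVerticalFace p k) : False := by
  obtain ⟨-, c, hc, h⟩ := hi
  obtain ⟨-, c', -, h'⟩ := hk
  let e : EuclideanSpace ℝ (Fin (2 * m + 4)) := EuclideanSpace.single i 1
  have h1 : c * e i = c' * e k := (h e).symm.trans (h' e)
  have h2 : e i = 1 := by simp [e]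
  have h3 : e k = 0 := by simp [e, hik.symm]
  rw [h2, h3, mul_one, mul_zero] at h1
  exact hc.ne h1

theorem normSq_pos (hz : L.pr p ≠ 0) : 0 < Complex.normSq (L.pr p) := Complex.normSq_pos.2 hz

theorem IsHorizontalFace.isSymplecticOn_pageTangent (hi : L.IsHorizontalFace p i)
    (hf : IsFace p i) (hz : L.pr p ≠ 0) :
    IsSymplecticOn (m + 1) (pageTangent L.pr p i) ((L.α.mulFun L.factor).d p) := by
  obtain ⟨h, hh, hhv⟩ := L.exists_orthogonal_lift (L.dmap_surjective_of_isFace hf) (L.pr p)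
  have hn := normSq_pos hz
  rw [L.mulFun_factor_d]
  refine isSymplecticOn_mulFunForm (S := bindingTangent L.pr p i) (h := h)
    (fun x y ↦ L.α.d_antisymm p x y)
    (L.factor_pos p).ne' (hi.isContactOn_bindingTangent hf) ?_ ?_ ?_ ?_ ?_ ?_
  · rintro x ⟨hx, hx'⟩
    have hx'' : dmap L.pr p x = 0 := hx'
    exact mem_pageTangent.2 ⟨hx, by rw [hx'', mul_zero, Complex.zero_im]⟩
  · exact fun x hx ↦ L.dFactor_eq_zero hx.2
  · refine mem_pageTangent.2 ⟨hi.dcoord_eq_zero hhv, ?_⟩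
    rw [hh, mul_comm, Complex.mul_conj, Complex.ofReal_im]
  · exact fun x hx ↦ hhv x hx.2
  · rw [L.dFactor_lift hh]
    exact (by linarith : -2 * Complex.normSq (L.pr p) < 0).ne
  · intro x hx
    have h1 := hi.exists_sub_smul_mem hz hx hh hhv
    exact ⟨_, h1.2, h1.1⟩

theorem IsVerticalFace.isSymplecticOn_pageTangent (hi : L.IsVerticalFace p i)
    (hf : IsFace p i) :
    IsSymplecticOn (m + 1) (pageTangent L.pr p i) ((L.α.mulFun L.factor).d p) := by
  rw [hi.pageTangent_eq]
  have h1 := L.isSymplecticOn_vert (L.dmap_surjective_of_isFace hf)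
  refine ⟨h1.1, fun x hx hxy ↦ h1.2 x hx fun y hy ↦ ?_⟩
  have h2 := hxy y hy
  rw [L.mulFun_factor_d] at h2
  beta_reduce at h2
  rw [mulFunForm_apply, L.dFactor_eq_zero hx, L.dFactor_eq_zero hy,
    L.factor_eq_one hi.1] at h2
  rw [one_mul, zero_mul, zero_mul, sub_zero, add_zero] at h2
  exact h2

theorem wedgePow_mul_neg_of_isHorizontalFace_of_isVerticalFace {k : Fin (2 * m + 4)}
    (hi : L.IsHorizontalFace p i) (hk : L.IsVerticalFace p k) (hfi : IsFace p i)
    {u v : TangentSpace (Cor (2 * m + 4)) p} (hu : u ∈ pageTangent L.pr p i) (hku : 0 < dcoord p k u)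
    (hv : v ∈ pageTangent L.pr p k) (hiv : 0 < dcoord p i v)
    {e : Fin (2 * m + 1) → TangentSpace (Cor (2 * m + 4)) p} (hli : LinearIndependent ℝ e)
    (he : ∀ l, e l ∈ vert L.pr p ∧ dcoord p i (e l) = 0) :
    wedgePow (m + 1) ((L.α.mulFun L.factor).d p) (Fin.cons u e : Fin (2 * m + 1 + 1) → _) *
      wedgePow (m + 1) ((L.α.mulFun L.factor).d p) (Fin.cons v e : Fin (2 * m + 1 + 1) → _) < 0 := by
  have hp := L.dmap_surjective_of_isFace hfi
  have hz : L.pr p ≠ 0 := by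
    intro h0
    have := hk.1
    simp [h0] at this
  have hn := normSq_pos hz
  obtain ⟨h, hh, hhv⟩ := L.exists_orthogonal_lift hp (L.pr p)
  obtain ⟨Z, hZ, hZa⟩ := L.exists_liouville_vert hp
  rw [L.mulFun_factor_d]
  have hδh : L.dFactor p h < 0 := by
    rw [L.dFactor_lift hh]
    linarith
  -- `u` points from the corner into the horizontal face, hence into `|π| < 2`, so its radial
  -- component is negative.
  have hb : (conj (L.pr p) * dmap L.pr p u).re / Complex.normSq (L.pr p) < 0 := by
    obtain ⟨-, c, hc, hcv⟩ := hk
    rw [hcv]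
    exact div_neg_of_neg_of_pos (mul_neg_of_neg_of_pos hc hku) hn
  rw [hk.pageTangent_eq] at hv
  exact wedgePow_mul_neg_of_horizontal_vertical (w := L.α.dForm p) (K := vert L.pr p)
    (ν := (dcoord p i).toLinearMap)
    (fun x y ↦ L.α.d_antisymm p x y) (L.isSymplecticOn_vert hp) hZ hZa
    (hi.dcoord_neg hfi hZa) (L.factor_pos p) (fun x hx ↦ L.dFactor_eq_zero hx) hhv hδh
    (hi.exists_sub_smul_mem hz hu hh hhv) hb hv hiv hli he

theorem wedgePow_mul_neg_of_isHorizontalFace {k : Fin (2 * m + 4)} (hz : L.pr p ≠ 0)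
    (hi : L.IsHorizontalFace p i) (hk : L.IsHorizontalFace p k) (hfi : IsFace p i)
    (hfk : IsFace p k)
    {u v : TangentSpace (Cor (2 * m + 4)) p} (hu : u ∈ pageTangent L.pr p i) (hku : 0 < dcoord p k u)
    (hv : v ∈ pageTangent L.pr p k) (hiv : 0 < dcoord p i v)
    {e : Fin (2 * m + 1) → TangentSpace (Cor (2 * m + 4)) p} (hli : LinearIndependent ℝ e)
    (he : ∀ l, e l ∈ pageTangent L.pr p i ⊓ faceTangent p k) :
    wedgePow (m + 1) ((L.α.mulFun L.factor).d p) (Fin.cons u e : Fin (2 * m + 1 + 1) → _) *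
      wedgePow (m + 1) ((L.α.mulFun L.factor).d p) (Fin.cons v e : Fin (2 * m + 1 + 1) → _) < 0 := by
  have hp := L.dmap_surjective_of_isFace hfi
  have hn := normSq_pos hz
  obtain ⟨h, hh, hhv⟩ := L.exists_orthogonal_lift hp (L.pr p)
  obtain ⟨Z, hZ, hZa⟩ := L.exists_liouville_vert hp
  rw [L.mulFun_factor_d]
  have hδh : L.dFactor p h ≠ 0 := by
    rw [L.dFactor_lift hh]
    exact (by linarith : -2 * Complex.normSq (L.pr p) < 0).ne
  exact wedgePow_mul_neg_of_two_horizontal (w := L.α.dForm p) (K := vert L.pr p)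
    (ν := (dcoord p i).toLinearMap) (μ := (dcoord p k).toLinearMap)
    (fun x y ↦ L.α.d_antisymm p x y) (L.isSymplecticOn_vert hp) hZ hZa
    (hi.dcoord_neg hfi hZa) (hk.dcoord_neg hfk hZa) (L.factor_pos p)
    (fun x hx ↦ L.dFactor_eq_zero hx) hhv hδh (hi.dcoord_eq_zero hhv) (hk.dcoord_eq_zero hhv)
    (hi.exists_sub_smul_mem hz hu hh hhv) (hk.exists_sub_smul_mem hz hv hh hhv) hku hiv hli
    fun l ↦ ⟨_, hi.exists_sub_smul_mem hz (he l).1 hh hhv,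
      (hk.exists_sub_smul_mem hz (mem_pageTangent.2 ⟨(he l).2, (he l).1.2⟩) hh hhv).2⟩

end CompatibleExactLefschetzFibration
end Adapted

/-- The frames live in varying tangent spaces, so convergence is required only of the scalar
entries. -/
theorem tendsto_contactVol {ι : Type*} {l : Filter ι} {V : ι → Type*} [∀ q, AddCommGroup (V q)]
    [∀ q, Module ℝ (V q)] {W : Type*} [AddCommGroup W] [Module ℝ W] {k : ℕ}
    {a : ∀ q, V q → ℝ} {w : ∀ q, V q → V q → ℝ} {e : ∀ q, Fin (2 * k + 1) → V q}
    {a₀ : W → ℝ} {w₀ : W → W → ℝ} {e₀ : Fin (2 * k + 1) → W}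
    (ha : ∀ i, Tendsto (fun q ↦ a q (e q i)) l (𝓝 (a₀ (e₀ i))))
    (hw : ∀ i j, Tendsto (fun q ↦ w q (e q i) (e q j)) l (𝓝 (w₀ (e₀ i) (e₀ j)))) :
    Tendsto (fun q ↦ contactVol k (a q) (w q) (e q)) l (𝓝 (contactVol k a₀ w₀ e₀)) := by
  simp only [contactVol]
  exact tendsto_finsetSum _ fun s _ ↦ Tendsto.const_mul _
    ((ha _).mul (tendsto_finsetProd _ fun i _ ↦ hw _ _))

/-! ### The orientation of the binding -/

section Orientation

variable {m : ℕ} {E X : Type*}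
  [TopologicalSpace E] [ChartedSpace (EuclideanQuadrant (2 * m + 4)) E]
  [IsManifold (Cor (2 * m + 4)) ∞ E]
  [TopologicalSpace X] [ChartedSpace (EuclideanHalfSpace (2 * m + 2)) X]
  [IsManifold (𝓡∂ (2 * m + 2)) ∞ X]

namespace CompatibleExactLefschetzFibration

variable {L : CompatibleExactLefschetzFibration m E X}

/-- The differential of the radial coordinate along the page `t`. -/
noncomputable def radial (L : CompatibleExactLefschetzFibration m E X) (t : ℂ) (q : E) :
    TangentSpace (Cor (2 * m + 4)) q →ₗ[ℝ] ℝ :=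
  (Complex.reCLM.comp ((ContinuousLinearMap.mul ℝ ℂ (conj t)).comp (dmap L.pr q))).toLinearMap

theorem radial_apply (t : ℂ) (q : E) (v : TangentSpace (Cor (2 * m + 4)) q) :
    L.radial t q v = (conj t * dmap L.pr q v).re := rfl

theorem continuousWithinAt_radial (t : ℂ) {s : Set E} {p : E}
    {u : ∀ q : E, TangentSpace (Cor (2 * m + 4)) q}
    (hu : ContinuousWithinAt (fun q ↦ (⟨q, u q⟩ : TangentBundle (Cor (2 * m + 4)) E)) s p) :
    ContinuousWithinAt (fun q ↦ L.radial t q (u q)) s p := by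
  have h1 := continuousWithinAt_mfderiv_apply L.pr_smooth hu
  have h2 : Continuous fun z : ℂ ↦ (conj t * z).re := by fun_prop
  exact h2.continuousAt.comp_continuousWithinAt h1

/-- The orientation of a page over the interior of the disk. -/
theorem wedgePow_cons_pos_of_mem_page {t : ℂ} {q : E} (hq : q ∈ page (2 * m + 4) L.pr t)
    (hq2 : ‖L.pr q‖ < 2) {w : TangentSpace (Cor (2 * m + 4)) q}
    {e : Fin (2 * m + 1) → TangentSpace (Cor (2 * m + 4)) q}
    (hwe : ∀ k, IsFace q k → w ∈ pageTangent L.pr q k ∧ ∀ l, e l ∈ pageTangent L.pr q k)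
    (hw : L.radial t q w < 0)
    (hpos : 0 < contactVol m (L.α q) (L.α.d q)
      (fun l ↦ e l + (-(L.radial t q (e l) / L.radial t q w)) • w)) :
    0 < wedgePow (m + 1) ((L.α.mulFun L.factor).d q)
      (Fin.cons w e : Fin (2 * m + 1 + 1) → _) := by
  obtain ⟨⟨k, hk⟩, hz, hzt⟩ := hq
  obtain ⟨hwk, hek⟩ := hwe k hk
  have hi : L.IsHorizontalFace q k := .of_norm_lt hk hq2
  obtain ⟨h, hh, hhv⟩ := L.exists_orthogonal_lift (L.dmap_surjective_of_isFace hk) (L.pr q)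
  have hn := normSq_pos hz
  have hnorm : 0 < ‖L.pr q‖ := norm_pos_iff.2 hz
  have hlh : 0 < L.radial t q h := by
    rw [radial_apply, hh, ← hzt, map_div₀, Complex.conj_ofReal, div_mul_eq_mul_div, mul_comm,
      Complex.mul_conj, ← Complex.ofReal_div, Complex.ofReal_re]
    positivity
  have hδh : L.dFactor q h < 0 := by
    rw [L.dFactor_lift hh]
    linarith
  rw [L.mulFun_factor_d]
  have h1 := wedgePow_mulFunForm_cons_of_transverse (k := m) (w := L.α.dForm q)
    (S := bindingTangent L.pr q k) (a := (L.α q).toLinearMap) (g := L.factor q)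
    (δ := L.dFactor q) (h := h) (l := L.radial t q) (u := w) (e := e)
    (fun x y ↦ L.α.d_antisymm q x y) (hi.isContactOn_bindingTangent hk).1
    (fun x hx ↦ L.dFactor_eq_zero hx.2) (fun x hx ↦ hhv x hx.2)
    (fun x hx ↦ by
      have hx' : dmap L.pr q x = 0 := hx.2
      rw [radial_apply, hx', mul_zero, Complex.zero_re]) hlh.ne' hw.ne
    (by
      have h2 := hi.exists_sub_smul_mem hz hwk hh hhv
      exact ⟨_, h2.2, h2.1⟩)
    (fun l ↦ by
      have h2 := hi.exists_sub_smul_mem hz (hek l) hh hhv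
      exact ⟨_, h2.2, h2.1⟩)
  refine lt_of_lt_of_eq ?_ h1.symm
  have h3 : L.radial t q w / L.radial t q h < 0 := div_neg_of_neg_of_pos hw hlh
  have h4 : 0 < L.factor q ^ m := pow_pos (L.factor_pos q) m
  -- Two signs cancel: `w` points toward the binding while `h` points away from it, and `dg(h)` is
  -- negative.
  exact mul_pos_of_neg_of_neg h3 (mul_neg_of_pos_of_neg (by positivity)
    (mul_neg_of_neg_of_pos (mul_neg_of_neg_of_pos hδh h4) hpos))

/-- The contact form on the binding, extended to the nearby pages by projection along a vector
field transverse to the binding, remains positive. -/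
theorem eventually_contactVol_pos {t : ℂ} {p : E} {s : Set E}
    {w : ∀ q : E, TangentSpace (Cor (2 * m + 4)) q}
    {e : Fin (2 * m + 1) → ∀ q : E, TangentSpace (Cor (2 * m + 4)) q}
    (hw : ContinuousWithinAt (fun q ↦ (⟨q, w q⟩ : TangentBundle (Cor (2 * m + 4)) E)) s p)
    (he : ∀ l, ContinuousWithinAt (fun q ↦ (⟨q, e l q⟩ : TangentBundle (Cor (2 * m + 4)) E)) s p)
    (hwp : L.radial t p (w p) ≠ 0) (hep : ∀ l, L.radial t p (e l p) = 0)
    (hpos : 0 < contactVol m (L.α p) (L.α.d p) (fun l ↦ e l p)) :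
    ∀ᶠ q in 𝓝[s] p, 0 < contactVol m (L.α q) (L.α.d q)
      (fun l ↦ e l q + (-(L.radial t q (e l q) / L.radial t q (w q))) • w q) := by
  have hs := L.exact_symplectic.smooth
  have hr : ∀ l, Tendsto (fun q ↦ -(L.radial t q (e l q) / L.radial t q (w q))) (𝓝[s] p)
      (𝓝 0) := by
    intro l
    have h1 := ((continuousWithinAt_radial (L := L) t (he l)).tendsto.div
      (continuousWithinAt_radial (L := L) t hw).tendsto hwp).neg
    rwa [hep, zero_div, neg_zero] at h1
  have h2 : Tendsto (fun q ↦ contactVol m (L.α q) (L.α.d q)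
      (fun l ↦ e l q + (-(L.radial t q (e l q) / L.radial t q (w q))) • w q)) (𝓝[s] p)
      (𝓝 (contactVol m (L.α p) (L.α.d p) (fun l ↦ e l p))) := by
    refine tendsto_contactVol (fun l ↦ ?_) fun l l' ↦ ?_
    · have h1 := (hs.continuousWithinAt_apply (he l)).tendsto.add
        ((hr l).mul (hs.continuousWithinAt_apply hw).tendsto)
      rw [zero_mul, add_zero] at h1
      refine h1.congr fun q ↦ ?_
      rw [map_add, map_smul, smul_eq_mul]
    · have h1 := ((hs.continuousWithinAt_d (he l) (he l')).tendsto.add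
        ((hr l').mul (hs.continuousWithinAt_d (he l) hw).tendsto)).add
        ((hr l).mul (hs.continuousWithinAt_d hw (he l')).tendsto)
      rw [zero_mul, zero_mul, add_zero, add_zero] at h1
      exact h1.congr fun q ↦ (OneForm.d_add_smul _ _ _ _ _ _ _).symm
  exact h2.eventually (lt_mem_nhds hpos)

theorem isAdapted_mulFun_factor (L : CompatibleExactLefschetzFibration m E X) :
    IsAdapted L.pr (L.α.mulFun L.factor) where
  binding_contact := by
    rintro p ⟨-, hp⟩ i hi
    have h1 : L.IsHorizontalFace p i := .of_norm_lt hi (by simp [hp])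
    rw [L.mulFun_factor_d_binding hp]
    exact (h1.isContactOn_bindingTangent hi).smul (L.factor_pos p).ne'
  page_symplectic := by
    rintro t - p ⟨-, hz, -⟩ i hi
    rcases isHorizontalFace_or_isVerticalFace (L := L) hi with h | h
    · exact h.isSymplecticOn_pageTangent hi hz
    · exact h.isSymplecticOn_pageTangent hi
  page_oriented := by
    rintro t - p ⟨-, hz, -⟩ i k hi hk hik u hu hku w hw hiw e hli he
    rcases isHorizontalFace_or_isVerticalFace (L := L) hi with h | h <;>
      rcases isHorizontalFace_or_isVerticalFace (L := L) hk with h' | h'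
    · exact wedgePow_mul_neg_of_isHorizontalFace hz h h' hi hk hu hku hw hiw hli he
    · refine wedgePow_mul_neg_of_isHorizontalFace_of_isVerticalFace h h' hi hu hku hw hiw hli
        fun l ↦ ⟨h'.mem_vert_of_dcoord (he l).2 (he l).1.2, (he l).1.1⟩
    · rw [mul_comm]
      refine wedgePow_mul_neg_of_isHorizontalFace_of_isVerticalFace h' h hk hw hiw hu hku hli
        fun l ↦ ⟨h.mem_vert_of_dcoord (he l).1.1 (he l).1.2, (he l).2⟩
    · exact (not_isVerticalFace_of_ne hik h h').elim
  orientation := by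
    rintro t ht p ⟨-, hp⟩ i hi w e hw he hev hwi ⟨s, hs, hws⟩ hei hpos
    -- Out of the page means toward decreasing radius; since `|t| = 1`, the radial component of `w
    -- p` is `-s`.
    have hwp : L.radial t p (w p) < 0 := by
      have h1 : conj t * -(s * t : ℂ) = ((-s : ℝ) : ℂ) := by
        have h2 : t * conj t = 1 := by
          rw [Complex.mul_conj, Complex.normSq_eq_norm_sq, ht]
          norm_num
        push_cast
        linear_combination (-s : ℂ) * h2
      rw [radial_apply, hws, h1, Complex.ofReal_re]
      linarith
    have hep : ∀ l, L.radial t p (e l p) = 0 := by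
      intro l
      have h1 : dmap L.pr p (e l p) = 0 := (hei l).2
      rw [radial_apply, h1, mul_zero, Complex.zero_re]
    have hpos' : 0 < contactVol m (L.α p) (L.α.d p) (fun l ↦ e l p) := by
      have h1 := contactVol_smul m (L.factor p) (L.factor p) (L.α p) (L.α.d p) (fun l ↦ e l p)
      rw [L.mulFun_factor_d_binding hp] at hpos
      have h2 := hpos.trans_eq h1
      have h3 := L.factor_pos p
      exact (mul_pos_iff_of_pos_left (by positivity)).1 h2
    have hnorm : ∀ᶠ q in 𝓝[page (2 * m + 4) L.pr t] p, ‖L.pr q‖ < 2 := by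
      refine mem_nhdsWithin_of_mem_nhds ?_
      exact L.pr_smooth.continuous.norm.continuousAt.eventually
        (gt_mem_nhds (by simp [hp]))
    filter_upwards [eventually_contactVol_pos hw he hwp.ne hep hpos', hnorm, hev,
      self_mem_nhdsWithin, (continuousWithinAt_radial (L := L) t hw).eventually
        (gt_mem_nhds hwp)] with q h1 h2 h3 h4 h5
    exact wedgePow_cons_pos_of_mem_page h4 h2 h3 h5 h1

end CompatibleExactLefschetzFibration
end Orientation
end ExactLefschetz

/-! ### The main theorem -/

open ExactLefschetz in
theorem mainTheorem3 (m : ℕ) {E X : Type*}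
    [TopologicalSpace E] [T2Space E] [CompactSpace E]
    [ChartedSpace (EuclideanQuadrant (2 * m + 4)) E] [IsManifold (Cor (2 * m + 4)) ∞ E]
    [TopologicalSpace X] [T2Space X] [CompactSpace X] [ConnectedSpace X]
    [ChartedSpace (EuclideanHalfSpace (2 * m + 2)) X] [IsManifold (𝓡∂ (2 * m + 2)) ∞ X]
    (L : CompatibleExactLefschetzFibration m E X)
    (hreg : (0 : ℂ) ∉ L.pr '' critSet (2 * m + 4) L.pr) :
    -- `α` is a contact form on (every face of) the boundary of `E`
    (∀ p i, IsFace p i → IsContactOn (m + 1) (faceTangent p i) (L.α p) (L.α.d p)) ∧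
    -- `dα` is symplectic on every regular fibre
    (∀ p, L.pr p ∈ regularBase (2 * m + 4) L.pr → IsSymplecticOn (m + 1) (vert L.pr p) (L.α.d p)) ∧
    -- `α` is a contact form on the binding, and orients it as the boundary of the fibre
    -- over `0`, oriented by `dα`
    (∀ p ∈ binding (2 * m + 4) L.pr, ∀ i, IsFace p i →
      IsContactOn m (bindingTangent L.pr p i) (L.α p) (L.α.d p) ∧
      ∀ w ∈ vert L.pr p, dcoord p i w < 0 →
        ∀ e : Fin (2 * m + 1) → TangentSpace (Cor (2 * m + 4)) p,
          (∀ l, e l ∈ bindingTangent L.pr p i) →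
          0 < contactVol m (L.α p) (L.α.d p) e →
          0 < wedgePow (m + 1) (L.α.d p) (Fin.cons w e : Fin (2 * m + 1 + 1) → _)) ∧
    -- the contact structure `ker α` on `∂E` is carried by the induced open book: it has
    -- a contact form `g α`, equal to `α` on the vertical boundary, adapted to the open book
    ∃ g : E → ℝ, ContMDiff (Cor (2 * m + 4)) 𝓘(ℝ, ℝ) ∞ g ∧ (∀ p, 0 < g p) ∧
      (∀ p, ‖L.pr p‖ = 2 → g p = 1) ∧ IsAdapted L.pr (L.α.mulFun g) := by
  refine ⟨fun p i hi ↦ CompatibleExactLefschetzFibration.isContactOn_faceTangent hi,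
    fun p hp ↦ L.isSymplecticOn_vert ?_, fun p hp i hi ↦ ?_, L.factor, L.contMDiff_factor,
    L.factor_pos, fun p hp ↦ L.factor_eq_one hp, L.isAdapted_mulFun_factor⟩
  · by_contra h
    exact hp.2 ⟨p, h, rfl⟩
  · have h1 : L.IsHorizontalFace p i := .of_norm_lt hi (by simp [hp.2])
    exact ⟨h1.isContactOn_bindingTangent hi, fun w hw hwi e he hpos ↦
      h1.wedgePow_cons_pos hi hw hwi he hpos⟩
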